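/- Let $T>0$ and let $\mathbb T^2=\mathbb R^2/(2\pi\mathbb Z)^2$. For a periodic field $u=\sum_{k\in\mathbb Z^2}\hat u_k e^{ik\cdot x}$ with values in $\mathbb R^2$ put $\|u\|_{H^{s}}^2=\sum_k(1+|k|^2)^s|\hat u_k|^2$ and $\|u\|_{H^{s,s'}}^2=\sum_k(1+k_1^2)^s(1+k_2^2)^{s'}|\hat u_k|^2$. Let $\tilde H^{s,s'}$ be the space of real divergence-free fields with $\|u\|_{H^{s,s'}}<\infty$, let $H=\tilde H^{0,0}$, and let $H^{-1}$ be the space of real fields with $\|u\|_{H^{-1}}<\infty$. Let $P_H$ be the Leray projection onto divergence-free fields and $B(u,v)=P_H(u\cdot\nabla v)$. Let $\sigma$ be a Borel measurable map on $[0,T]\times H$ with values in the Hilbert–Schmidt operators $L_2(l^2,H^{-1})$ such that, for some nonnegative constants $K_0',K_1',K_0,K_1,K_2,\tilde K_0,\tilde K_1,\tilde K_2$ and all $t\in[0,T]$: (A0) $\|\sigma(t,u)\|^2_{L_2(l^2,H^{-1})}\le K_0'+K_1'\|u\|_H^2$ for $u\in H$; (A1) $\sigma(t,u)\in L_2(l^2,H)$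 and $\|\sigma(t,u)\|^2_{L_2(l^2,H)}\le K_0+K_1\|u\|_H^2+K_2\|\partial_1u\|_H^2$ for $u\in\tilde H^{1,0}$; (A2) $\sigma(t,u)\in L_2(l^2,\tilde H^{0,1})$ and $\|\sigma(t,u)\|^2_{L_2(l^2,H^{0,1})}\le \tilde K_0+\tilde K_1\|u\|_{H^{0,1}}^2+\tilde K_2(\|\partial_1u\|_H^2+\|\partial_1\partial_2u\|_H^2)$ for $u\in\tilde H^{1,1}$. Put $\mathcal X=L^\infty([0,T],\tilde H^{0,1})\cap L^2([0,T],\tilde H^{1,1})\cap C([0,T],H^{-1})$. Let $u_0\in\tilde H^{0,2}$ and $\varphi\in L^2([0,T],l^2)$. Then the deterministic equation $$du^0=\partial_1^2u^0\,dt-B(u^0,u^0)\,dt,\qquad u^0(0)=u_0,$$ has a unique solution $u^0\in\mathcal X$, and, for this $u^0$, the linearized skeleton equation $$dX=\partial_1^2X\,dt-B(X,u^0)\,dt-B(u^0,X)\,dt+\sigma(t,u^0)\varphi\,dt,\qquad X(0)=0,$$ has a unique solution $X\in\mathcal X$. Both equations are understood in the sense of periodic distributions, integrated in time: for all $t\in[0,T]$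 the equation $X(t)=X(0)+\int_0^t F(s)\,ds$ holds for every Fourier coefficient, with $F$ the right-hand side, whose Fourier coefficients are integrable on $[0,T]$. Uniqueness means equality at every $t\in[0,T]$. -/

import Mathlib

open MeasureTheory Filter Topology
open scoped ENNReal NNReal ComplexConjugate

noncomputable section

namespace AnisoNS

/-! Fields on the torus `𝕋² = ℝ²/(2πℤ)²` are represented by their Fourier coefficients:
`u k j` is the coefficient `û_k` of the `j`-th component in `u(x) = ∑_k û_k e^{i k·x}`.
The horizontal variable `x₁` has index `0`, the vertical variable `x₂` has index `1`. -/

/-- Frequencies `k ∈ ℤ²`. -/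
abbrev Freq := Fin 2 → ℤ

/-- Periodic two-component (complex) fields, as families of Fourier coefficients. The topology and
the measurable structure are those of a product: every single Fourier coefficient is continuous,
respectively measurable. -/
abbrev VField := Freq → Fin 2 → ℂ

/-- The real Hilbert space `l²`. -/
abbrev EllTwo := lp (fun _ : ℕ => ℝ) 2

/-- The field is real-valued: `û_{-k}` is the complex conjugate of `û_k`. -/
def IsRealField (u : VField) : Prop := ∀ k j, u (-k) j = conj (u k j)

/-- The field has zero divergence: `k · û_k = 0`. -/
def IsDivFree (u : VField) : Prop := ∀ k : Freq, ∑ j, (k j : ℂ) * u k j = 0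

/-- `∑_k (1 + |k|²)^s |û_k|²`, the square of the `H^s` norm (infinite outside `H^s`). -/
def sobolevSq (s : ℝ) (u : VField) : ℝ≥0∞ :=
  ∑' k : Freq, ENNReal.ofReal ((1 + ((k 0 : ℝ) ^ 2 + (k 1 : ℝ) ^ 2)) ^ s) * ∑ j, ‖u k j‖ₑ ^ 2

/-- `∑_k (1 + |k₁|²)^s (1 + |k₂|²)^s' |û_k|²`, the square of the anisotropic `H^{s,s'}` norm
(infinite outside `H^{s,s'}`). For `s = s' = 0` this is the square of the norm of `H`. -/
def anisoSq (s s' : ℝ) (u : VField) : ℝ≥0∞ :=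
  ∑' k : Freq, ENNReal.ofReal ((1 + (k 0 : ℝ) ^ 2) ^ s * (1 + (k 1 : ℝ) ^ 2) ^ s') *
    ∑ j, ‖u k j‖ₑ ^ 2

/-- The space `H^s(𝕋²; ℝ²)`. -/
def SobolevSpace (s : ℝ) : Set VField := {u | IsRealField u ∧ sobolevSq s u < ∞}

/-- The space `H̃^{s,s'}` of divergence-free fields in `H^{s,s'}(𝕋²; ℝ²)`. -/
def AnisoSpace (s s' : ℝ) : Set VField := {u | IsRealField u ∧ IsDivFree u ∧ anisoSq s s' u < ∞}

/-- The space `H` of divergence-free fields in `L²(𝕋²; ℝ²)`. -/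
abbrev SpaceH : Set VField := AnisoSpace 0 0

/-- The partial derivative `∂_i`, in the sense of distributions. -/
def partialDeriv (i : Fin 2) (u : VField) : VField := fun k j => Complex.I * (k i : ℂ) * u k j

/-- The Leray projection `P_H u = u - ∇ Δ⁻¹ (div u)`; the mean value (`k = 0`) is left unchanged. -/
def leray (u : VField) : VField := fun k j =>
  u k j - (k j : ℂ) * (∑ i, (k i : ℂ) * u k i) / (∑ i, (k i : ℂ) ^ 2)

/-- The Fourier coefficients of `u · ∇ v = ∑_i uⁱ ∂_i v`: the coefficients of a product are the
convolution of the coefficients of its factors, see `advection_eq_mFourierCoeff`. -/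
def advection (u v : VField) : VField := fun k j =>
  ∑' l : Freq, ∑ i, u (k - l) i * partialDeriv i v l j

/-- `B(u, v) = P_H (u · ∇ v)`. -/
def bilinB (u v : VField) : VField := leray (advection u v)

/-- The normalised Lebesgue measure of the two-dimensional torus. -/
abbrev torusMeasure : Measure (UnitAddTorus (Fin 2)) :=
  Measure.pi fun _ => (AddCircle.haarAddCircle : Measure UnitAddCircle)

theorem hasSum_mFourierCoeff_mul (f g : Lp ℂ 2 torusMeasure) (k : Freq) :
    HasSum (fun l : Freq => UnitAddTorus.mFourierCoeff f (k - l) * UnitAddTorus.mFourierCoeff g l)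
      (UnitAddTorus.mFourierCoeff (fun x => f x * g x) k) := by
  have hm : MemLp (fun x => conj (UnitAddTorus.mFourier (-k) x * f x)) 2 torusMeasure := by
    have h1 : MemLp (fun x => UnitAddTorus.mFourier (-k) x * f x) 2 torusMeasure := by
      refine (Lp.memLp f).of_le_mul (c := 1) ?_ ?_
      · exact (UnitAddTorus.mFourier (-k)).continuous.aestronglyMeasurable.mul
          (Lp.memLp f).aestronglyMeasurable
      · refine Eventually.of_forall fun x => ?_
        rw [norm_mul]
        have := (UnitAddTorus.mFourier (-k)).norm_coe_le_norm x
        rw [UnitAddTorus.mFourier_norm] at this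
        gcongr
    exact h1.star
  have h := UnitAddTorus.hasSum_prod_mFourierCoeff (hm.toLp _) g
  have hae := hm.coeFn_toLp
  convert h using 1
  · funext l
    congr 1
    unfold UnitAddTorus.mFourierCoeff
    rw [← integral_conj]
    refine integral_congr_ae ?_
    filter_upwards [hae] with x hx
    rw [hx]
    simp only [smul_eq_mul, map_mul, ← UnitAddTorus.mFourier_neg, Complex.conj_conj, neg_neg]
    rw [← mul_assoc, ← UnitAddTorus.mFourier_add]
    congr 3
    abel
  · unfold UnitAddTorus.mFourierCoeff
    refine integral_congr_ae ?_
    filter_upwards [hae] with x hx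
    rw [hx, Complex.conj_conj, smul_eq_mul, mul_assoc]

/-- If `uⁱ` and `∂_i vʲ` are square integrable functions on the torus (in the variable
`y = x / 2π`), then `advection u v` consists of the Fourier coefficients of the pointwise product
`∑_i uⁱ ∂_i vʲ`. -/
theorem advection_eq_mFourierCoeff (u v : VField) (j : Fin 2) (f g : Fin 2 → Lp ℂ 2 torusMeasure)
    (hf : ∀ i k, UnitAddTorus.mFourierCoeff (f i) k = u k i)
    (hg : ∀ i k, UnitAddTorus.mFourierCoeff (g i) k = partialDeriv i v k j) (k : Freq) :
    advection u v k j = UnitAddTorus.mFourierCoeff (fun x => ∑ i, f i x * g i x) k := by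
  have hs := hasSum_sum fun i (_ : i ∈ Finset.univ) => hasSum_mFourierCoeff_mul (f i) (g i) k
  simp only [hf, hg] at hs
  unfold advection
  rw [hs.tsum_eq]
  unfold UnitAddTorus.mFourierCoeff
  simp only [smul_eq_mul, Finset.mul_sum]
  rw [integral_finsetSum]
  intro i _
  have h1 : Integrable (fun x => f i x * g i x) torusMeasure :=
    MemLp.integrable_mul (Lp.memLp (f i)) (Lp.memLp (g i))
  refine h1.bdd_mul (c := 1) (UnitAddTorus.mFourier (-k)).continuous.aestronglyMeasurable
    (Eventually.of_forall fun x => ?_)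
  have := (UnitAddTorus.mFourier (-k)).norm_coe_le_norm x
  rwa [UnitAddTorus.mFourier_norm] at this

/-- `∑_n N (A e_n)` for the standard basis `(e_n)` of `l²`. If `N` is the square of the norm of a
Hilbert space `X` of fields, this is the square of the norm of `A` in `L₂(l², X)`. A linear map
`A` with continuous Fourier coefficients is a Hilbert-Schmidt operator from `l²` to `X`
if and only if this sum is finite. -/
def hilbertSchmidtSq (N : VField → ℝ≥0∞) (A : EllTwo →L[ℝ] VField) : ℝ≥0∞ :=
  ∑' n : ℕ, N (A (lp.single 2 n 1))

/-- Joint Borel measurability of the coefficient `σ` on `[0,T] × H`. -/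
def MeasurableCoeff (T : ℝ) (σ : ℝ → VField → EllTwo →L[ℝ] VField) : Prop :=
  ∀ a : EllTwo, Measurable fun p : Set.Icc (0 : ℝ) T × SpaceH => σ p.1 p.2 a

/-- Growth condition (A0): `‖σ(t,u)‖²_{L₂(l²,H⁻¹)} ≤ K₀' + K₁' ‖u‖²_H`. -/
def GrowthA0 (T : ℝ) (σ : ℝ → VField → EllTwo →L[ℝ] VField) : Prop :=
  ∃ K₀ K₁ : ℝ≥0, ∀ t ∈ Set.Icc 0 T, ∀ u ∈ SpaceH,
    (∀ a, σ t u a ∈ SobolevSpace (-1)) ∧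
    hilbertSchmidtSq (sobolevSq (-1)) (σ t u) ≤ K₀ + K₁ * anisoSq 0 0 u

/-- Growth condition (A1): `‖σ(t,u)‖²_{L₂(l²,H)} ≤ K₀ + K₁ ‖u‖²_H + K₂ ‖∂₁u‖²_H`. -/
def GrowthA1 (T : ℝ) (σ : ℝ → VField → EllTwo →L[ℝ] VField) : Prop :=
  ∃ K₀ K₁ K₂ : ℝ≥0, ∀ t ∈ Set.Icc 0 T, ∀ u ∈ AnisoSpace 1 0,
    (∀ a, σ t u a ∈ SpaceH) ∧
    hilbertSchmidtSq (anisoSq 0 0) (σ t u) ≤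
      K₀ + K₁ * anisoSq 0 0 u + K₂ * anisoSq 0 0 (partialDeriv 0 u)

/-- Growth condition (A2):
`‖σ(t,u)‖²_{L₂(l²,H^{0,1})} ≤ K₀ + K₁ ‖u‖²_{H^{0,1}} + K₂ (‖∂₁u‖²_H + ‖∂₁∂₂u‖²_H)`. -/
def GrowthA2 (T : ℝ) (σ : ℝ → VField → EllTwo →L[ℝ] VField) : Prop :=
  ∃ K₀ K₁ K₂ : ℝ≥0, ∀ t ∈ Set.Icc 0 T, ∀ u ∈ AnisoSpace 1 1,
    (∀ a, σ t u a ∈ AnisoSpace 0 1) ∧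
    hilbertSchmidtSq (anisoSq 0 1) (σ t u) ≤
      K₀ + K₁ * anisoSq 0 1 u +
        K₂ * (anisoSq 0 0 (partialDeriv 0 u) + anisoSq 0 0 (partialDeriv 0 (partialDeriv 1 u)))

/-- `X ∈ L^∞([0,T], H̃^{0,1}) ∩ L²([0,T], H̃^{1,1}) ∩ C([0,T], H⁻¹)`. -/
structure InSolutionClass (T : ℝ) (X : ℝ → VField) : Prop where
  aemeasurable : AEMeasurable X (volume.restrict (Set.Icc 0 T))
  memLinfty : ∃ C : ℝ≥0, ∀ᵐ t ∂volume.restrict (Set.Icc 0 T),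
    X t ∈ AnisoSpace 0 1 ∧ anisoSq 0 1 (X t) ≤ C
  memL2 : ∀ᵐ t ∂volume.restrict (Set.Icc 0 T), X t ∈ AnisoSpace 1 1
  memL2_norm : ∫⁻ t in Set.Icc 0 T, anisoSq 1 1 (X t) < ∞
  mem_neg_one : ∀ t ∈ Set.Icc 0 T, X t ∈ SobolevSpace (-1)
  continuous_neg_one : ∀ t ∈ Set.Icc 0 T,
    Tendsto (fun s => sobolevSq (-1) (X s - X t)) (𝓝[Set.Icc 0 T] t) (𝓝 0)

/-- `dX = F dt`, `X(0) = x₀`, on `[0,T]`, in the sense of periodic distributions: for every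
Fourier coefficient, `X(t) = x₀ + ∫₀ᵗ F(s) ds`, where the integral converges absolutely. -/
def SolvesOn (T : ℝ) (x₀ : VField) (F X : ℝ → VField) : Prop :=
  ∀ k j, IntervalIntegrable (fun s => F s k j) volume 0 T ∧
    ∀ t ∈ Set.Icc 0 T, X t k j = x₀ k j + ∫ s in (0 : ℝ)..t, F s k j

/-- `u` is a solution of `du = ∂₁² u dt - B(u, u) dt`, `u(0) = u₀`. -/
def IsDeterministicSolution (T : ℝ) (u₀ : VField) (u : ℝ → VField) : Prop :=
  InSolutionClass T u ∧
    SolvesOn T u₀ (fun s => partialDeriv 0 (partialDeriv 0 (u s)) - bilinB (u s) (u s)) u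

/-- `X` is a solution of the linearized skeleton equation
`dX = ∂₁² X dt - B(X, u) dt - B(u, X) dt + σ(t, u) φ dt`, `X(0) = 0`. -/
def IsSkeletonSolution (T : ℝ) (σ : ℝ → VField → EllTwo →L[ℝ] VField) (u : ℝ → VField)
    (φ : ℝ → EllTwo) (X : ℝ → VField) : Prop :=
  InSolutionClass T X ∧
    SolvesOn T 0 (fun s => partialDeriv 0 (partialDeriv 0 (X s)) - bilinB (X s) (u s)
      - bilinB (u s) (X s) + σ s (u s) (φ s)) X

end AnisoNS

end

open MeasureTheory Filter Topology
open scoped ENNReal NNReal ComplexConjugate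

noncomputable section

namespace AnisoNS

/-! The viscosity acts only in the horizontal variable, so every estimate has to spend horizontal
derivatives sparingly. The basic tool is `convForm_le`, the Fourier form of the inequality that puts
one factor of a triple product in sup-in-x₁, L²-in-x₂, another in sup-in-x₂, L²-in-x₁, and the third
in L². Each sup norm costs one derivative in one variable (`tsum_le_weighted`). The missing vertical
derivatives come from incompressibility: ∂₂u² = -∂₁u¹, so the vertical component, which multiplies
the bad derivative ∂₂, is smooth in x₂ at the price of a horizontal derivative
(`enorm_partialDeriv_divFree`).

Existence uses Galerkin truncation to square boxes of frequencies. The L² energy law gives a bound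
on ∫‖∂₁u‖² in time. In the H^{0,1} estimate of the deterministic equation the only surviving cubic
term is ∫(∂₂u·∇u)·∂₂u. Its part with first component ∂₂u¹ cancels by div u = 0
(`tri_partial_cancel`), and what is left contains two horizontal derivatives. By interpolation it is
at most ‖∂₁∂₂u‖² plus a multiple of ‖∂₂u‖²‖∂₁u‖² plus lower terms (`two_mul_norm_tri_partial_le`).
The first is absorbed by the dissipation and the second is a Gronwall term with an integrable
factor, so the bound is global. Then H^{0,2} is propagated by an inequality that is linear in its
own norm. The skeleton equation is linear, but its H^{0,1} estimate contains ∂₂²u⁰. This is where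
the H^{0,2} regularity of u₀ enters (`triAbs_partial_middle_le`).

The truncated systems are finite-dimensional quadratic equations, solved globally by
`exists_solution_of_bound`. Every Fourier coefficient is equicontinuous in time uniformly in the
truncation, so a diagonal Arzelà–Ascoli argument gives a limit. In divergence form a coefficient of
B is a convergent series whose tail is uniformly small under an L²(H^{1,1}) bound, so the integrated
equations pass to the limit (`tendsto_integral_bilinB`, `exists_galerkin_limit`).

For uniqueness, the difference w of two solutions satisfies a linear advection equation with
coefficients in the solution class. One term vanishes by `tri_self`. The other is bounded by ‖w‖_H
‖w‖_{H^{1,0}} ‖a‖_{H^{1,1}}, without vertical derivatives of w, so L² energy and Gronwall give w =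
0. The energy identity is first proved on boxes of frequencies, where it is elementary, and then
extended by dominated convergence (`eq_zero_of_solvesOn`). -/

/-! ### Mixed sequence norms and the anisotropic trilinear inequality -/

/-- The `ℓ²` norm, with values in `[0,∞]`. -/
def ellTwoNorm {ι : Type*} (f : ι → ℝ≥0∞) : ℝ≥0∞ := (∑' i, f i ^ 2) ^ (1 / 2 : ℝ)

theorem ellTwoNorm_sq {ι : Type*} (f : ι → ℝ≥0∞) : ellTwoNorm f ^ 2 = ∑' i, f i ^ 2 := by
  rw [ellTwoNorm, ← ENNReal.rpow_natCast, ← ENNReal.rpow_mul]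
  norm_num

theorem rpow_half_sq (x : ℝ≥0∞) : (x ^ 2) ^ (1 / 2 : ℝ) = x := by
  rw [← ENNReal.rpow_natCast, ← ENNReal.rpow_mul]
  norm_num

theorem rpow_half_pow_two (x : ℝ≥0∞) : (x ^ (1 / 2 : ℝ)) ^ 2 = x := by
  rw [← ENNReal.rpow_natCast, ← ENNReal.rpow_mul]
  norm_num

theorem tsum_prod_ennreal {ι κ : Type*} (f : ι × κ → ℝ≥0∞) :
    ∑' x, f x = ∑' (i : ι) (j : κ), f (i, j) :=
  ENNReal.tsum_prod (f := fun i j => f (i, j))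

theorem tsum_mul_le_ellTwoNorm {ι : Type*} (f g : ι → ℝ≥0∞) :
    ∑' i, f i * g i ≤ ellTwoNorm f * ellTwoNorm g := by
  let _ : MeasurableSpace ι := ⊤
  have h := ENNReal.lintegral_mul_le_Lp_mul_Lq (Measure.count : Measure ι)
    (p := 2) (q := 2) Real.HolderConjugate.two_two (f := f) (g := g)
    (measurable_from_top.aemeasurable) (measurable_from_top.aemeasurable)
  simpa [lintegral_count, ellTwoNorm] using h

theorem ellTwoNorm_comp_equiv {ι κ : Type*} (e : ι ≃ κ) (f : κ → ℝ≥0∞) :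
    ellTwoNorm (fun i => f (e i)) = ellTwoNorm f := by
  unfold ellTwoNorm
  rw [e.tsum_eq (fun i => f i ^ 2)]

theorem ellTwoNorm_mul_prod {ι κ : Type*} (f : ι → ℝ≥0∞) (g : κ → ℝ≥0∞) :
    ellTwoNorm (fun x : ι × κ => f x.1 * g x.2) = ellTwoNorm f * ellTwoNorm g := by
  unfold ellTwoNorm
  rw [← ENNReal.mul_rpow_of_nonneg _ _ (by norm_num), tsum_prod_ennreal]
  congr 1
  simp_rw [mul_pow, ENNReal.tsum_mul_left, ENNReal.tsum_mul_right]

/-- The trilinear convolution form `∑_{p+q+r=0} f_p g_q h_r`. -/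
def convForm (f g h : Freq → ℝ≥0∞) : ℝ≥0∞ :=
  ∑' x : Freq × Freq, f x.1 * g x.2 * h (-(x.1 + x.2))

/-- The pairs of frequencies `(p, q) ↦ (p, r)` with `p + q + r = 0`. -/
def swapLast : Freq × Freq ≃ Freq × Freq where
  toFun x := (x.1, -(x.1 + x.2))
  invFun x := (x.1, -(x.1 + x.2))
  left_inv x := by ext <;> simp
  right_inv x := by ext <;> simp

theorem convForm_swap_left (f g h : Freq → ℝ≥0∞) : convForm f g h = convForm g f h := by
  unfold convForm
  rw [← (Equiv.prodComm Freq Freq).tsum_eq]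
  refine tsum_congr fun x => ?_
  simp only [Equiv.prodComm_apply, Prod.fst_swap, Prod.snd_swap]
  rw [mul_comm (f _), add_comm]

theorem convForm_swap_right (f g h : Freq → ℝ≥0∞) : convForm f g h = convForm f h g := by
  unfold convForm
  rw [← swapLast.tsum_eq]
  refine tsum_congr fun x => ?_
  simp only [swapLast, Equiv.coe_fn_mk]
  rw [mul_right_comm]
  congr 2
  abel_nf

/-- The norm of `ℓ¹_{k₁}(ℓ²_{k₂})`. -/
def mixedNormFst (f : Freq → ℝ≥0∞) : ℝ≥0∞ := ∑' n : ℤ, ellTwoNorm fun m : ℤ => f ![n, m]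

/-- The norm of `ℓ¹_{k₂}(ℓ²_{k₁})`. -/
def mixedNormSnd (f : Freq → ℝ≥0∞) : ℝ≥0∞ := ∑' m : ℤ, ellTwoNorm fun n : ℤ => f ![n, m]

theorem tsum_freq (f : Freq → ℝ≥0∞) : ∑' k, f k = ∑' n : ℤ, ∑' m : ℤ, f ![n, m] := by
  rw [← (finTwoArrowEquiv ℤ).symm.tsum_eq, tsum_prod_ennreal]
  rfl

theorem tsum_freq' (f : Freq → ℝ≥0∞) : ∑' k, f k = ∑' m : ℤ, ∑' n : ℤ, f ![n, m] := by
  rw [tsum_freq, ENNReal.tsum_comm]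

/-- Fix the horizontal frequency n of f and the vertical frequency b of g. The remaining summation
variables are the vertical frequency of f and the horizontal one of g: f and g then form a product
of functions of separate variables, while the argument of h runs bijectively over all frequencies.
Cauchy–Schwarz bounds this inner sum, and summing over n and b produces the two ℓ¹(ℓ²) norms. -/
theorem convForm_le (f g h : Freq → ℝ≥0∞) :
    convForm f g h ≤ mixedNormFst f * mixedNormSnd g * ellTwoNorm h := by
  have key : ∀ n b : ℤ, ∑' x : ℤ × ℤ, f ![n, x.1] * g ![x.2, b] * h (-(![n, x.1] + ![x.2, b])) ≤
      (ellTwoNorm fun m : ℤ => f ![n, m]) * (ellTwoNorm fun a : ℤ => g ![a, b]) *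
        ellTwoNorm h := by
    intro n b
    refine (tsum_mul_le_ellTwoNorm (fun x : ℤ × ℤ => f ![n, x.1] * g ![x.2, b]) _).trans ?_
    rw [ellTwoNorm_mul_prod (fun m => f ![n, m]) (fun a => g ![a, b])]
    gcongr
    let e : ℤ × ℤ ≃ Freq :=
      { toFun := fun x => -(![n, x.1] + ![x.2, b])
        invFun := fun k => (-(k 1) - b, -(k 0) - n)
        left_inv := fun x => by ext <;> simp
        right_inv := fun k => by
          funext i
          fin_cases i <;> simp }
    exact (ellTwoNorm_comp_equiv e h).le
  calc convForm f g h
      = ∑' (n : ℤ) (b : ℤ), ∑' x : ℤ × ℤ,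
          f ![n, x.1] * g ![x.2, b] * h (-(![n, x.1] + ![x.2, b])) := by
        unfold convForm
        rw [tsum_prod_ennreal, tsum_freq]
        refine tsum_congr fun n => ?_
        simp_rw [tsum_freq' (fun q => f ![n, _] * g q * h (-(![n, _] + q)))]
        rw [ENNReal.tsum_comm]
        exact tsum_congr fun b => (tsum_prod_ennreal fun x : ℤ × ℤ =>
          f ![n, x.1] * g ![x.2, b] * h (-(![n, x.1] + ![x.2, b]))).symm
    _ ≤ ∑' (n : ℤ) (b : ℤ), (ellTwoNorm fun m : ℤ => f ![n, m]) *
          (ellTwoNorm fun a : ℤ => g ![a, b]) * ellTwoNorm h :=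
        ENNReal.tsum_le_tsum fun n => ENNReal.tsum_le_tsum fun b => key n b
    _ = mixedNormFst f * mixedNormSnd g * ellTwoNorm h := by
        simp_rw [ENNReal.tsum_mul_right, ENNReal.tsum_mul_left, ENNReal.tsum_mul_right]
        rfl

/-- A telescoping sum: l / (l² + (n+1)²) is at most 2l / ((l+n)(l+n+1)), the difference of
consecutive values of 2l / (l+n), because (l+n+1)² ≤ 2(l² + (n+1)²). The bound is uniform in l. -/
theorem sum_inv_weight_le {l : ℝ} (hl : 1 ≤ l) (N : ℕ) :
    ∑ n ∈ Finset.range N, (l + ((n : ℝ) + 1) ^ 2 / l)⁻¹ ≤ 2 - 2 * l / (l + N) := by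
  have hl0 : 0 < l := by linarith
  induction N with
  | zero => simp [hl0.ne']
  | succ N ih =>
    rw [Finset.sum_range_succ]
    have hN : (0 : ℝ) ≤ N := N.cast_nonneg
    have h1 : (l + ((N : ℝ) + 1) ^ 2 / l)⁻¹ ≤ 2 * l / (l + N) - 2 * l / (l + (N + 1 : ℕ)) := by
      push_cast
      rw [div_sub_div _ _ (by positivity) (by positivity), inv_le_iff_one_le_mul₀ (by positivity),
        div_mul_eq_mul_div, le_div_iff₀ (by positivity)]
      have h2 : (l + ((N : ℝ) + 1) ^ 2 / l) = (l ^ 2 + (N + 1) ^ 2) / l := by field_simp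
      have h3 : (2 * l * (l + (N + 1)) - (l + N) * (2 * l)) * (l + ((N : ℝ) + 1) ^ 2 / l) =
          2 * (l ^ 2 + (N + 1) ^ 2) := by
        rw [h2]; field_simp; ring
      rw [h3]
      nlinarith [sq_nonneg (l - (N + 1))]
    linarith

theorem tsum_inv_weight_le {l : ℝ} (hl : 1 ≤ l) :
    ∑' n : ℤ, (ENNReal.ofReal (l + (n : ℝ) ^ 2 / l))⁻¹ ≤ 5 := by
  have hl0 : 0 < l := by linarith
  have hhalf : ∑' n : ℕ, (ENNReal.ofReal (l + ((n : ℝ) + 1) ^ 2 / l))⁻¹ ≤ 2 := by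
    refine ENNReal.tsum_le_of_sum_range_le fun N => ?_
    have : ∀ n : ℕ, (ENNReal.ofReal (l + ((n : ℝ) + 1) ^ 2 / l))⁻¹ =
        ENNReal.ofReal (l + ((n : ℝ) + 1) ^ 2 / l)⁻¹ := fun n =>
      (ENNReal.ofReal_inv_of_pos (by positivity)).symm
    simp_rw [this]
    rw [← ENNReal.ofReal_sum_of_nonneg (fun n _ => by positivity)]
    refine ENNReal.ofReal_le_of_le_toReal ((sum_inv_weight_le hl N).trans ?_)
    have : 0 ≤ 2 * l / (l + N) := by positivity
    simpa using this
  have hsplit : ∑' n : ℤ, (ENNReal.ofReal (l + (n : ℝ) ^ 2 / l))⁻¹ =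
      ∑' n : ℕ, (ENNReal.ofReal (l + ((n : ℤ) : ℝ) ^ 2 / l))⁻¹ +
      ∑' n : ℕ, (ENNReal.ofReal (l + ((-((n : ℤ) + 1) : ℤ) : ℝ) ^ 2 / l))⁻¹ :=
    (HasSum.of_nat_of_neg_add_one ENNReal.summable.hasSum ENNReal.summable.hasSum).tsum_eq
  rw [hsplit, tsum_eq_zero_add' ENNReal.summable]
  have h0 : (ENNReal.ofReal (l + (((0 : ℕ) : ℤ) : ℝ) ^ 2 / l))⁻¹ ≤ 1 := by
    rw [ENNReal.inv_le_one]
    simpa using hl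
  have h1 : ∑' n : ℕ, (ENNReal.ofReal (l + (((n + 1 : ℕ) : ℤ) : ℝ) ^ 2 / l))⁻¹ ≤ 2 := by
    refine le_trans (le_of_eq ?_) hhalf
    simp
  have h2 : ∑' n : ℕ, (ENNReal.ofReal (l + ((-((n : ℤ) + 1) : ℤ) : ℝ) ^ 2 / l))⁻¹ ≤ 2 := by
    refine le_trans (le_of_eq ?_) hhalf
    refine tsum_congr fun n => ?_
    congr 4
    push_cast
    ring
  calc _ ≤ (1 + 2 + 2 : ℝ≥0∞) := add_le_add (add_le_add h0 h1) h2
    _ = 5 := by norm_num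

/-- Cauchy–Schwarz against the weight l + n²/l, whose reciprocals have sum at most 5 for every l.
With l = 1 this is the one-dimensional embedding of H¹ in the functions with summable coefficients.
With l close to ‖∂F‖/‖F‖ it becomes the interpolation inequality between F and its derivative. -/
theorem tsum_le_weighted (F : ℤ → ℝ≥0∞) {l : ℝ} (hl : 1 ≤ l) :
    ∑' n, F n ≤ (5 * ∑' n : ℤ, ENNReal.ofReal (l + (n : ℝ) ^ 2 / l) * F n ^ 2) ^ (1 / 2 : ℝ) := by
  set w : ℤ → ℝ≥0∞ := fun n => ENNReal.ofReal (l + (n : ℝ) ^ 2 / l) with hw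
  have hl0 : 0 < l := by linarith
  have hw0 : ∀ n, w n ≠ 0 := fun n => by
    rw [hw]; simp only [ne_eq, ENNReal.ofReal_eq_zero, not_le]; positivity
  have hwt : ∀ n, w n ≠ ∞ := fun n => ENNReal.ofReal_ne_top
  have h1 : ∀ n, F n = ((w n)⁻¹) ^ (1 / 2 : ℝ) * ((w n) ^ (1 / 2 : ℝ) * F n) := fun n => by
    rw [← mul_assoc, ← ENNReal.mul_rpow_of_nonneg _ _ (by norm_num),
      ENNReal.inv_mul_cancel (hw0 n) (hwt n), ENNReal.one_rpow, one_mul]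
  calc ∑' n, F n = ∑' n, ((w n)⁻¹) ^ (1 / 2 : ℝ) * ((w n) ^ (1 / 2 : ℝ) * F n) :=
        tsum_congr h1
    _ ≤ _ := tsum_mul_le_ellTwoNorm _ _
    _ ≤ _ := by
      unfold ellTwoNorm
      simp_rw [mul_pow, rpow_half_pow_two]
      rw [← ENNReal.mul_rpow_of_nonneg _ _ (by norm_num)]
      gcongr
      exact tsum_inv_weight_le hl

theorem mixedNormFst_le (f : Freq → ℝ≥0∞) {l : ℝ} (hl : 1 ≤ l) :
    mixedNormFst f ≤
      (5 * ∑' k : Freq, ENNReal.ofReal (l + (k 0 : ℝ) ^ 2 / l) * f k ^ 2) ^ (1 / 2 : ℝ) := by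
  refine (tsum_le_weighted _ hl).trans (le_of_eq ?_)
  congr 2
  rw [tsum_freq]
  refine tsum_congr fun n => ?_
  rw [ellTwoNorm_sq, ← ENNReal.tsum_mul_left]
  simp

theorem mixedNormSnd_le (f : Freq → ℝ≥0∞) {l : ℝ} (hl : 1 ≤ l) :
    mixedNormSnd f ≤
      (5 * ∑' k : Freq, ENNReal.ofReal (l + (k 1 : ℝ) ^ 2 / l) * f k ^ 2) ^ (1 / 2 : ℝ) := by
  refine (tsum_le_weighted _ hl).trans (le_of_eq ?_)
  congr 2
  rw [tsum_freq']
  refine tsum_congr fun n => ?_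
  rw [ellTwoNorm_sq, ← ENNReal.tsum_mul_left]
  simp

/-! ### Anisotropic weights and norms -/

/-- The squared length `|û_k|²`. -/
def ampSq (u : VField) (k : Freq) : ℝ≥0∞ := ∑ j, ‖u k j‖ₑ ^ 2

/-- The weight of the norm of `H^{m,n}`. -/
def anisoWeight (m n : ℕ) (k : Freq) : ℝ := (1 + (k 0 : ℝ) ^ 2) ^ m * (1 + (k 1 : ℝ) ^ 2) ^ n

theorem anisoWeight_pos (m n : ℕ) (k : Freq) : 0 < anisoWeight m n k := by
  unfold anisoWeight; positivity

theorem anisoSq_natCast (m n : ℕ) (u : VField) :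
    anisoSq m n u = ∑' k, ENNReal.ofReal (anisoWeight m n k) * ampSq u k := by
  simp only [anisoSq, Real.rpow_natCast]
  rfl

/-- The norm of `H^{m,n}`. -/
def anisoNorm (m n : ℕ) (u : VField) : ℝ≥0∞ := (anisoSq m n u) ^ (1 / 2 : ℝ)

theorem anisoNorm_sq (m n : ℕ) (u : VField) : anisoNorm m n u ^ 2 = anisoSq m n u :=
  rpow_half_pow_two _

theorem anisoWeight_mono {m n m' n' : ℕ} (hm : m ≤ m') (hn : n ≤ n') (k : Freq) :
    anisoWeight m n k ≤ anisoWeight m' n' k := by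
  unfold anisoWeight
  gcongr <;> nlinarith [sq_nonneg (k 0 : ℝ), sq_nonneg (k 1 : ℝ)]

theorem anisoSq_mono {m n m' n' : ℕ} (hm : m ≤ m') (hn : n ≤ n') (u : VField) :
    anisoSq m n u ≤ anisoSq m' n' u := by
  rw [anisoSq_natCast, anisoSq_natCast]
  gcongr with k
  exact anisoWeight_mono hm hn k

theorem anisoNorm_mono {m n m' n' : ℕ} (hm : m ≤ m') (hn : n ≤ n') (u : VField) :
    anisoNorm m n u ≤ anisoNorm m' n' u :=
  ENNReal.rpow_le_rpow (anisoSq_mono hm hn u) (by norm_num)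

theorem five_rpow_half_le : (5 : ℝ≥0∞) ^ (1 / 2 : ℝ) ≤ 3 := by
  rw [← rpow_half_sq 3]
  exact ENNReal.rpow_le_rpow (by norm_num) (by norm_num)

theorem mixedNormFst_le_anisoNorm {f : Freq → ℝ≥0∞} {u : VField} {m n : ℕ}
    (h : ∀ k, ENNReal.ofReal (1 + (k 0 : ℝ) ^ 2) * f k ^ 2 ≤
      ENNReal.ofReal (anisoWeight m n k) * ampSq u k) :
    mixedNormFst f ≤ 3 * anisoNorm m n u := by
  refine (mixedNormFst_le f le_rfl).trans ?_
  rw [ENNReal.mul_rpow_of_nonneg _ _ (by norm_num), anisoNorm, anisoSq_natCast]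
  refine mul_le_mul' five_rpow_half_le (ENNReal.rpow_le_rpow ?_ (by norm_num))
  refine ENNReal.tsum_le_tsum fun k => ?_
  rw [div_one]
  exact h k

theorem mixedNormSnd_le_anisoNorm {f : Freq → ℝ≥0∞} {u : VField} {m n : ℕ}
    (h : ∀ k, ENNReal.ofReal (1 + (k 1 : ℝ) ^ 2) * f k ^ 2 ≤
      ENNReal.ofReal (anisoWeight m n k) * ampSq u k) :
    mixedNormSnd f ≤ 3 * anisoNorm m n u := by
  refine (mixedNormSnd_le f le_rfl).trans ?_
  rw [ENNReal.mul_rpow_of_nonneg _ _ (by norm_num), anisoNorm, anisoSq_natCast]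
  refine mul_le_mul' five_rpow_half_le (ENNReal.rpow_le_rpow ?_ (by norm_num))
  refine ENNReal.tsum_le_tsum fun k => ?_
  rw [div_one]
  exact h k

theorem ellTwoNorm_le_anisoNorm {f : Freq → ℝ≥0∞} {u : VField} {m n : ℕ}
    (h : ∀ k, f k ^ 2 ≤ ENNReal.ofReal (anisoWeight m n k) * ampSq u k) :
    ellTwoNorm f ≤ anisoNorm m n u := by
  rw [anisoNorm, anisoSq_natCast]
  exact ENNReal.rpow_le_rpow (ENNReal.tsum_le_tsum h) (by norm_num)

theorem enorm_intCast_sq (n : ℤ) : ‖(n : ℂ)‖ₑ ^ 2 = ENNReal.ofReal ((n : ℝ) ^ 2) := by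
  rw [← ofReal_norm, ← ENNReal.ofReal_pow (norm_nonneg _), Complex.norm_intCast, sq_abs]

theorem enorm_sq_le_ampSq (u : VField) (k : Freq) (j : Fin 2) : ‖u k j‖ₑ ^ 2 ≤ ampSq u k :=
  Finset.single_le_sum (f := fun j => ‖u k j‖ₑ ^ 2) (fun _ _ => zero_le) (Finset.mem_univ j)

theorem enorm_partialDeriv_sq (i : Fin 2) (u : VField) (k : Freq) (j : Fin 2) :
    ‖partialDeriv i u k j‖ₑ ^ 2 = ENNReal.ofReal ((k i : ℝ) ^ 2) * ‖u k j‖ₑ ^ 2 := by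
  have hI : ‖Complex.I‖ₑ = 1 := by rw [← ofReal_norm, Complex.norm_I, ENNReal.ofReal_one]
  simp only [partialDeriv, enorm_mul, mul_pow, enorm_intCast_sq, hI, one_mul]

/-- The divergence condition reads ∂₂u² = -∂₁u¹. It is the mechanism by which horizontal regularity
controls the vertical derivative of the vertical component. -/
theorem enorm_partialDeriv_divFree {u : VField} (hu : IsDivFree u) (k : Freq) :
    ‖partialDeriv 1 u k 1‖ₑ ^ 2 = ‖partialDeriv 0 u k 0‖ₑ ^ 2 := by
  have h := hu k
  rw [Fin.sum_univ_two] at h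
  have h' : partialDeriv 1 u k 1 = -partialDeriv 0 u k 0 := by
    simp only [partialDeriv]
    linear_combination Complex.I * h
  rw [h', enorm_neg]

theorem weight_mul_enorm_sq_le (u : VField) (k : Freq) (j : Fin 2) {a b : ℝ}
    (hab : a ≤ b) : ENNReal.ofReal a * ‖u k j‖ₑ ^ 2 ≤ ENNReal.ofReal b * ampSq u k :=
  mul_le_mul' (ENNReal.ofReal_le_ofReal hab) (enorm_sq_le_ampSq u k j)

theorem isDivFree_partialDeriv {u : VField} (hu : IsDivFree u) (i : Fin 2) :
    IsDivFree (partialDeriv i u) := fun k => by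
  have h := hu k
  rw [Fin.sum_univ_two] at h ⊢
  simp only [partialDeriv]
  linear_combination Complex.I * (k i : ℂ) * h

theorem isRealField_partialDeriv {u : VField} (hu : IsRealField u) (i : Fin 2) :
    IsRealField (partialDeriv i u) := fun k j => by
  simp [partialDeriv, hu k j]

/-! ### Bounds for the absolute trilinear form -/

/-- The absolute form of `∑_{i,j} ∫ uⁱ ∂_i vʲ wʲ`. -/
def triAbs (u v w : VField) : ℝ≥0∞ :=
  ∑ i, ∑ j, convForm (fun k => ‖u k i‖ₑ) (fun k => ‖partialDeriv i v k j‖ₑ) (fun k => ‖w k j‖ₑ)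

theorem triAbs_le_of_forall {u v w : VField} {M : ℝ≥0∞}
    (h0 : ∀ j, convForm (fun k => ‖u k 0‖ₑ) (fun k => ‖partialDeriv 0 v k j‖ₑ)
      (fun k => ‖w k j‖ₑ) ≤ 9 * M)
    (h1 : ∀ j, convForm (fun k => ‖u k 1‖ₑ) (fun k => ‖partialDeriv 1 v k j‖ₑ)
      (fun k => ‖w k j‖ₑ) ≤ 9 * M) : triAbs u v w ≤ 36 * M := by
  unfold triAbs
  simp only [Fin.sum_univ_two]
  calc _ ≤ (9 * M + 9 * M) + (9 * M + 9 * M) :=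
        add_le_add (add_le_add (h0 0) (h0 1)) (add_le_add (h1 0) (h1 1))
    _ = 36 * M := by ring

section ConvFormBounds

variable {f g h : Freq → ℝ≥0∞} {A B C : ℝ≥0∞}

/-- The form is symmetric in its arguments, so the two mixed norms and the ℓ² norm can be
distributed at will. In the names of these variants, F, S and N record which of `mixedNormFst`,
`mixedNormSnd`, `ellTwoNorm` is put on the first, second and third factor. -/
theorem convForm_le_FSN (hf : mixedNormFst f ≤ 3 * A) (hg : mixedNormSnd g ≤ 3 * B)
    (hh : ellTwoNorm h ≤ C) : convForm f g h ≤ 9 * (A * B * C) :=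
  (convForm_le f g h).trans ((mul_le_mul' (mul_le_mul' hf hg) hh).trans_eq (by ring))

theorem convForm_le_SFN (hf : mixedNormSnd f ≤ 3 * A) (hg : mixedNormFst g ≤ 3 * B)
    (hh : ellTwoNorm h ≤ C) : convForm f g h ≤ 9 * (A * B * C) := by
  rw [convForm_swap_left]
  exact (convForm_le_FSN hg hf hh).trans_eq (by ring)

theorem convForm_le_FNS (hf : mixedNormFst f ≤ 3 * A) (hg : ellTwoNorm g ≤ B)
    (hh : mixedNormSnd h ≤ 3 * C) : convForm f g h ≤ 9 * (A * B * C) := by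
  rw [convForm_swap_right]
  exact (convForm_le_FSN hf hh hg).trans_eq (by ring)

theorem convForm_le_SNF (hf : mixedNormSnd f ≤ 3 * A) (hg : ellTwoNorm g ≤ B)
    (hh : mixedNormFst h ≤ 3 * C) : convForm f g h ≤ 9 * (A * B * C) := by
  rw [convForm_swap_right]
  exact (convForm_le_SFN hf hh hg).trans_eq (by ring)

theorem convForm_le_NSF (hf : ellTwoNorm f ≤ A) (hg : mixedNormSnd g ≤ 3 * B)
    (hh : mixedNormFst h ≤ 3 * C) : convForm f g h ≤ 9 * (A * B * C) := by
  rw [convForm_swap_left]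
  exact (convForm_le_SNF hg hf hh).trans_eq (by ring)

end ConvFormBounds

section PartialBounds

variable (u : VField) (j : Fin 2)

theorem mixedNormFst_comp_le : mixedNormFst (fun k => ‖u k j‖ₑ) ≤ 3 * anisoNorm 1 0 u := by
  refine mixedNormFst_le_anisoNorm fun k => weight_mul_enorm_sq_le _ _ _ ?_
  simp [anisoWeight]

theorem mixedNormFst_partial_one_le :
    mixedNormFst (fun k => ‖partialDeriv 1 u k j‖ₑ) ≤ 3 * anisoNorm 1 1 u := by
  refine mixedNormFst_le_anisoNorm fun k => ?_
  rw [enorm_partialDeriv_sq, ← mul_assoc, ← ENNReal.ofReal_mul (by positivity)]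
  refine weight_mul_enorm_sq_le _ _ _ ?_
  unfold anisoWeight
  nlinarith [sq_nonneg (k 0 : ℝ)]

theorem mixedNormFst_partial_one_one_le :
    mixedNormFst (fun k => ‖partialDeriv 1 (partialDeriv 1 u) k j‖ₑ) ≤ 3 * anisoNorm 1 2 u := by
  refine mixedNormFst_le_anisoNorm fun k => ?_
  rw [enorm_partialDeriv_sq, enorm_partialDeriv_sq, ← mul_assoc, ← mul_assoc,
    ← ENNReal.ofReal_mul (by positivity), ← ENNReal.ofReal_mul (by positivity), mul_assoc]
  refine weight_mul_enorm_sq_le _ _ _ ?_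
  unfold anisoWeight
  rw [pow_one]
  gcongr
  nlinarith [sq_nonneg (k 1 : ℝ)]

theorem mixedNormSnd_comp_le : mixedNormSnd (fun k => ‖u k j‖ₑ) ≤ 3 * anisoNorm 0 1 u := by
  refine mixedNormSnd_le_anisoNorm fun k => weight_mul_enorm_sq_le _ _ _ ?_
  simp [anisoWeight]

theorem mixedNormSnd_partial_zero_le :
    mixedNormSnd (fun k => ‖partialDeriv 0 u k j‖ₑ) ≤ 3 * anisoNorm 1 1 u := by
  refine mixedNormSnd_le_anisoNorm fun k => ?_
  rw [enorm_partialDeriv_sq, ← mul_assoc, ← ENNReal.ofReal_mul (by positivity)]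
  refine weight_mul_enorm_sq_le _ _ _ ?_
  unfold anisoWeight
  nlinarith [sq_nonneg (k 1 : ℝ)]

theorem mixedNormSnd_partial_one_le :
    mixedNormSnd (fun k => ‖partialDeriv 1 u k j‖ₑ) ≤ 3 * anisoNorm 0 2 u := by
  refine mixedNormSnd_le_anisoNorm fun k => ?_
  rw [enorm_partialDeriv_sq, ← mul_assoc, ← ENNReal.ofReal_mul (by positivity)]
  refine weight_mul_enorm_sq_le _ _ _ ?_
  unfold anisoWeight
  nlinarith [sq_nonneg (k 1 : ℝ)]

theorem ellTwoNorm_comp_le : ellTwoNorm (fun k => ‖u k j‖ₑ) ≤ anisoNorm 0 0 u := by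
  refine ellTwoNorm_le_anisoNorm fun k => ?_
  simpa [anisoWeight] using enorm_sq_le_ampSq u k j

theorem ellTwoNorm_partial_zero_le :
    ellTwoNorm (fun k => ‖partialDeriv 0 u k j‖ₑ) ≤ anisoNorm 1 0 u := by
  refine ellTwoNorm_le_anisoNorm fun k => ?_
  rw [enorm_partialDeriv_sq]
  refine weight_mul_enorm_sq_le _ _ _ ?_
  simp [anisoWeight]

theorem ellTwoNorm_partial_one_le :
    ellTwoNorm (fun k => ‖partialDeriv 1 u k j‖ₑ) ≤ anisoNorm 0 1 u := by
  refine ellTwoNorm_le_anisoNorm fun k => ?_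
  rw [enorm_partialDeriv_sq]
  refine weight_mul_enorm_sq_le _ _ _ ?_
  simp [anisoWeight]

theorem ellTwoNorm_partial_zero_one_le :
    ellTwoNorm (fun k => ‖partialDeriv 0 (partialDeriv 1 u) k j‖ₑ) ≤ anisoNorm 1 1 u := by
  refine ellTwoNorm_le_anisoNorm fun k => ?_
  rw [enorm_partialDeriv_sq, enorm_partialDeriv_sq, ← mul_assoc,
    ← ENNReal.ofReal_mul (by positivity)]
  refine weight_mul_enorm_sq_le _ _ _ ?_
  unfold anisoWeight
  nlinarith [sq_nonneg (k 0 : ℝ), sq_nonneg (k 1 : ℝ)]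

theorem ellTwoNorm_partial_one_one_le :
    ellTwoNorm (fun k => ‖partialDeriv 1 (partialDeriv 1 u) k j‖ₑ) ≤ anisoNorm 0 2 u := by
  refine ellTwoNorm_le_anisoNorm fun k => ?_
  rw [enorm_partialDeriv_sq, enorm_partialDeriv_sq, ← mul_assoc,
    ← ENNReal.ofReal_mul (by positivity)]
  refine weight_mul_enorm_sq_le _ _ _ ?_
  unfold anisoWeight
  nlinarith [sq_nonneg (k 1 : ℝ)]

variable {u}

/-- The vertical derivative needed for summability in k₂ is traded for a horizontal derivative of
the other component. For a general component one would pay `anisoNorm 0 1`. -/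
theorem mixedNormSnd_vertical_le (hu : IsDivFree u) : mixedNormSnd (fun k => ‖u k 1‖ₑ) ≤ 3 * anisoNorm 1 0 u := by
  refine mixedNormSnd_le_anisoNorm fun k => ?_
  have h := enorm_partialDeriv_divFree hu k
  rw [enorm_partialDeriv_sq, enorm_partialDeriv_sq] at h
  rw [ENNReal.ofReal_add (by positivity) (by positivity), add_mul, h, ENNReal.ofReal_one, one_mul]
  have hw : anisoWeight 1 0 k = 1 + (k 0 : ℝ) ^ 2 := by simp [anisoWeight]
  rw [hw, ENNReal.ofReal_add (by positivity) (by positivity), add_mul, ENNReal.ofReal_one, one_mul]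
  gcongr
  · exact enorm_sq_le_ampSq u k 1
  · exact enorm_sq_le_ampSq u k 0

theorem mixedNormSnd_partial_one_vertical_le (hu : IsDivFree u) :
    mixedNormSnd (fun k => ‖partialDeriv 1 u k 1‖ₑ) ≤ 3 * anisoNorm 1 1 u := by
  refine mixedNormSnd_le_anisoNorm fun k => ?_
  rw [enorm_partialDeriv_divFree hu, enorm_partialDeriv_sq, ← mul_assoc,
    ← ENNReal.ofReal_mul (by positivity)]
  refine weight_mul_enorm_sq_le _ _ _ ?_
  unfold anisoWeight
  nlinarith [sq_nonneg (k 1 : ℝ)]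

theorem mixedNormSnd_partial_one_one_vertical_le (hu : IsDivFree u) :
    mixedNormSnd (fun k => ‖partialDeriv 1 (partialDeriv 1 u) k 1‖ₑ) ≤ 3 * anisoNorm 1 2 u := by
  refine mixedNormSnd_le_anisoNorm fun k => ?_
  rw [enorm_partialDeriv_divFree (isDivFree_partialDeriv hu 1), enorm_partialDeriv_sq,
    enorm_partialDeriv_sq, ← mul_assoc, ← mul_assoc, ← ENNReal.ofReal_mul (by positivity),
    ← ENNReal.ofReal_mul (by positivity)]
  refine weight_mul_enorm_sq_le _ _ _ ?_
  unfold anisoWeight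
  have h0 := sq_nonneg (k 0 : ℝ)
  have h1 := sq_nonneg (k 1 : ℝ)
  calc (1 + (k 1 : ℝ) ^ 2) * (k 0 : ℝ) ^ 2 * (k 1 : ℝ) ^ 2
      = (k 0 : ℝ) ^ 2 * ((1 + (k 1 : ℝ) ^ 2) * (k 1 : ℝ) ^ 2) := by ring
    _ ≤ (1 + (k 0 : ℝ) ^ 2) ^ 1 * (1 + (k 1 : ℝ) ^ 2) ^ 2 := by
      rw [pow_one]
      refine mul_le_mul (by linarith) (by nlinarith) (by positivity) (by positivity)

end PartialBounds

/-- A crude bound, for absolute convergence only. -/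
theorem triAbs_le_general (u v w : VField) :
    triAbs u v w ≤ 36 * (anisoNorm 1 1 u * anisoNorm 1 1 v * anisoNorm 1 1 w) := by
  have key : ∀ i j, convForm (fun k => ‖u k i‖ₑ) (fun k => ‖partialDeriv i v k j‖ₑ)
      (fun k => ‖w k j‖ₑ) ≤ 9 * (anisoNorm 1 1 u * anisoNorm 1 1 v * anisoNorm 1 1 w) := by
    intro i j
    refine convForm_le_FNS ((mixedNormFst_comp_le u i).trans ?_) ?_
      ((mixedNormSnd_comp_le w j).trans ?_)
    · gcongr
      exact anisoNorm_mono le_rfl zero_le_one u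
    · fin_cases i
      · exact (ellTwoNorm_partial_zero_le v j).trans (anisoNorm_mono le_rfl zero_le_one v)
      · exact (ellTwoNorm_partial_one_le v j).trans (anisoNorm_mono zero_le_one le_rfl v)
    · gcongr
      exact anisoNorm_mono zero_le_one le_rfl w
  exact triAbs_le_of_forall (fun j => key 0 j) (fun j => key 1 j)

/-- No vertical derivative of w appears: when the derivative of u is vertical it is multiplied by
the vertical component of w, for which `mixedNormSnd_vertical_le` applies. This makes uniqueness
work at the level of L². -/
theorem triAbs_middle_le {w : VField} (hw : IsDivFree w) (u : VField) :
    triAbs w u w ≤ 36 * (anisoNorm 0 0 w * anisoNorm 1 0 w * anisoNorm 1 1 u) := by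
  refine triAbs_le_of_forall (fun j => ?_) (fun j => ?_)
  · refine (convForm_le_NSF (ellTwoNorm_comp_le w 0) (mixedNormSnd_partial_zero_le u j)
      (mixedNormFst_comp_le w j)).trans_eq (by ring)
  · refine (convForm_le_SFN (mixedNormSnd_vertical_le hw) (mixedNormFst_partial_one_le u j)
      (ellTwoNorm_comp_le w j)).trans_eq (by ring)

/-- The signed form is zero for divergence-free b. The absolute bound provides the dominating
function when partial sums of that vanishing form are integrated in time. -/
theorem triAbs_advect_le (b w : VField) :
    triAbs b w w ≤ 36 * (anisoNorm 1 1 b * anisoNorm 1 1 w * anisoNorm 0 1 w) := by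
  refine triAbs_le_of_forall (fun j => ?_) (fun j => ?_)
  · refine (convForm_le_FNS (mixedNormFst_comp_le b 0) (ellTwoNorm_partial_zero_le w j)
      (mixedNormSnd_comp_le w j)).trans ?_
    gcongr
    · exact anisoNorm_mono le_rfl zero_le_one b
    · exact anisoNorm_mono le_rfl zero_le_one w
  · refine (convForm_le_SNF (mixedNormSnd_comp_le b 1) (ellTwoNorm_partial_one_le w j)
      (mixedNormFst_comp_le w j)).trans ?_
    rw [mul_right_comm]
    gcongr
    · exact anisoNorm_mono zero_le_one le_rfl b
    · exact anisoNorm_mono le_rfl zero_le_one w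

theorem triAbs_partial_left_le {w : VField} (hw : IsDivFree w) (u : VField) :
    triAbs (partialDeriv 1 w) u (partialDeriv 1 w) ≤
      36 * (anisoNorm 0 1 w * anisoNorm 1 1 w * anisoNorm 1 1 u) := by
  refine triAbs_le_of_forall (fun j => ?_) (fun j => ?_)
  · refine (convForm_le_NSF (ellTwoNorm_partial_one_le w 0) (mixedNormSnd_partial_zero_le u j)
      (mixedNormFst_partial_one_le w j)).trans_eq (by ring)
  · refine (convForm_le_SFN (mixedNormSnd_partial_one_vertical_le hw)
      (mixedNormFst_partial_one_le u j) (ellTwoNorm_partial_one_le w j)).trans_eq (by ring)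

/-- The vertical component of w meets ∂₂²u here, and the latter can only be put in L². Hence the
norm of u in H^{0,2}. -/
theorem triAbs_partial_middle_le (w u : VField) :
    triAbs w (partialDeriv 1 u) (partialDeriv 1 w) ≤
      36 * (anisoNorm 0 1 w * anisoNorm 1 1 w * (anisoNorm 1 1 u + anisoNorm 0 2 u)) := by
  refine triAbs_le_of_forall (fun j => ?_) (fun j => ?_)
  · refine (convForm_le_SNF (mixedNormSnd_comp_le w 0) (ellTwoNorm_partial_zero_one_le u j)
      (mixedNormFst_partial_one_le w j)).trans ?_
    rw [mul_right_comm]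
    gcongr
    exact le_self_add
  · refine (convForm_le_SNF (mixedNormSnd_comp_le w 1) (ellTwoNorm_partial_one_one_le u j)
      (mixedNormFst_partial_one_le w j)).trans ?_
    rw [mul_right_comm]
    gcongr
    exact le_add_self

theorem triAbs_second_left_le {u : VField} (hu : IsDivFree u) :
    triAbs (partialDeriv 1 (partialDeriv 1 u)) u (partialDeriv 1 (partialDeriv 1 u)) ≤
      36 * (anisoNorm 0 2 u * anisoNorm 1 2 u * anisoNorm 1 1 u) := by
  refine triAbs_le_of_forall (fun j => ?_) (fun j => ?_)
  · refine (convForm_le_NSF (ellTwoNorm_partial_one_one_le u 0) (mixedNormSnd_partial_zero_le u j)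
      (mixedNormFst_partial_one_one_le u j)).trans_eq (by ring)
  · refine (convForm_le_SFN (mixedNormSnd_partial_one_one_vertical_le hu)
      (mixedNormFst_partial_one_le u j) (ellTwoNorm_partial_one_one_le u j)).trans_eq (by ring)

/-- The bound is linear in ‖u‖_{H^{0,2}} ‖u‖_{H^{1,2}}, with a factor already controlled by the
H^{0,1} estimate, so H^{0,2} regularity propagates for all times. -/
theorem triAbs_second_middle_le {u : VField} (hu : IsDivFree u) :
    triAbs (partialDeriv 1 u) (partialDeriv 1 u) (partialDeriv 1 (partialDeriv 1 u)) ≤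
      36 * (anisoNorm 0 2 u * anisoNorm 1 2 u * anisoNorm 1 1 u) := by
  refine triAbs_le_of_forall (fun j => ?_) (fun j => ?_)
  · refine (convForm_le_SNF (mixedNormSnd_partial_one_le u 0) (ellTwoNorm_partial_zero_one_le u j)
      (mixedNormFst_partial_one_one_le u j)).trans_eq (by ring)
  · refine (convForm_le_SFN (mixedNormSnd_partial_one_vertical_le hu)
      (mixedNormFst_partial_one_one_le u j) (ellTwoNorm_partial_one_one_le u j)).trans_eq (by ring)

/-! ### The signed trilinear form: cancellations and integration by parts -/

/-- The summand of `∑_{i,j} ∫ uⁱ ∂_i vʲ wʲ` with components `i`, `j`, at the frequencies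
`p`, `q`, `-(p + q)`. -/
def triComp (i j : Fin 2) (u v w : VField) (x : Freq × Freq) : ℂ :=
  u x.1 i * partialDeriv i v x.2 j * w (-(x.1 + x.2)) j

/-- The summand of the trilinear form. -/
def triTerm (u v w : VField) (x : Freq × Freq) : ℂ := ∑ i, ∑ j, triComp i j u v w x

/-- The trilinear form `∫ (u · ∇ v) · w`. -/
def tri (u v w : VField) : ℂ := ∑' x, triTerm u v w x

theorem tsum_enorm_triComp (i j : Fin 2) (u v w : VField) :
    ∑' x, ‖triComp i j u v w x‖ₑ =
      convForm (fun k => ‖u k i‖ₑ) (fun k => ‖partialDeriv i v k j‖ₑ) (fun k => ‖w k j‖ₑ) := by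
  simp only [triComp, enorm_mul, convForm]

theorem tsum_enorm_triComp_le (i j : Fin 2) (u v w : VField) :
    ∑' x, ‖triComp i j u v w x‖ₑ ≤ triAbs u v w := by
  rw [tsum_enorm_triComp, triAbs]
  refine le_trans ?_ (Finset.single_le_sum (f := fun i => ∑ j, convForm (fun k => ‖u k i‖ₑ)
    (fun k => ‖partialDeriv i v k j‖ₑ) (fun k => ‖w k j‖ₑ)) (fun _ _ => zero_le)
    (Finset.mem_univ i))
  exact Finset.single_le_sum (f := fun j => convForm (fun k => ‖u k i‖ₑ)
    (fun k => ‖partialDeriv i v k j‖ₑ) (fun k => ‖w k j‖ₑ)) (fun _ _ => zero_le)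
    (Finset.mem_univ j)

theorem enorm_sum_fin_two_le (f : Fin 2 → ℂ) : ‖∑ i, f i‖ₑ ≤ ∑ i, ‖f i‖ₑ := by
  simpa only [Fin.sum_univ_two] using enorm_add_le (f 0) (f 1)

theorem tsum_enorm_triTerm_le (u v w : VField) : ∑' x, ‖triTerm u v w x‖ₑ ≤ triAbs u v w := by
  calc ∑' x, ‖triTerm u v w x‖ₑ ≤ ∑' x, ∑ i, ∑ j, ‖triComp i j u v w x‖ₑ :=
        ENNReal.tsum_le_tsum fun x => (enorm_sum_fin_two_le _).trans
          (Finset.sum_le_sum fun i _ => enorm_sum_fin_two_le _)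
    _ = triAbs u v w := by
        simp only [Fin.sum_univ_two, triAbs, ENNReal.tsum_add, tsum_enorm_triComp]

theorem summable_triComp {u v w : VField} (h : triAbs u v w ≠ ∞) (i j : Fin 2) :
    Summable (triComp i j u v w) :=
  Summable.of_enorm (ne_top_of_le_ne_top h (tsum_enorm_triComp_le i j u v w))

theorem summable_triTerm {u v w : VField} (h : triAbs u v w ≠ ∞) : Summable (triTerm u v w) :=
  Summable.of_enorm (ne_top_of_le_ne_top h (tsum_enorm_triTerm_le u v w))

theorem enorm_tri_le (u v w : VField) : ‖tri u v w‖ₑ ≤ triAbs u v w :=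
  enorm_tsum_le_tsum_enorm.trans (tsum_enorm_triTerm_le u v w)

/-- Exchanging the frequencies q and -(p+q) of the two copies of w changes the symbol p-wise by
u_p·p, which is zero, and otherwise reverses the sign. So the sum equals its negative. -/
theorem tri_self {u : VField} (hu : IsDivFree u) (w : VField) : tri u w w = 0 := by
  have h : tri u w w = -tri u w w := by
    conv_lhs => rw [tri, ← swapLast.tsum_eq]
    rw [tri, ← tsum_neg]
    refine tsum_congr fun x => ?_
    have h1 := hu x.1
    simp only [Fin.sum_univ_two] at h1
    have h2 : -(x.1 + -(x.1 + x.2)) = x.2 := by abel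
    simp only [triTerm, triComp, swapLast, Equiv.coe_fn_mk, Fin.sum_univ_two, partialDeriv, h2,
      Pi.neg_apply, Pi.add_apply, Int.cast_neg, Int.cast_add]
    linear_combination (-Complex.I * (w x.2 0 * w (-(x.1 + x.2)) 0
      + w x.2 1 * w (-(x.1 + x.2)) 1)) * h1
  exact self_eq_neg.mp h

/-- Integration by parts in x₂ holds term by term, since the three vertical frequencies add up to
zero. -/
theorem triTerm_partial_right (u v w : VField) (x : Freq × Freq) :
    triTerm u v (partialDeriv 1 w) x =
      -(triTerm (partialDeriv 1 u) v w x + triTerm u (partialDeriv 1 v) w x) := by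
  simp only [triTerm, triComp, Fin.sum_univ_two, partialDeriv,
      Pi.neg_apply, Pi.add_apply, Int.cast_neg, Int.cast_add]
  ring

theorem tri_partial_right {u v w : VField} (h1 : triAbs (partialDeriv 1 u) v w ≠ ∞)
    (h2 : triAbs u (partialDeriv 1 v) w ≠ ∞) :
    tri u v (partialDeriv 1 w) = -(tri (partialDeriv 1 u) v w + tri u (partialDeriv 1 v) w) := by
  simp only [tri, triTerm_partial_right]
  rw [tsum_neg, (summable_triTerm h1).tsum_add (summable_triTerm h2)]

/-- The pairs `(k, l) ↦ (k - l, l)`. -/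
def subFirst : Freq × Freq ≃ Freq × Freq where
  toFun x := (x.1 - x.2, x.2)
  invFun x := (x.1 + x.2, x.2)
  left_inv x := by ext <;> simp
  right_inv x := by ext <;> simp

theorem tsum_triTerm_fiber {u v w : VField} (h : triAbs u v w ≠ ∞) (k : Freq) :
    ∑' l, triTerm u v w (subFirst (k, l)) = ∑ j, advection u v k j * w (-k) j := by
  have hs : ∀ i j, Summable fun l => triComp i j u v w (subFirst (k, l)) := fun i j =>
    ((subFirst.summable_iff).mpr (summable_triComp h i j)).comp_injective
      (Prod.mk_right_injective k)
  have h1 : ∀ l, triTerm u v w (subFirst (k, l)) =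
      ∑ j, ∑ i, triComp i j u v w (subFirst (k, l)) := fun l => Finset.sum_comm
  simp_rw [h1]
  rw [Summable.tsum_finsetSum fun j _ => summable_sum fun i _ => hs i j]
  refine Finset.sum_congr rfl fun j _ => ?_
  rw [advection, ← tsum_mul_right]
  refine tsum_congr fun l => ?_
  simp only [triComp, subFirst, Equiv.coe_fn_mk, Fin.sum_univ_two, sub_add_cancel]
  ring

/-- The double series is regrouped by output frequency k = p + l, which turns the trilinear form
into the duality pairing of u·∇v with w. -/
theorem hasSum_advection {u v w : VField} (h : triAbs u v w ≠ ∞) :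
    HasSum (fun k => ∑ j, advection u v k j * w (-k) j) (tri u v w) := by
  have hs := (subFirst.summable_iff).mpr (summable_triTerm h)
  have h1 : HasSum (fun x => triTerm u v w (subFirst x)) (tri u v w) :=
    (subFirst.hasSum_iff).mpr (summable_triTerm h).hasSum
  have h2 := h1.prod_fiberwise fun k => (hs.prod_factor k).hasSum
  simpa only [Function.comp_apply, tsum_triTerm_fiber h] using h2

theorem tsum_enorm_advection_le {u v w : VField} (h : triAbs u v w ≠ ∞) :
    ∑' k, ‖∑ j, advection u v k j * w (-k) j‖ₑ ≤ triAbs u v w := by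
  calc ∑' k, ‖∑ j, advection u v k j * w (-k) j‖ₑ
      = ∑' k, ‖∑' l, triTerm u v w (subFirst (k, l))‖ₑ := by simp_rw [tsum_triTerm_fiber h]
    _ ≤ ∑' k, ∑' l, ‖triTerm u v w (subFirst (k, l))‖ₑ :=
        ENNReal.tsum_le_tsum fun k => enorm_tsum_le_tsum_enorm
    _ = ∑' x, ‖triTerm u v w x‖ₑ := by
        rw [← subFirst.tsum_eq, tsum_prod_ennreal]
    _ ≤ _ := tsum_enorm_triTerm_le u v w

/-- The removed part is a gradient, parallel to k, hence orthogonal to the coefficient of a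
divergence-free field at -k. -/
theorem sum_leray_mul {w : VField} (hw : IsDivFree w) (F : VField) (k : Freq) :
    ∑ j, leray F k j * w (-k) j = ∑ j, F k j * w (-k) j := by
  have h := hw (-k)
  simp only [Fin.sum_univ_two, Pi.neg_apply, Int.cast_neg] at h
  simp only [leray, Fin.sum_univ_two]
  linear_combination ((k 0 : ℂ) * F k 0 + (k 1 : ℂ) * F k 1) /
    ((k 0 : ℂ) ^ 2 + (k 1 : ℂ) ^ 2) * h

/-- The part with j = 0 is the integral of (∂₂u¹)²(∂₁u¹ + ∂₂u²), which vanishes; in Fourier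
variables the two terms are matched by exchanging p and q. Each remaining term contains ∂₂u² = -∂₁u¹
and a second factor ∂₁u² or ∂₂u², hence two horizontal derivatives. -/
theorem tri_partial_cancel {u : VField} (hu : IsDivFree u)
    (h : triAbs (partialDeriv 1 u) u (partialDeriv 1 u) ≠ ∞) :
    tri (partialDeriv 1 u) u (partialDeriv 1 u) =
      ∑' x, triComp 0 1 (partialDeriv 1 u) u (partialDeriv 1 u) x +
      ∑' x, triComp 1 1 (partialDeriv 1 u) u (partialDeriv 1 u) x := by
  have hs := summable_triComp h
  have h1 : ∑' x, triComp 1 0 (partialDeriv 1 u) u (partialDeriv 1 u) x =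
      -∑' x, triComp 0 0 (partialDeriv 1 u) u (partialDeriv 1 u) x := by
    rw [← (Equiv.prodComm Freq Freq).tsum_eq, ← tsum_neg]
    refine tsum_congr fun x => ?_
    have h2 := hu x.2
    rw [Fin.sum_univ_two] at h2
    simp only [triComp, partialDeriv, Equiv.prodComm_apply, Prod.fst_swap, Prod.snd_swap,
      add_comm x.2 x.1]
    linear_combination (Complex.I ^ 2 * x.1 1 * u x.1 0 *
      (Complex.I * ((-(x.1 + x.2)) 1 : ℤ) * u (-(x.1 + x.2)) 0)) * h2
  unfold tri triTerm
  simp only [Fin.sum_univ_two]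
  rw [((hs 0 0).add (hs 0 1)).tsum_add ((hs 1 0).add (hs 1 1)), (hs 0 0).tsum_add (hs 0 1),
    (hs 1 0).tsum_add (hs 1 1), h1]
  ring

/-! ### Interpolation and the critical vertical estimate -/

theorem anisoSq_zero_zero (u : VField) : anisoSq 0 0 u = ∑' k, ampSq u k := by
  have h := anisoSq_natCast 0 0 u
  simpa [anisoWeight] using h

theorem ampSq_partialDeriv (i : Fin 2) (u : VField) (k : Freq) :
    ampSq (partialDeriv i u) k = ENNReal.ofReal ((k i : ℝ) ^ 2) * ampSq u k := by
  simp only [ampSq, enorm_partialDeriv_sq, Finset.mul_sum]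

theorem ampSq_eq_zero {u : VField} {k : Freq} (h : u k = 0) : ampSq u k = 0 := by
  simp [ampSq, h]

theorem ampSq_ne_top (u : VField) (k : Freq) : ampSq u k ≠ ∞ := by
  simp [ampSq]

theorem support_partialDeriv_subset (i : Fin 2) (u : VField) :
    Function.support (partialDeriv i u) ⊆ Function.support u := by
  intro k hk h
  refine hk ?_
  funext j
  simp [partialDeriv, h]

theorem anisoSq_ne_top_of_finite {u : VField} (hu : (Function.support u).Finite) (m n : ℕ) :
    anisoSq m n u ≠ ∞ := by
  rw [anisoSq_natCast, tsum_eq_sum (s := hu.toFinset)]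
  · exact (ENNReal.sum_ne_top).mpr fun k _ =>
      ENNReal.mul_ne_top ENNReal.ofReal_ne_top (ampSq_ne_top u k)
  · intro k hk
    rw [ampSq_eq_zero (by simpa using hk), mul_zero]

theorem anisoNorm_ne_top {m n : ℕ} {u : VField} (h : anisoSq m n u ≠ ∞) : anisoNorm m n u ≠ ∞ :=
  ENNReal.rpow_ne_top_of_nonneg (by norm_num) h

theorem triAbs_ne_top {u v w : VField} (hu : anisoSq 1 1 u ≠ ∞) (hv : anisoSq 1 1 v ≠ ∞)
    (hw : anisoSq 1 1 w ≠ ∞) : triAbs u v w ≠ ∞ := by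
  refine ne_top_of_le_ne_top ?_ (triAbs_le_general u v w)
  have h : ∀ {x : VField}, anisoSq 1 1 x ≠ ∞ → anisoNorm 1 1 x ≠ ∞ := fun hx =>
    anisoNorm_ne_top (by simpa using hx)
  exact ENNReal.mul_ne_top (by norm_num)
    (ENNReal.mul_ne_top (ENNReal.mul_ne_top (h hu) (h hv)) (h hw))

theorem triAbs_ne_top_of_finite {u v w : VField} (hu : (Function.support u).Finite)
    (hv : (Function.support v).Finite) (hw : (Function.support w).Finite) :
    triAbs u v w ≠ ∞ := by
  have h : ∀ {x : VField}, (Function.support x).Finite → anisoSq 1 1 x ≠ ∞ := fun hx => by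
    simpa using anisoSq_ne_top_of_finite hx 1 1
  exact triAbs_ne_top (h hu) (h hv) (h hw)

theorem interpolation_sum_le {g : VField} {f : Freq → ℝ≥0∞} (i : Fin 2) {A B l : ℝ} (hl : 1 ≤ l)
    (hA : 0 ≤ A) (hB : 0 ≤ B) (hf : ∀ k, f k ^ 2 ≤ ampSq g k)
    (h0 : anisoSq 0 0 g = ENNReal.ofReal A)
    (h1 : anisoSq 0 0 (partialDeriv i g) = ENNReal.ofReal B) :
    ∑' k : Freq, ENNReal.ofReal (l + (k i : ℝ) ^ 2 / l) * f k ^ 2 ≤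
      ENNReal.ofReal (l * A + B / l) := by
  have hl0 : 0 < l := by linarith
  calc ∑' k : Freq, ENNReal.ofReal (l + (k i : ℝ) ^ 2 / l) * f k ^ 2
      ≤ ∑' k : Freq, (ENNReal.ofReal l * ampSq g k +
          ENNReal.ofReal (1 / l) * ampSq (partialDeriv i g) k) := by
        refine ENNReal.tsum_le_tsum fun k => ?_
        rw [ampSq_partialDeriv, ← mul_assoc, ← ENNReal.ofReal_mul (by positivity), ← add_mul,
          ← ENNReal.ofReal_add (by positivity) (by positivity), one_div_mul_eq_div]
        gcongr
        exact hf k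
    _ = ENNReal.ofReal (l * A + B / l) := by
        rw [ENNReal.tsum_add, ENNReal.tsum_mul_left, ENNReal.tsum_mul_left, ← anisoSq_zero_zero,
          ← anisoSq_zero_zero, h0, h1, ← ENNReal.ofReal_mul (by positivity),
          ← ENNReal.ofReal_mul (by positivity), ← ENNReal.ofReal_add (by positivity) (by positivity),
          one_div_mul_eq_div]

/-- In the application y = ∂₂u and z = ∂₁u, so the two missing derivatives are the same mixed
derivative ∂₁∂₂u, and one number B serves for both. The parameters l and m are left free to be
optimized. -/
theorem convForm_sq_le_interpolation {f g h : Freq → ℝ≥0∞} {y z r : VField} {A B C D l m : ℝ}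
    (hl : 1 ≤ l) (hm : 1 ≤ m) (hA : 0 ≤ A) (hB : 0 ≤ B) (hC : 0 ≤ C)
    (hf : ∀ k, f k ^ 2 ≤ ampSq y k) (hg : ∀ k, g k ^ 2 ≤ ampSq z k)
    (hh : ∀ k, h k ^ 2 ≤ ampSq r k)
    (hyA : anisoSq 0 0 y = ENNReal.ofReal A)
    (hyB : anisoSq 0 0 (partialDeriv 0 y) = ENNReal.ofReal B)
    (hzC : anisoSq 0 0 z = ENNReal.ofReal C)
    (hzB : anisoSq 0 0 (partialDeriv 1 z) = ENNReal.ofReal B)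
    (hr : anisoSq 0 0 r = ENNReal.ofReal D) :
    convForm f g h ^ 2 ≤ ENNReal.ofReal (25 * (l * A + B / l) * (m * C + B / m) * D) := by
  have hl0 : 0 < l := by linarith
  have hm0 : 0 < m := by linarith
  have h1 := (mixedNormFst_le f hl).trans (ENNReal.rpow_le_rpow (mul_le_mul_right
    (interpolation_sum_le 0 hl hA hB hf hyA hyB) 5) (by norm_num))
  have h2 := (mixedNormSnd_le g hm).trans (ENNReal.rpow_le_rpow (mul_le_mul_right
    (interpolation_sum_le 1 hm hC hB hg hzC hzB) 5) (by norm_num))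
  have h3 : ellTwoNorm h ≤ (ENNReal.ofReal D) ^ (1 / 2 : ℝ) := by
    refine ENNReal.rpow_le_rpow ?_ (by norm_num)
    rw [← hr, anisoSq_zero_zero]
    exact ENNReal.tsum_le_tsum hh
  calc convForm f g h ^ 2 ≤ _ :=
        pow_le_pow_left' ((convForm_le f g h).trans (mul_le_mul' (mul_le_mul' h1 h2) h3)) 2
    _ = ENNReal.ofReal (25 * (l * A + B / l) * (m * C + B / m) * D) := by
        simp only [mul_pow, rpow_half_pow_two]
        rw [ENNReal.ofReal_mul (by positivity), ENNReal.ofReal_mul (by positivity),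
          ENNReal.ofReal_mul (by positivity)]
        have : ENNReal.ofReal 25 = 25 := by simp
        rw [this]
        ring

/-- The third factor can be estimated by a or by c. The geometric mean of both bounds gives g² ≤ 25
(ac)² (a+2b)(c+2b) after optimizing l and m, and the arithmetic–geometric mean inequality finishes.
The gain is the factor ac: only one power of b remains, which the dissipation absorbs. -/
theorem le_of_interpolation {a b c g : ℝ} (ha : 0 ≤ a) (hb : 0 ≤ b) (hc : 0 ≤ c) (hg : 0 ≤ g)
    (h1 : ∀ l m : ℝ, 1 ≤ l → 1 ≤ m →
      g ^ 2 ≤ 25 * (l * a ^ 2 + b ^ 2 / l) * (m * c ^ 2 + b ^ 2 / m) * a ^ 2)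
    (h2 : ∀ l m : ℝ, 1 ≤ l → 1 ≤ m →
      g ^ 2 ≤ 25 * (l * a ^ 2 + b ^ 2 / l) * (m * c ^ 2 + b ^ 2 / m) * c ^ 2) :
    g ≤ 5 * (a * c) * ((a + c + 4 * b) / 2) := by
  rcases ha.eq_or_lt with rfl | ha
  · have := h1 1 1 le_rfl le_rfl
    have hg0 : g = 0 := by nlinarith
    simp [hg0]
  rcases hc.eq_or_lt with rfl | hc
  · have := h2 1 1 le_rfl le_rfl
    have hg0 : g = 0 := by nlinarith
    simp [hg0]
  -- The minimum of l x² + b²/l is at l = b/x. Adding 1 keeps the parameter admissible and costs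
  -- only lower-order terms.
  have key : ∀ x : ℝ, 0 < x →
      (1 + b / x) * x ^ 2 + b ^ 2 / (1 + b / x) ≤ x * (x + 2 * b) := by
    intro x hx
    have e1 : 1 + b / x = (x + b) / x := by field_simp
    have e2 : b ^ 2 / ((x + b) / x) ≤ b * x := by
      rw [div_div_eq_mul_div, div_le_iff₀ (by positivity)]
      nlinarith [mul_nonneg hb hx.le, mul_nonneg (mul_nonneg hb hx.le) hx.le]
    rw [e1]
    have e3 : (x + b) / x * x ^ 2 = (x + b) * x := by field_simp
    rw [e3]
    linarith
  have hl : 1 ≤ 1 + b / a := by have : 0 ≤ b / a := by positivity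
                                linarith
  have hm : 1 ≤ 1 + b / c := by have : 0 ≤ b / c := by positivity
                                linarith
  set X := 25 * (a * (a + 2 * b)) * (c * (c + 2 * b)) with hX
  have hX0 : 0 ≤ X := by positivity
  have hle : 25 * ((1 + b / a) * a ^ 2 + b ^ 2 / (1 + b / a)) *
      ((1 + b / c) * c ^ 2 + b ^ 2 / (1 + b / c)) ≤ X := by
    refine mul_le_mul (mul_le_mul_of_nonneg_left (key a ha) (by norm_num)) (key c hc)
      (by positivity) (by positivity)
  have g1 : g ^ 2 ≤ X * a ^ 2 := (h1 _ _ hl hm).trans (by gcongr)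
  have g2 : g ^ 2 ≤ X * c ^ 2 := (h2 _ _ hl hm).trans (by gcongr)
  have g3 : g ^ 2 ≤ X * (a * c) := by
    refine (sq_le_sq₀ (by positivity) (by positivity)).mp ?_
    calc (g ^ 2) ^ 2 = g ^ 2 * g ^ 2 := by ring
      _ ≤ (X * a ^ 2) * (X * c ^ 2) := mul_le_mul g1 g2 (by positivity) (by positivity)
      _ = (X * (a * c)) ^ 2 := by ring
  refine (sq_le_sq₀ hg (by positivity)).mp (g3.trans ?_)
  rw [hX]
  have : (5 * (a * c) * ((a + c + 4 * b) / 2)) ^ 2 -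
      25 * (a * (a + 2 * b)) * (c * (c + 2 * b)) * (a * c) =
      (25 / 4) * (a * c) ^ 2 * (a - c) ^ 2 := by ring
  nlinarith [mul_nonneg (sq_nonneg (a * c)) (sq_nonneg (a - c))]

/-- The coefficient 1 of B is what matters: the dissipation carries 2B, so half of it remains. The
product A C is a Gronwall term because C is integrable in time by the L² energy law. -/
theorem two_mul_norm_tri_partial_le {u : VField} (hu : IsDivFree u)
    (hfin : triAbs (partialDeriv 1 u) u (partialDeriv 1 u) ≠ ∞) {A B C : ℝ}
    (hA : 0 ≤ A) (hB : 0 ≤ B) (hC : 0 ≤ C)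
    (hA' : anisoSq 0 0 (partialDeriv 1 u) = ENNReal.ofReal A)
    (hB' : anisoSq 0 0 (partialDeriv 0 (partialDeriv 1 u)) = ENNReal.ofReal B)
    (hC' : anisoSq 0 0 (partialDeriv 0 u) = ENNReal.ofReal C) :
    2 * ‖tri (partialDeriv 1 u) u (partialDeriv 1 u)‖ ≤ B + 410 * A * C + 5 * A + 5 * C := by
  have hcomm : partialDeriv 1 (partialDeriv 0 u) = partialDeriv 0 (partialDeriv 1 u) := by
    funext k j
    simp only [partialDeriv]
    ring
  have hv : ∀ k, ‖partialDeriv 1 u k 1‖ₑ ^ 2 ≤ ampSq (partialDeriv 0 u) k := fun k => by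
    rw [enorm_partialDeriv_divFree hu]
    exact enorm_sq_le_ampSq _ k 0
  have key : ∀ i, ‖∑' x, triComp i 1 (partialDeriv 1 u) u (partialDeriv 1 u) x‖ ≤
      5 * (√A * √C) * ((√A + √C + 4 * √B) / 2) := by
    intro i
    set G := convForm (fun k => ‖partialDeriv 1 u k i‖ₑ) (fun k => ‖partialDeriv i u k 1‖ₑ)
      (fun k => ‖partialDeriv 1 u k 1‖ₑ) with hG
    have hGle : ∑' x, ‖triComp i 1 (partialDeriv 1 u) u (partialDeriv 1 u) x‖ₑ = G :=
      tsum_enorm_triComp _ _ _ _ _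
    have hGt : G ≠ ∞ := hGle ▸ ne_top_of_le_ne_top hfin (tsum_enorm_triComp_le _ _ _ _ _)
    have hi : ∀ k, ‖partialDeriv i u k 1‖ₑ ^ 2 ≤ ampSq (partialDeriv 0 u) k := fun k => by
      fin_cases i
      · exact enorm_sq_le_ampSq _ k 1
      · exact hv k
    have hn : ‖∑' x, triComp i 1 (partialDeriv 1 u) u (partialDeriv 1 u) x‖ ≤ G.toReal := by
      rw [← toReal_enorm]
      exact ENNReal.toReal_mono hGt (enorm_tsum_le_tsum_enorm.trans hGle.le)
    refine hn.trans (le_of_interpolation (Real.sqrt_nonneg _) (Real.sqrt_nonneg _)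
      (Real.sqrt_nonneg _) ENNReal.toReal_nonneg ?_ ?_)
    · intro l m hl hm
      have hl0 : 0 < l := by linarith
      have hm0 : 0 < m := by linarith
      rw [Real.sq_sqrt hA, Real.sq_sqrt hB, Real.sq_sqrt hC, ← ENNReal.toReal_pow]
      refine ENNReal.toReal_le_of_le_ofReal (by positivity) ?_
      exact convForm_sq_le_interpolation hl hm hA hB hC (fun k => enorm_sq_le_ampSq _ k i) hi
        (fun k => enorm_sq_le_ampSq _ k 1) hA' hB' hC' (hcomm ▸ hB') hA'
    · intro l m hl hm
      have hl0 : 0 < l := by linarith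
      have hm0 : 0 < m := by linarith
      rw [Real.sq_sqrt hA, Real.sq_sqrt hB, Real.sq_sqrt hC, ← ENNReal.toReal_pow]
      refine ENNReal.toReal_le_of_le_ofReal (by positivity) ?_
      exact convForm_sq_le_interpolation hl hm hA hB hC (fun k => enorm_sq_le_ampSq _ k i) hi
        hv hA' hB' hC' (hcomm ▸ hB') hC'
  rw [tri_partial_cancel hu hfin]
  have h1 := norm_add_le (∑' x, triComp 0 1 (partialDeriv 1 u) u (partialDeriv 1 u) x)
    (∑' x, triComp 1 1 (partialDeriv 1 u) u (partialDeriv 1 u) x)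
  have h2 := key 0
  have h3 := key 1
  obtain ⟨a, ha, rfl⟩ : ∃ a, 0 ≤ a ∧ A = a ^ 2 := ⟨√A, Real.sqrt_nonneg _, (Real.sq_sqrt hA).symm⟩
  obtain ⟨b, hb, rfl⟩ : ∃ a, 0 ≤ a ∧ B = a ^ 2 := ⟨√B, Real.sqrt_nonneg _, (Real.sq_sqrt hB).symm⟩
  obtain ⟨c, hc, rfl⟩ : ∃ a, 0 ≤ a ∧ C = a ^ 2 := ⟨√C, Real.sqrt_nonneg _, (Real.sq_sqrt hC).symm⟩
  rw [Real.sqrt_sq ha, Real.sqrt_sq hb, Real.sqrt_sq hc] at h2 h3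
  -- The two terms together give 10ac(a + c + 4b). Young's inequality turns 40abc into b² + 400a²c²,
  -- and the two other products into 5a²c² + 5a² and 5a²c² + 5c².
  have h4 : 0 ≤ (b - 20 * (a * c)) ^ 2 := sq_nonneg _
  have h5 : 0 ≤ a ^ 2 * (c - 1) ^ 2 := by positivity
  have h6 : 0 ≤ c ^ 2 * (a - 1) ^ 2 := by positivity
  nlinarith [h1, h2, h3, h4, h5, h6]

/-! ### Integral equations, a Gronwall inequality, and global solvability in finite dimension -/

theorem intervalIntegrable_of_mem_Icc {E : Type*} [NormedAddCommGroup E] {f : ℝ → E} {T s t : ℝ}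
    (hf : IntervalIntegrable f volume 0 T) (hs : s ∈ Set.Icc 0 T) (ht : t ∈ Set.Icc 0 T) :
    IntervalIntegrable f volume s t := by
  refine hf.mono_set ?_
  rw [Set.uIcc_of_le (hs.1.trans hs.2)]
  exact Set.uIcc_subset_Icc hs ht

theorem continuousOn_primitive_Icc {E : Type*} [NormedAddCommGroup E] [NormedSpace ℝ E]
    {f : ℝ → E} {T : ℝ} (hT : 0 ≤ T) (hf : IntervalIntegrable f volume 0 T) :
    ContinuousOn (fun t => ∫ s in (0 : ℝ)..t, f s) (Set.Icc 0 T) := by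
  have h := intervalIntegral.continuousOn_primitive_interval' hf (a := 0) Set.left_mem_uIcc
  rwa [Set.uIcc_of_le hT] at h

/-- The right-hand side is only integrable, so x is absolutely continuous rather than C¹, and the
product rule is used almost everywhere. -/
theorem sq_of_eq_integral {T x₀ : ℝ} {x g : ℝ → ℝ} (hg : IntervalIntegrable g volume 0 T)
    (hx : ∀ t ∈ Set.Icc 0 T, x t = x₀ + ∫ s in (0 : ℝ)..t, g s) {t : ℝ} (ht : t ∈ Set.Icc 0 T) :
    x t ^ 2 = x₀ ^ 2 + 2 * ∫ s in (0 : ℝ)..t, x s * g s := by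
  have hT : 0 ≤ T := ht.1.trans ht.2
  have hgt := intervalIntegrable_of_mem_Icc hg (Set.left_mem_Icc.mpr hT) ht
  set F : ℝ → ℝ := fun r => x₀ + ∫ s in (0 : ℝ)..r, g s with hF
  have hP := hgt.absolutelyContinuousOnInterval_intervalIntegral (c := 0) Set.left_mem_uIcc
  have hc : AbsolutelyContinuousOnInterval (fun _ : ℝ => x₀) 0 t :=
    (contDiff_const (n := 1)).contDiffOn.absolutelyContinuousOnInterval
  have hAC : AbsolutelyContinuousOnInterval F 0 t := hc.add hP
  have h := hAC.integral_deriv_mul_eq_sub hAC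
  have h2 : ∫ r in (0 : ℝ)..t, deriv F r * F r + F r * deriv F r =
      ∫ r in (0 : ℝ)..t, 2 * (x r * g r) := by
    refine intervalIntegral.integral_congr_ae ?_
    filter_upwards [hgt.ae_hasDerivAt_integral] with r hr hr'
    have hr'' : r ∈ Set.uIcc 0 t := Set.uIoc_subset_uIcc hr'
    have hd : deriv F r = g r := ((hr hr'' 0 Set.left_mem_uIcc).const_add x₀).deriv
    rw [Set.uIcc_of_le ht.1] at hr''
    rw [hd, hx r ⟨hr''.1, hr''.2.trans ht.2⟩]
    ring
  rw [h2, intervalIntegral.integral_const_mul] at h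
  have h0 : F 0 = x₀ := by simp [hF]
  have hFt : F t = x t := (hx t ht).symm
  rw [h0, hFt] at h
  rw [h]
  ring

theorem normSq_of_eq_integral {T : ℝ} {z₀ : ℂ} {z g : ℝ → ℂ}
    (hg : IntervalIntegrable g volume 0 T)
    (hz : ∀ t ∈ Set.Icc 0 T, z t = z₀ + ∫ s in (0 : ℝ)..t, g s) {t : ℝ}
    (ht : t ∈ Set.Icc 0 T) :
    IntervalIntegrable (fun s => (g s * conj (z s)).re) volume 0 t ∧
    ‖z t‖ ^ 2 = ‖z₀‖ ^ 2 + 2 * ∫ s in (0 : ℝ)..t, (g s * conj (z s)).re := by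
  have hT : 0 ≤ T := ht.1.trans ht.2
  have h0 : (0 : ℝ) ∈ Set.Icc 0 T := Set.left_mem_Icc.mpr hT
  have hre : IntervalIntegrable (fun s => (g s).re) volume 0 T :=
    ⟨hg.1.re, hg.2.re⟩
  have him : IntervalIntegrable (fun s => (g s).im) volume 0 T :=
    ⟨hg.1.im, hg.2.im⟩
  have ere : ∀ r ∈ Set.Icc 0 T, (z r).re = z₀.re + ∫ s in (0 : ℝ)..r, (g s).re := by
    intro r hr
    rw [hz r hr, Complex.add_re]
    congr 1
    exact (Complex.reCLM.intervalIntegral_comp_comm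
      (intervalIntegrable_of_mem_Icc hg h0 hr)).symm
  have eim : ∀ r ∈ Set.Icc 0 T, (z r).im = z₀.im + ∫ s in (0 : ℝ)..r, (g s).im := by
    intro r hr
    rw [hz r hr, Complex.add_im]
    congr 1
    exact (Complex.imCLM.intervalIntegral_comp_comm
      (intervalIntegrable_of_mem_Icc hg h0 hr)).symm
  have hzc : ContinuousOn z (Set.uIcc 0 t) := by
    rw [Set.uIcc_of_le ht.1]
    refine ContinuousOn.congr (f := fun r => z₀ + ∫ s in (0 : ℝ)..r, g s) ?_
      fun r hr => hz r ⟨hr.1, hr.2.trans ht.2⟩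
    exact continuousOn_const.add ((continuousOn_primitive_Icc hT hg).mono
      (Set.Icc_subset_Icc_right ht.2))
  have ire := (intervalIntegrable_of_mem_Icc hre h0 ht).continuousOn_mul
    (Complex.continuous_re.comp_continuousOn hzc)
  have iim := (intervalIntegrable_of_mem_Icc him h0 ht).continuousOn_mul
    (Complex.continuous_im.comp_continuousOn hzc)
  have hsum : ∀ s, (g s * conj (z s)).re = (z s).re * (g s).re + (z s).im * (g s).im := fun s => by
    simp only [Complex.mul_re, Complex.conj_re, Complex.conj_im]
    ring
  simp only [hsum]
  refine ⟨ire.add iim, ?_⟩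
  have hadd := intervalIntegral.integral_add ire iim
  simp only [Function.comp_apply] at hadd
  rw [hadd, ← Complex.normSq_eq_norm_sq, ← Complex.normSq_eq_norm_sq, Complex.normSq_apply,
    Complex.normSq_apply]
  linarith [sq_of_eq_integral hre ere ht, sq_of_eq_integral him eim ht]

/-- Cut the interval at times between which h has integral 1/2. On each piece G(t) ≤ G(r) + G(t)/2
by monotonicity of G, so G at most doubles, and n pieces give 2ⁿ. No continuity of h or e is needed.
-/
theorem gronwall_halving {T K : ℝ} {e h : ℝ → ℝ} (hK : 0 ≤ K)
    (hh : IntervalIntegrable h volume 0 T) (hh0 : ∀ s, 0 ≤ h s) (he0 : ∀ s, 0 ≤ e s)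
    (hhe : IntervalIntegrable (fun s => h s * e s) volume 0 T)
    (he : ∀ t ∈ Set.Icc 0 T, e t ≤ K + ∫ s in (0 : ℝ)..t, h s * e s) (n : ℕ)
    (hn : ∫ s in (0 : ℝ)..T, h s ≤ n / 2) :
    ∀ t ∈ Set.Icc 0 T, K + ∫ s in (0 : ℝ)..t, h s * e s ≤ K * 2 ^ n := by
  intro t₁ ht₁
  have hT : 0 ≤ T := ht₁.1.trans ht₁.2
  have h0 : (0 : ℝ) ∈ Set.Icc 0 T := Set.left_mem_Icc.mpr hT
  set G : ℝ → ℝ := fun t => K + ∫ s in (0 : ℝ)..t, h s * e s with hG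
  set H : ℝ → ℝ := fun t => ∫ s in (0 : ℝ)..t, h s with hH
  have hHc : ContinuousOn H (Set.Icc 0 T) := continuousOn_primitive_Icc hT hh
  have hHsub : ∀ {r t}, r ∈ Set.Icc 0 T → t ∈ Set.Icc 0 T → H t = H r + ∫ s in r..t, h s :=
    fun hr ht => (intervalIntegral.integral_add_adjacent_intervals
      (intervalIntegrable_of_mem_Icc hh h0 hr) (intervalIntegrable_of_mem_Icc hh hr ht)).symm
  have hGsub : ∀ {r t}, r ∈ Set.Icc 0 T → t ∈ Set.Icc 0 T →
      G t = G r + ∫ s in r..t, h s * e s := fun hr ht => by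
    simp only [hG]
    rw [add_assoc, intervalIntegral.integral_add_adjacent_intervals
      (intervalIntegrable_of_mem_Icc hhe h0 hr) (intervalIntegrable_of_mem_Icc hhe hr ht)]
  have hGmono : ∀ {r t}, r ∈ Set.Icc 0 T → t ∈ Set.Icc 0 T → r ≤ t → G r ≤ G t :=
    fun hr ht hrt => by
      rw [hGsub hr ht]
      exact le_add_of_nonneg_right (intervalIntegral.integral_nonneg hrt fun s _ =>
        mul_nonneg (hh0 s) (he0 s))
  have hHmono : ∀ {r t}, r ∈ Set.Icc 0 T → t ∈ Set.Icc 0 T → r ≤ t → H r ≤ H t :=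
    fun hr ht hrt => by
      rw [hHsub hr ht]
      exact le_add_of_nonneg_right (intervalIntegral.integral_nonneg hrt fun s _ => hh0 s)
  have hG0 : G 0 = K := by simp [hG]
  have hH0 : H 0 = 0 := by simp [hH]
  have hstep : ∀ {r t}, r ∈ Set.Icc 0 T → t ∈ Set.Icc 0 T → r ≤ t →
      G t ≤ G r + G t * (H t - H r) := by
    intro r t hr ht hrt
    have h1 : ∫ s in r..t, h s * e s ≤ ∫ s in r..t, h s * G t := by
      refine intervalIntegral.integral_mono_on hrt (intervalIntegrable_of_mem_Icc hhe hr ht)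
        ((intervalIntegrable_of_mem_Icc hh hr ht).mul_const _) fun s hs => ?_
      have hs' : s ∈ Set.Icc 0 T := ⟨hr.1.trans hs.1, hs.2.trans ht.2⟩
      exact mul_le_mul_of_nonneg_left ((he s hs').trans (hGmono hs' ht hs.2)) (hh0 s)
    rw [intervalIntegral.integral_mul_const] at h1
    have h2 := hGsub hr ht
    have h3 : H t - H r = ∫ s in r..t, h s := by rw [hHsub hr ht, add_sub_cancel_left]
    rw [h3, mul_comm (G t)]
    linarith
  have key : ∀ m : ℕ, ∀ t ∈ Set.Icc 0 T, H t ≤ m / 2 → G t ≤ K * 2 ^ m := by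
    intro m
    induction m with
    | zero =>
      intro t ht hm
      have h1 := hstep h0 ht ht.1
      have h2 := hHmono h0 ht ht.1
      rw [hG0, hH0] at h1
      have h3 : H t = 0 := by
        rw [hH0] at h2
        refine le_antisymm ?_ h2
        simpa using hm
      simpa [h3] using h1
    | succ m ih =>
      intro t ht hm
      by_cases hlt : H t ≤ m / 2
      · refine (ih t ht hlt).trans (mul_le_mul_of_nonneg_left ?_ hK)
        exact pow_le_pow_right₀ one_le_two m.le_succ
      -- The last time at which the previous bound is used comes from the intermediate value theorem
      -- for the continuous primitive of h.
      · obtain ⟨r, hr, hHr⟩ : (m / 2 : ℝ) ∈ H '' Set.Icc 0 t := by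
          refine intermediate_value_Icc ht.1 (hHc.mono (Set.Icc_subset_Icc_right ht.2)) ⟨?_, ?_⟩
          · rw [hH0]; positivity
          · linarith
        have hr' : r ∈ Set.Icc 0 T := ⟨hr.1, hr.2.trans ht.2⟩
        have h1 := hstep hr' ht hr.2
        have h2 := ih r hr' hHr.le
        have h3 : 0 ≤ G t := by
          have := hGmono h0 ht ht.1
          rw [hG0] at this
          linarith
        have h4 : H t - H r ≤ 1 / 2 := by
          rw [hHr]
          push_cast at hm
          linarith
        have h5 : G t * (H t - H r) ≤ G t * (1 / 2) := mul_le_mul_of_nonneg_left h4 h3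
        rw [pow_succ]
        linarith
  exact key n t₁ ht₁ ((hHmono ht₁ (Set.right_mem_Icc.mpr hT) ht₁.2).trans hn)

/-- A finite-dimensional quadratic differential equation has a global solution if the solutions of
all its damped versions are bounded by the same constant. -/
theorem exists_solution_of_bound {E : Type*} [NormedAddCommGroup E] [NormedSpace ℝ E]
    [FiniteDimensional ℝ E] {T : ℝ} (hT : 0 ≤ T) (x₀ : E) (M : ℝ → E →L[ℝ] E)
    (hM : ContinuousOn M (Set.Icc 0 T)) (Q : E →L[ℝ] E →L[ℝ] E) (f : ℝ → E)
    (hf : IntervalIntegrable f volume 0 T) (R : ℝ)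
    (hR : ∀ θ : ℝ → ℝ, (∀ s, θ s ∈ Set.Icc (0 : ℝ) 1) → ContinuousOn θ (Set.Icc 0 T) →
      ∀ X : ℝ → E, ContinuousOn X (Set.Icc 0 T) →
        (∀ t ∈ Set.Icc 0 T, X t = x₀ + ∫ s in (0 : ℝ)..t,
          (θ s • (M s (X s) + Q (X s) (X s)) + f s)) → ∀ t ∈ Set.Icc 0 T, ‖X t‖ ≤ R) :
    ∃ X : ℝ → E, ContinuousOn X (Set.Icc 0 T) ∧ ∀ t ∈ Set.Icc 0 T,
      X t = x₀ + ∫ s in (0 : ℝ)..t, (M s (X s) + Q (X s) (X s) + f s) := by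
  have h0 : (0 : ℝ) ∈ Set.Icc 0 T := Set.left_mem_Icc.mpr hT
  -- The cutoff equals 1 on the ball where the a priori bound places all solutions, and makes the
  -- quadratic vector field bounded and globally Lipschitz.
  let χ : ContDiffBump (0 : E) := ⟨max R 1, max R 1 + 1, by positivity, by linarith⟩
  set ρ : ℝ := max R 1 + 1 with hρ
  have hρ0 : 0 ≤ ρ := by positivity
  obtain ⟨L, hL⟩ := ContDiff.lipschitzWith_of_hasCompactSupport (𝕂 := ℝ) χ.hasCompactSupport
    (χ.contDiff (n := 1)) one_ne_zero
  obtain ⟨B, hB⟩ := isCompact_Icc.exists_bound_of_continuousOn hM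
  have hB0 : 0 ≤ B := (norm_nonneg _).trans (hB 0 h0)
  set V : ℝ → E → E := fun s x => M s x + Q x x with hV
  set A : ℝ := B * ρ + ‖Q‖ * ρ * ρ with hA
  have hA0 : 0 ≤ A := by positivity
  have hVb : ∀ s ∈ Set.Icc 0 T, ∀ x, ‖x‖ ≤ ρ → ‖V s x‖ ≤ A := by
    intro s hs x hx
    refine (norm_add_le _ _).trans (add_le_add ?_ ?_)
    · exact ((M s).le_opNorm x).trans (mul_le_mul (hB s hs) hx (norm_nonneg _) hB0)
    · refine (Q.le_opNorm₂ x x).trans ?_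
      gcongr
  set D : ℝ := B + ‖Q‖ * ρ + ‖Q‖ * ρ with hD
  have hD0 : 0 ≤ D := by positivity
  have hVl : ∀ s ∈ Set.Icc 0 T, ∀ x y, ‖x‖ ≤ ρ → ‖y‖ ≤ ρ → ‖V s x - V s y‖ ≤ D * ‖x - y‖ := by
    intro s hs x y hx hy
    have e : V s x - V s y = M s (x - y) + Q (x - y) x + Q y (x - y) := by
      simp only [hV, map_sub, sub_apply]
      abel
    rw [e, hD, add_mul, add_mul]
    refine (norm_add₃_le).trans (add_le_add (add_le_add ?_ ?_) ?_)
    · exact ((M s).le_opNorm _).trans (mul_le_mul_of_nonneg_right (hB s hs) (norm_nonneg _))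
    · refine (Q.le_opNorm₂ _ _).trans ?_
      rw [mul_right_comm]
      gcongr
    · refine (Q.le_opNorm₂ _ _).trans ?_
      gcongr
  set W : ℝ → E → E := fun s x => χ x • V s x with hW
  have hχ1 : ∀ x, ‖χ x‖ ≤ 1 := fun x => by
    rw [Real.norm_of_nonneg χ.nonneg]
    exact χ.le_one
  have hχ0 : ∀ x, ρ ≤ ‖x‖ → χ x = 0 := fun x hx =>
    χ.zero_of_le_dist (by simpa using hx)
  have hWb : ∀ s ∈ Set.Icc 0 T, ∀ x, ‖W s x‖ ≤ A := by
    intro s hs x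
    rcases le_total ‖x‖ ρ with hx | hx
    · rw [hW, norm_smul]
      calc ‖χ x‖ * ‖V s x‖ ≤ 1 * A :=
            mul_le_mul (hχ1 x) (hVb s hs x hx) (norm_nonneg _) zero_le_one
        _ = A := one_mul _
    · simpa [hW, hχ0 x hx] using hA0
  have hWl' : ∀ s ∈ Set.Icc 0 T, ∀ x y, ‖y‖ ≤ ρ →
      ‖W s x - W s y‖ ≤ (L * A + D) * ‖x - y‖ := by
    intro s hs x y hy
    have hLxy : ‖χ x - χ y‖ ≤ L * ‖x - y‖ := by
      simpa [dist_eq_norm] using hL.dist_le_mul x y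
    rcases le_total ‖x‖ ρ with hx | hx
    · have e : W s x - W s y = (χ x - χ y) • V s y + χ x • (V s x - V s y) := by
        simp only [hW, smul_sub, sub_smul]
        abel
      rw [e, add_mul]
      refine (norm_add_le _ _).trans (add_le_add ?_ ?_)
      · rw [norm_smul, mul_right_comm]
        exact mul_le_mul hLxy (hVb s hs y hy) (norm_nonneg _) (by positivity)
      · rw [norm_smul]
        calc ‖χ x‖ * ‖V s x - V s y‖ ≤ 1 * (D * ‖x - y‖) :=
              mul_le_mul (hχ1 x) (hVl s hs x y hx hy) (norm_nonneg _) zero_le_one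
          _ = _ := one_mul _
    · have e : W s x - W s y = (χ x - χ y) • V s y := by
        simp [hW, hχ0 x hx]
      rw [e, norm_smul]
      calc ‖χ x - χ y‖ * ‖V s y‖ ≤ (L * ‖x - y‖) * A :=
            mul_le_mul hLxy (hVb s hs y hy) (norm_nonneg _) (by positivity)
        _ ≤ (L * A + D) * ‖x - y‖ := by
            have : 0 ≤ D * ‖x - y‖ := by positivity
            linarith
  have hWl : ∀ s ∈ Set.Icc 0 T, ∀ x y, ‖W s x - W s y‖ ≤ (L * A + D) * ‖x - y‖ := by
    intro s hs x y
    rcases le_total ‖y‖ ρ with hy | hy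
    · exact hWl' s hs x y hy
    rcases le_total ‖x‖ ρ with hx | hx
    · rw [norm_sub_rev, norm_sub_rev x y]
      exact hWl' s hs y x hx
    · have : (0 : ℝ) ≤ (L * A + D) * ‖x - y‖ := by positivity
      simpa [hW, hχ0 x hx, hχ0 y hy] using this
  set F : ℝ → E := fun t => ∫ s in (0 : ℝ)..t, f s with hF
  have hFc : ContinuousOn F (Set.Icc 0 T) := continuousOn_primitive_Icc hT hf
  have hWc : ∀ x : ℝ → E, ContinuousOn x (Set.Icc 0 T) →
      ContinuousOn (fun s => W s (x s)) (Set.Icc 0 T) := by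
    intro x hx
    refine (χ.continuous.comp_continuousOn hx).smul ((hM.clm_apply hx).add ?_)
    exact (Q.continuous.comp_continuousOn hx).clm_apply hx
  -- Since f is only integrable, Picard–Lindelöf is applied to X minus the primitive of f, whose
  -- equation is continuous in time. The field is bounded by A everywhere, so the radius A T gives a
  -- solution on the whole interval.
  have hPL : IsPicardLindelof (fun s y => W s (y + F s)) (⟨0, h0⟩ : Set.Icc 0 T) x₀
      (NNReal.mk (A * T) (by positivity)) 0 (NNReal.mk A hA0)
      (NNReal.mk (L * A + D) (by positivity)) := by
    refine ⟨fun s hs => ?_, fun x _ => ?_, fun s hs x _ => hWb s hs _, ?_⟩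
    · refine LipschitzOnWith.of_dist_le_mul fun x _ y _ => ?_
      rw [dist_eq_norm, dist_eq_norm]
      have := hWl s hs (x + F s) (y + F s)
      rwa [add_sub_add_right_eq_sub] at this
    · exact hWc _ (continuousOn_const.add hFc)
    · simp only [sub_zero, sub_self, max_eq_left hT, NNReal.coe_zero]
      exact le_rfl
  have hx0 : x₀ ∈ Metric.closedBall x₀ ((0 : ℝ≥0) : ℝ) := by simp
  obtain ⟨α, hα⟩ := ODE.FunSpace.exists_isFixedPt_next hPL hx0
  set Y : ℝ → E := α.compProj with hYdef
  have hYc : ContinuousOn Y (Set.Icc 0 T) := α.continuous_compProj.continuousOn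
  have hY : ∀ t ∈ Set.Icc 0 T, Y t = x₀ + ∫ s in (0 : ℝ)..t, W s (Y s + F s) := by
    intro t ht
    have h1 : (ODE.FunSpace.next hPL hx0 α).compProj t =
        x₀ + ∫ s in (0 : ℝ)..t, W s (Y s + F s) := by
      rw [ODE.FunSpace.compProj_apply, ODE.FunSpace.next_apply, Set.projIcc_of_mem _ ht]
      rfl
    rw [← h1, hα]
  set X : ℝ → E := fun t => Y t + F t with hX
  have hXc : ContinuousOn X (Set.Icc 0 T) := hYc.add hFc
  have hWX : IntervalIntegrable (fun s => W s (X s)) volume 0 T :=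
    (hWc X hXc).intervalIntegrable_of_Icc hT
  have hXeq : ∀ t ∈ Set.Icc 0 T, X t = x₀ + ∫ s in (0 : ℝ)..t, (W s (X s) + f s) := by
    intro t ht
    rw [intervalIntegral.integral_add (intervalIntegrable_of_mem_Icc hWX h0 ht)
      (intervalIntegrable_of_mem_Icc hf h0 ht), ← add_assoc, ← hY t ht]
  -- Along the solution the cutoff is a scalar factor in [0,1], so X solves a damped equation and
  -- obeys the common bound. Hence the cutoff is 1 along X, and X solves the original equation.
  have hb := hR (fun s => χ (X s)) (fun s => ⟨χ.nonneg, χ.le_one⟩)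
    (χ.continuous.comp_continuousOn hXc) X hXc hXeq
  refine ⟨X, hXc, fun t ht => ?_⟩
  rw [hXeq t ht]
  congr 1
  refine intervalIntegral.integral_congr fun s hs => ?_
  rw [Set.uIcc_of_le ht.1] at hs
  have hs1 : χ (X s) = 1 := χ.one_of_mem_closedBall (by
    rw [mem_closedBall_zero_iff]
    exact (hb s ⟨hs.1, hs.2.trans ht.2⟩).trans (le_max_left _ _))
  simp only [hW, hs1, one_smul, hV]

/-! ### Boxes of frequencies, truncation, and the energy identity -/

/-- The frequencies with `|k₁|, |k₂| ≤ n`. -/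
def box (n : ℕ) : Finset Freq := Fintype.piFinset fun _ => Finset.Icc (-(n : ℤ)) n

theorem mem_box {n : ℕ} {k : Freq} : k ∈ box n ↔ ∀ i, |k i| ≤ n := by
  simp [box, abs_le]

theorem neg_mem_box {n : ℕ} {k : Freq} : -k ∈ box n ↔ k ∈ box n := by
  simp [mem_box]

theorem box_mono {m n : ℕ} (h : m ≤ n) : box m ⊆ box n := fun k hk => by
  rw [mem_box] at hk ⊢
  exact fun i => (hk i).trans (by exact_mod_cast h)

theorem tendsto_box : Tendsto box atTop atTop := by
  refine tendsto_atTop_finset_of_monotone (fun _ _ h => box_mono h) fun k => ?_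
  refine ⟨∑ i, (k i).natAbs, mem_box.mpr fun i => ?_⟩
  have h : (k i).natAbs ≤ ∑ i, (k i).natAbs :=
    Finset.single_le_sum (f := fun i => (k i).natAbs) (fun _ _ => Nat.zero_le _)
      (Finset.mem_univ i)
  rw [Int.abs_eq_natAbs]
  exact_mod_cast h

/-- The weighted sum of squares over a box of frequencies. -/
def boxSq (n : ℕ) (ω : Freq → ℝ) (u : VField) : ℝ := ∑ k ∈ box n, ω k * ∑ j, ‖u k j‖ ^ 2

/-- The weighted real inner product over a box of frequencies. -/
def boxPairing (n : ℕ) (ω : Freq → ℝ) (F u : VField) : ℝ :=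
  ∑ k ∈ box n, ω k * ∑ j, (F k j * conj (u k j)).re

theorem boxSq_nonneg {n : ℕ} {ω : Freq → ℝ} (hω : ∀ k, 0 ≤ ω k) (u : VField) :
    0 ≤ boxSq n ω u :=
  Finset.sum_nonneg fun k _ => mul_nonneg (hω k) (Finset.sum_nonneg fun _ _ => by positivity)

theorem boxSq_add_weight (n : ℕ) (ω η : Freq → ℝ) (u : VField) :
    boxSq n (fun k => ω k + η k) u = boxSq n ω u + boxSq n η u := by
  simp [boxSq, add_mul, Finset.sum_add_distrib]

theorem energy_identity {T : ℝ} (n : ℕ) (ω : Freq → ℝ) {x₀ : VField} {U G : ℝ → VField}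
    (hG : ∀ k ∈ box n, ∀ j, IntervalIntegrable (fun s => G s k j) volume 0 T)
    (hU : ∀ k ∈ box n, ∀ j, ∀ t ∈ Set.Icc 0 T,
      U t k j = x₀ k j + ∫ s in (0 : ℝ)..t, G s k j) {t : ℝ} (ht : t ∈ Set.Icc 0 T) :
    IntervalIntegrable (fun s => boxPairing n ω (G s) (U s)) volume 0 t ∧
    boxSq n ω (U t) =
      boxSq n ω x₀ + 2 * ∫ s in (0 : ℝ)..t, boxPairing n ω (G s) (U s) := by
  have h := fun k (hk : k ∈ box n) j => normSq_of_eq_integral (hG k hk j) (hU k hk j) ht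
  have hint : ∀ k ∈ box n, IntervalIntegrable
      (fun s => ω k * ∑ j, (G s k j * conj (U s k j)).re) volume 0 t := fun k hk => by
    have h1 := (IntervalIntegrable.sum Finset.univ fun j _ => (h k hk j).1).const_mul (ω k)
    simpa only [Finset.sum_apply] using h1
  refine ⟨?_, ?_⟩
  · simpa only [boxPairing, Finset.sum_fn] using IntervalIntegrable.sum (box n) hint
  · unfold boxPairing boxSq
    rw [intervalIntegral.integral_finsetSum hint, Finset.mul_sum, ← Finset.sum_add_distrib]
    refine Finset.sum_congr rfl fun k hk => ?_
    rw [intervalIntegral.integral_const_mul, intervalIntegral.integral_finsetSum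
      fun j _ => (h k hk j).1]
    rw [Finset.sum_congr rfl fun j _ => (h k hk j).2, Finset.sum_add_distrib, ← Finset.mul_sum]
    ring

/-- Young's inequality 2⟨F,u⟩ ≤ |F|²/r + r|u|² in a form that uses only the first power of r. The
forcing is merely integrable in time, so r² would be too much. -/
theorem two_mul_boxPairing_le {n : ℕ} {ω : Freq → ℝ} (hω : ∀ k, 0 ≤ ω k) {F u : VField} {r : ℝ}
    (hr : 0 ≤ r) (hF : boxSq n ω F ≤ r ^ 2) :
    2 * boxPairing n ω F u ≤ r * (1 + boxSq n ω u) := by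
  set S := boxSq n ω u with hS
  have hS0 : 0 ≤ S := boxSq_nonneg hω u
  have key : ∀ a : ℝ, 0 < a → 2 * a * boxPairing n ω F u ≤ boxSq n ω F + a ^ 2 * S := by
    intro a ha
    rw [hS]
    unfold boxPairing boxSq
    rw [Finset.mul_sum, Finset.mul_sum, ← Finset.sum_add_distrib]
    refine Finset.sum_le_sum fun k _ => ?_
    have h1 : ∀ j, 2 * a * (F k j * conj (u k j)).re ≤ ‖F k j‖ ^ 2 + a ^ 2 * ‖u k j‖ ^ 2 := by
      intro j
      rw [← Complex.normSq_eq_norm_sq, ← Complex.normSq_eq_norm_sq, Complex.normSq_apply,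
        Complex.normSq_apply]
      simp only [Complex.mul_re, Complex.conj_re, Complex.conj_im]
      nlinarith [sq_nonneg ((F k j).re - a * (u k j).re), sq_nonneg ((F k j).im - a * (u k j).im)]
    have h2 := Finset.sum_le_sum fun j (_ : j ∈ Finset.univ) => h1 j
    rw [← Finset.mul_sum, Finset.sum_add_distrib, ← Finset.mul_sum] at h2
    calc 2 * a * (ω k * ∑ j, (F k j * conj (u k j)).re)
        = ω k * (2 * a * ∑ j, (F k j * conj (u k j)).re) := by ring
      _ ≤ ω k * (∑ j, ‖F k j‖ ^ 2 + a ^ 2 * ∑ j, ‖u k j‖ ^ 2) :=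
          mul_le_mul_of_nonneg_left h2 (hω k)
      _ = _ := by ring
  -- For r = 0 Young's inequality with parameter P/(S+1) shows that the pairing P cannot be
  -- positive.
  rcases hr.eq_or_lt with rfl | hr
  · rw [zero_mul]
    by_contra! hlt
    have h2 : 0 < boxPairing n ω F u := by linarith
    have h1 := key (boxPairing n ω F u / (S + 1)) (by positivity)
    set P := boxPairing n ω F u with hP
    have h3 : 2 * (P / (S + 1)) * P ≤ (P / (S + 1)) ^ 2 * S := by nlinarith
    have h4 : (P / (S + 1)) ^ 2 * S ≤ (P / (S + 1)) * P := by
      have : (P / (S + 1)) * S ≤ P := by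
        rw [div_mul_eq_mul_div, div_le_iff₀ (by positivity)]
        nlinarith
      have h5 : 0 ≤ P / (S + 1) := by positivity
      nlinarith
    have h6 : 0 < P / (S + 1) * P := by positivity
    linarith
  · have h1 := key r hr
    have h2 : r * (2 * boxPairing n ω F u) ≤ r * (r * (1 + S)) := by nlinarith
    exact le_of_mul_le_mul_left h2 hr

theorem ofReal_boxSq (n : ℕ) (u : VField) (a b : ℕ) :
    ENNReal.ofReal (boxSq n (anisoWeight a b) u) =
      ∑ k ∈ box n, ENNReal.ofReal (anisoWeight a b k) * ampSq u k := by
  rw [boxSq, ENNReal.ofReal_sum_of_nonneg fun k _ => mul_nonneg (anisoWeight_pos a b k).le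
    (Finset.sum_nonneg fun _ _ => by positivity)]
  refine Finset.sum_congr rfl fun k _ => ?_
  rw [ENNReal.ofReal_mul (anisoWeight_pos a b k).le, ampSq,
    ENNReal.ofReal_sum_of_nonneg fun _ _ => by positivity]
  congr 1
  refine Finset.sum_congr rfl fun j _ => ?_
  rw [ENNReal.ofReal_pow (norm_nonneg _), ofReal_norm]

theorem anisoSq_eq_boxSq {n : ℕ} {u : VField} (hu : ∀ k ∉ box n, u k = 0) (a b : ℕ) :
    anisoSq a b u = ENNReal.ofReal (boxSq n (anisoWeight a b) u) := by
  rw [anisoSq_natCast, ofReal_boxSq, tsum_eq_sum (s := box n) fun k hk => by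
    rw [ampSq_eq_zero (hu k hk), mul_zero]]

theorem ofReal_boxSq_le (n : ℕ) (u : VField) (a b : ℕ) :
    ENNReal.ofReal (boxSq n (anisoWeight a b) u) ≤ anisoSq a b u := by
  rw [anisoSq_natCast, ofReal_boxSq]
  exact ENNReal.sum_le_tsum (box n)

/-- The Fourier truncation to a box of frequencies. -/
def trunc (n : ℕ) (u : VField) : VField := fun k j => if k ∈ box n then u k j else 0

theorem trunc_apply_of_mem {n : ℕ} {k : Freq} (hk : k ∈ box n) (u : VField) (j : Fin 2) :
    trunc n u k j = u k j := by simp [trunc, hk]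

theorem trunc_apply_of_notMem {n : ℕ} {k : Freq} (hk : k ∉ box n) (u : VField) :
    trunc n u k = 0 := by
  funext j
  simp [trunc, hk]

theorem isRealField_trunc {u : VField} (hu : IsRealField u) (n : ℕ) :
    IsRealField (trunc n u) := fun k j => by
  by_cases hk : k ∈ box n
  · rw [trunc_apply_of_mem hk, trunc_apply_of_mem (neg_mem_box.mpr hk), hu k j]
  · rw [trunc_apply_of_notMem hk, trunc_apply_of_notMem (mt neg_mem_box.mp hk)]
    simp

theorem isDivFree_trunc {u : VField} (hu : IsDivFree u) (n : ℕ) : IsDivFree (trunc n u) :=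
  fun k => by
    by_cases hk : k ∈ box n
    · simpa only [trunc_apply_of_mem hk] using hu k
    · simp [trunc_apply_of_notMem hk]

theorem anisoSq_trunc_le (n : ℕ) (u : VField) (s s' : ℝ) :
    anisoSq s s' (trunc n u) ≤ anisoSq s s' u := by
  refine ENNReal.tsum_le_tsum fun k => mul_le_mul_right (Finset.sum_le_sum fun j _ => ?_) _
  by_cases hk : k ∈ box n
  · rw [trunc_apply_of_mem hk]
  · simp [trunc_apply_of_notMem hk]

theorem finite_support_of_box {n : ℕ} {u : VField} (hu : ∀ k ∉ box n, u k = 0) :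
    (Function.support u).Finite :=
  (box n).finite_toSet.subset fun k hk => by
    by_contra h
    exact hk (hu k h)

/-! ### Algebra of the bilinear term and its pairing with weighted fields -/

theorem isRealField_advection {u v : VField} (hu : IsRealField u) (hv : IsRealField v) :
    IsRealField (advection u v) := fun k j => by
  unfold advection
  rw [← (Equiv.neg Freq).tsum_eq, Complex.conj_tsum]
  refine tsum_congr fun l => ?_
  have h : -k - -l = -(k - l) := by abel
  simp only [Equiv.neg_apply, h, map_sum, map_mul]
  refine Finset.sum_congr rfl fun i _ => ?_
  rw [hu (k - l) i, isRealField_partialDeriv hv i l j]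

theorem isRealField_leray {u : VField} (hu : IsRealField u) : IsRealField (leray u) :=
  fun k j => by
    simp only [leray, hu k, Fin.sum_univ_two, Pi.neg_apply, Int.cast_neg, map_sub, map_div₀,
      map_mul, map_add, map_pow, map_intCast]
    ring

theorem isDivFree_leray (u : VField) : IsDivFree (leray u) := fun k => by
  simp only [leray, Fin.sum_univ_two]
  by_cases hk : (k 0 : ℂ) ^ 2 + (k 1 : ℂ) ^ 2 = 0
  · have hk' : k 0 ^ 2 + k 1 ^ 2 = 0 := by exact_mod_cast hk
    have h0 : k 0 = 0 := by nlinarith [sq_nonneg (k 0), sq_nonneg (k 1)]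
    have h1 : k 1 = 0 := by nlinarith [sq_nonneg (k 0), sq_nonneg (k 1)]
    simp [h0, h1]
  · field_simp
    ring

theorem isRealField_bilinB {u v : VField} (hu : IsRealField u) (hv : IsRealField v) :
    IsRealField (bilinB u v) := isRealField_leray (isRealField_advection hu hv)

theorem isDivFree_bilinB (u v : VField) : IsDivFree (bilinB u v) := isDivFree_leray _

theorem leray_add (u v : VField) : leray (u + v) = leray u + leray v := by
  funext k j
  simp only [leray, Pi.add_apply, Fin.sum_univ_two]
  ring

theorem leray_smul (c : ℝ) (u : VField) : leray (c • u) = c • leray u := by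
  funext k j
  simp only [leray, Pi.smul_apply, Fin.sum_univ_two, Complex.real_smul]
  ring

theorem summable_advection_of_finite {u v : VField} (hv : (Function.support v).Finite)
    (k : Freq) (j : Fin 2) : Summable fun l => ∑ i, u (k - l) i * partialDeriv i v l j := by
  refine summable_of_hasFiniteSupport (hv.subset fun l hl h => hl ?_)
  simp [partialDeriv, h]

theorem advection_add_left {u u' v : VField}
    (h : ∀ k j, Summable fun l => ∑ i, u (k - l) i * partialDeriv i v l j)
    (h' : ∀ k j, Summable fun l => ∑ i, u' (k - l) i * partialDeriv i v l j) :
    advection (u + u') v = advection u v + advection u' v := by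
  funext k j
  simp only [advection, Pi.add_apply]
  rw [← (h k j).tsum_add (h' k j)]
  refine tsum_congr fun l => ?_
  simp only [Fin.sum_univ_two]
  ring

theorem advection_add_right {u v v' : VField}
    (h : ∀ k j, Summable fun l => ∑ i, u (k - l) i * partialDeriv i v l j)
    (h' : ∀ k j, Summable fun l => ∑ i, u (k - l) i * partialDeriv i v' l j) :
    advection u (v + v') = advection u v + advection u v' := by
  funext k j
  simp only [advection, Pi.add_apply]
  rw [← (h k j).tsum_add (h' k j)]
  refine tsum_congr fun l => ?_
  simp only [Fin.sum_univ_two, partialDeriv, Pi.add_apply]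
  ring

theorem advection_smul_left (c : ℝ) (u v : VField) :
    advection (c • u) v = c • advection u v := by
  funext k j
  simp only [advection, Pi.smul_apply, Complex.real_smul]
  rw [← tsum_mul_left]
  refine tsum_congr fun l => ?_
  simp only [Fin.sum_univ_two]
  ring

theorem advection_smul_right (c : ℝ) (u v : VField) :
    advection u (c • v) = c • advection u v := by
  funext k j
  simp only [advection, Pi.smul_apply, Complex.real_smul]
  rw [← tsum_mul_left]
  refine tsum_congr fun l => ?_
  simp only [Fin.sum_univ_two, partialDeriv, Pi.smul_apply, Complex.real_smul]
  ring

/-- Multiplication of the Fourier coefficients by a real symbol. -/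
def weighted (ω : Freq → ℝ) (u : VField) : VField := fun k j => (ω k : ℂ) * u k j

theorem sum_bilinB_mul {n : ℕ} {a b z : VField} (h : triAbs a b z ≠ ∞) (hd : IsDivFree z)
    (hz : ∀ k ∉ box n, z k = 0) :
    ∑ k ∈ box n, ∑ j, bilinB a b k j * z (-k) j = tri a b z := by
  rw [← (hasSum_advection h).tsum_eq, tsum_eq_sum (s := box n)]
  · exact Finset.sum_congr rfl fun k _ => sum_leray_mul hd _ k
  · intro k hk
    simp [hz (-k) (mt neg_mem_box.mp hk)]

/-- Because u lives in the box, truncating the nonlinearity costs nothing in the pairing. Evenness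
of the weight and reality of u replace conjugation by k ↦ -k. -/
theorem boxPairing_bilinB {n : ℕ} {ω : Freq → ℝ} (hω : ∀ k, ω (-k) = ω k) {a b u : VField}
    (h : triAbs a b (weighted ω u) ≠ ∞) (hr : IsRealField u) (hd : IsDivFree u)
    (hu : ∀ k ∉ box n, u k = 0) :
    boxPairing n ω (bilinB a b) u = (tri a b (weighted ω u)).re := by
  have hd' : IsDivFree (weighted ω u) := fun k => by
    have := hd k
    simp only [weighted, Fin.sum_univ_two] at this ⊢
    linear_combination (ω k : ℂ) * this
  rw [← sum_bilinB_mul (n := n) h hd' fun k hk => by funext j; simp [weighted, hu k hk],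
    Complex.re_sum]
  refine Finset.sum_congr rfl fun k _ => ?_
  rw [Complex.re_sum, Finset.mul_sum]
  refine Finset.sum_congr rfl fun j _ => ?_
  simp only [weighted, hω, hr k j]
  rw [mul_left_comm, Complex.re_ofReal_mul]

theorem boxPairing_add (n : ℕ) (ω : Freq → ℝ) (F G u : VField) :
    boxPairing n ω (F + G) u = boxPairing n ω F u + boxPairing n ω G u := by
  simp only [boxPairing, Pi.add_apply, add_mul, Complex.add_re, Finset.sum_add_distrib, mul_add]

theorem boxPairing_smul (n : ℕ) (ω : Freq → ℝ) (c : ℝ) (F u : VField) :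
    boxPairing n ω (c • F) u = c * boxPairing n ω F u := by
  simp only [boxPairing, Pi.smul_apply, Complex.real_smul, mul_assoc, Complex.re_ofReal_mul,
    Finset.mul_sum]
  exact Finset.sum_congr rfl fun k _ => Finset.sum_congr rfl fun j _ => by ring

theorem boxPairing_sub (n : ℕ) (ω : Freq → ℝ) (F G u : VField) :
    boxPairing n ω (F - G) u = boxPairing n ω F u - boxPairing n ω G u := by
  simp only [boxPairing, Pi.sub_apply, sub_mul, Complex.sub_re, Finset.sum_sub_distrib, mul_sub]

theorem boxPairing_laplace (n : ℕ) (ω : Freq → ℝ) (u : VField) :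
    boxPairing n ω (partialDeriv 0 (partialDeriv 0 u)) u =
      -boxSq n (fun k => (k 0 : ℝ) ^ 2 * ω k) u := by
  simp only [boxPairing, boxSq]
  rw [← Finset.sum_neg_distrib]
  refine Finset.sum_congr rfl fun k _ => ?_
  have h : ∀ j, (partialDeriv 0 (partialDeriv 0 u) k j * conj (u k j)).re =
      -((k 0 : ℝ) ^ 2 * ‖u k j‖ ^ 2) := fun j => by
    have e : partialDeriv 0 (partialDeriv 0 u) k j * conj (u k j) =
        ((-((k 0 : ℝ) ^ 2 * ‖u k j‖ ^ 2) : ℝ) : ℂ) := by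
      have h1 := Complex.mul_conj' (u k j)
      simp only [partialDeriv]
      push_cast
      linear_combination (Complex.I ^ 2 * (k 0 : ℂ) ^ 2) * h1 +
        ((k 0 : ℂ) ^ 2 * (‖u k j‖ : ℂ) ^ 2) * Complex.I_sq
    rw [e, Complex.ofReal_re]
  simp_rw [h]
  rw [Finset.sum_neg_distrib, ← Finset.mul_sum]
  ring

theorem tri_neg_right (u v w : VField) : tri u v (-w) = -tri u v w := by
  unfold tri
  rw [← tsum_neg]
  refine tsum_congr fun x => ?_
  simp [triTerm, triComp, Fin.sum_univ_two]
  ring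

theorem tri_add_right {u v w w' : VField} (h : triAbs u v w ≠ ∞) (h' : triAbs u v w' ≠ ∞) :
    tri u v (w + w') = tri u v w + tri u v w' := by
  unfold tri
  rw [← (summable_triTerm h).tsum_add (summable_triTerm h')]
  refine tsum_congr fun x => ?_
  simp only [triTerm, triComp, Fin.sum_univ_two, Pi.add_apply]
  ring

/-- The symbol of `-∂₂²`. -/
def vertSymbol (k : Freq) : ℝ := (k 1 : ℝ) ^ 2

section FiniteSupport

variable {a b u : VField}

theorem finite_support_partialDeriv (hu : (Function.support u).Finite) (i : Fin 2) :
    (Function.support (partialDeriv i u)).Finite := hu.subset (support_partialDeriv_subset i u)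

theorem finite_support_weighted (hu : (Function.support u).Finite) (ω : Freq → ℝ) :
    (Function.support (weighted ω u)).Finite := hu.subset fun k hk h => hk (by
  funext j
  simp [weighted, h])

theorem tri_vertSymbol (ha : (Function.support a).Finite) (hb : (Function.support b).Finite)
    (hu : (Function.support u).Finite) :
    tri a b (weighted vertSymbol u) =
      tri (partialDeriv 1 a) b (partialDeriv 1 u) + tri a (partialDeriv 1 b) (partialDeriv 1 u) := by
  have e : weighted vertSymbol u = -partialDeriv 1 (partialDeriv 1 u) := by
    funext k j
    simp only [weighted, vertSymbol, Pi.neg_apply, partialDeriv]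
    push_cast
    linear_combination ((k 1 : ℂ) ^ 2 * u k j) * Complex.I_sq
  rw [e, tri_neg_right, tri_partial_right
    (triAbs_ne_top_of_finite (finite_support_partialDeriv ha 1) hb
      (finite_support_partialDeriv hu 1))
    (triAbs_ne_top_of_finite ha (finite_support_partialDeriv hb 1)
      (finite_support_partialDeriv hu 1)), neg_neg]

theorem tri_weight_zero (a b u : VField) : tri a b (weighted (anisoWeight 0 0) u) = tri a b u := by
  congr 1
  funext k j
  simp [weighted, anisoWeight]

theorem tri_weight_one (ha : (Function.support a).Finite) (hb : (Function.support b).Finite)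
    (hu : (Function.support u).Finite) :
    tri a b (weighted (anisoWeight 0 1) u) = tri a b u +
      (tri (partialDeriv 1 a) b (partialDeriv 1 u) +
        tri a (partialDeriv 1 b) (partialDeriv 1 u)) := by
  have e : weighted (anisoWeight 0 1) u = u + weighted vertSymbol u := by
    funext k j
    simp only [weighted, vertSymbol, anisoWeight, Pi.add_apply]
    push_cast
    ring
  rw [e, tri_add_right (triAbs_ne_top_of_finite ha hb hu)
    (triAbs_ne_top_of_finite ha hb (finite_support_weighted hu _)), tri_vertSymbol ha hb hu]

/-- The weight is (1 - ∂₂²)². Integrating by parts and expanding by the product rule, the terms in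
which all vertical derivatives fall symmetrically on the last two factors vanish by `tri_self`. -/
theorem tri_weight_two (hd : IsDivFree u) (hu : (Function.support u).Finite) :
    tri u u (weighted (anisoWeight 0 2) u) = 2 * tri (partialDeriv 1 u) u (partialDeriv 1 u) +
      (tri (partialDeriv 1 (partialDeriv 1 u)) u (partialDeriv 1 (partialDeriv 1 u)) +
        2 * tri (partialDeriv 1 u) (partialDeriv 1 u) (partialDeriv 1 (partialDeriv 1 u))) := by
  have hu1 := finite_support_partialDeriv hu 1
  have e : weighted (anisoWeight 0 2) u =
      weighted (anisoWeight 0 1) u + weighted vertSymbol (weighted (anisoWeight 0 1) u) := by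
    funext k j
    simp only [weighted, vertSymbol, anisoWeight, Pi.add_apply]
    push_cast
    ring
  have e1 : partialDeriv 1 (weighted (anisoWeight 0 1) u) =
      weighted (anisoWeight 0 1) (partialDeriv 1 u) := by
    funext k j
    simp only [weighted, partialDeriv]
    ring
  have hw := finite_support_weighted hu (anisoWeight 0 1)
  rw [e, tri_add_right (triAbs_ne_top_of_finite hu hu hw)
    (triAbs_ne_top_of_finite hu hu (finite_support_weighted hw _)), tri_vertSymbol hu hu hw, e1,
    tri_weight_one hu hu hu, tri_weight_one hu1 hu hu1, tri_weight_one hu hu1 hu1, tri_self hd,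
    tri_self hd, tri_self hd]
  ring

end FiniteSupport

/-! ### The trilinear bounds for trigonometric polynomials -/

section BoxBounds

variable {n : ℕ} {u v : VField}

theorem anisoNorm_eq_boxSq (hu : ∀ k ∉ box n, u k = 0) (a b : ℕ) :
    anisoNorm a b u = ENNReal.ofReal √(boxSq n (anisoWeight a b) u) := by
  rw [anisoNorm, anisoSq_eq_boxSq hu, Real.sqrt_eq_rpow,
    ENNReal.ofReal_rpow_of_nonneg (boxSq_nonneg (fun k => (anisoWeight_pos a b k).le) u)
      (by norm_num)]

theorem norm_le_of_enorm_le_mul {z : ℂ} {A : ℝ≥0∞} {x : ℝ} (hx : 0 ≤ x)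
    (h : ‖z‖ₑ ≤ 36 * A) (hA : A = ENNReal.ofReal x) : ‖z‖ ≤ 36 * x := by
  rw [← toReal_enorm]
  refine ENNReal.toReal_le_of_le_ofReal (by positivity) (h.trans_eq ?_)
  rw [hA, ENNReal.ofReal_mul (by norm_num)]
  norm_num

theorem norm_tri_middle_le (hu : ∀ k ∉ box n, u k = 0) (hv : ∀ k ∉ box n, v k = 0)
    (hd : IsDivFree u) :
    ‖tri u v u‖ ≤ 36 * (√(boxSq n (anisoWeight 0 0) u) * √(boxSq n (anisoWeight 1 0) u) *
      √(boxSq n (anisoWeight 1 1) v)) := by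
  refine norm_le_of_enorm_le_mul (by positivity) ((enorm_tri_le _ _ _).trans
    (triAbs_middle_le hd v)) ?_
  rw [anisoNorm_eq_boxSq hu, anisoNorm_eq_boxSq hu, anisoNorm_eq_boxSq hv,
    ENNReal.ofReal_mul (by positivity), ENNReal.ofReal_mul (by positivity)]

theorem norm_tri_partial_left_le (hu : ∀ k ∉ box n, u k = 0) (hv : ∀ k ∉ box n, v k = 0)
    (hd : IsDivFree u) :
    ‖tri (partialDeriv 1 u) v (partialDeriv 1 u)‖ ≤
      36 * (√(boxSq n (anisoWeight 0 1) u) * √(boxSq n (anisoWeight 1 1) u) *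
        √(boxSq n (anisoWeight 1 1) v)) := by
  refine norm_le_of_enorm_le_mul (by positivity) ((enorm_tri_le _ _ _).trans
    (triAbs_partial_left_le hd v)) ?_
  rw [anisoNorm_eq_boxSq hu, anisoNorm_eq_boxSq hu, anisoNorm_eq_boxSq hv,
    ENNReal.ofReal_mul (by positivity), ENNReal.ofReal_mul (by positivity)]

theorem norm_tri_partial_middle_le (hu : ∀ k ∉ box n, u k = 0) (hv : ∀ k ∉ box n, v k = 0) :
    ‖tri u (partialDeriv 1 v) (partialDeriv 1 u)‖ ≤
      36 * (√(boxSq n (anisoWeight 0 1) u) * √(boxSq n (anisoWeight 1 1) u) *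
        (√(boxSq n (anisoWeight 1 1) v) + √(boxSq n (anisoWeight 0 2) v))) := by
  refine norm_le_of_enorm_le_mul (by positivity) ((enorm_tri_le _ _ _).trans
    (triAbs_partial_middle_le u v)) ?_
  rw [anisoNorm_eq_boxSq hu, anisoNorm_eq_boxSq hu, anisoNorm_eq_boxSq hv, anisoNorm_eq_boxSq hv,
    ← ENNReal.ofReal_add (by positivity) (by positivity),
    ENNReal.ofReal_mul (by positivity), ENNReal.ofReal_mul (by positivity)]

theorem norm_tri_second_left_le (hu : ∀ k ∉ box n, u k = 0) (hd : IsDivFree u) :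
    ‖tri (partialDeriv 1 (partialDeriv 1 u)) u (partialDeriv 1 (partialDeriv 1 u))‖ ≤
      36 * (√(boxSq n (anisoWeight 0 2) u) * √(boxSq n (anisoWeight 1 2) u) *
        √(boxSq n (anisoWeight 1 1) u)) := by
  refine norm_le_of_enorm_le_mul (by positivity) ((enorm_tri_le _ _ _).trans
    (triAbs_second_left_le hd)) ?_
  rw [anisoNorm_eq_boxSq hu, anisoNorm_eq_boxSq hu, anisoNorm_eq_boxSq hu,
    ENNReal.ofReal_mul (by positivity), ENNReal.ofReal_mul (by positivity)]

theorem norm_tri_second_middle_le (hu : ∀ k ∉ box n, u k = 0) (hd : IsDivFree u) :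
    ‖tri (partialDeriv 1 u) (partialDeriv 1 u) (partialDeriv 1 (partialDeriv 1 u))‖ ≤
      36 * (√(boxSq n (anisoWeight 0 2) u) * √(boxSq n (anisoWeight 1 2) u) *
        √(boxSq n (anisoWeight 1 1) u)) := by
  refine norm_le_of_enorm_le_mul (by positivity) ((enorm_tri_le _ _ _).trans
    (triAbs_second_middle_le hd)) ?_
  rw [anisoNorm_eq_boxSq hu, anisoNorm_eq_boxSq hu, anisoNorm_eq_boxSq hu,
    ENNReal.ofReal_mul (by positivity), ENNReal.ofReal_mul (by positivity)]

theorem boxSq_anisoWeight_mono {a b a' b' : ℕ} (ha : a ≤ a') (hb : b ≤ b') (u : VField) :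
    boxSq n (anisoWeight a b) u ≤ boxSq n (anisoWeight a' b') u :=
  Finset.sum_le_sum fun k _ => mul_le_mul_of_nonneg_right (anisoWeight_mono ha hb k)
    (Finset.sum_nonneg fun _ _ => by positivity)

theorem boxSq_horizontal (m : ℕ) (u : VField) :
    boxSq n (fun k => (k 0 : ℝ) ^ 2 * anisoWeight 0 m k) u =
      boxSq n (anisoWeight 1 m) u - boxSq n (anisoWeight 0 m) u := by
  rw [eq_sub_iff_add_eq, ← boxSq_add_weight]
  congr 1
  funext k
  simp only [anisoWeight]
  ring

theorem anisoSq_zero_partialDeriv (hu : ∀ k ∉ box n, u k = 0) (i : Fin 2) :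
    anisoSq 0 0 (partialDeriv i u) = ENNReal.ofReal (boxSq n (fun k => (k i : ℝ) ^ 2) u) := by
  have h : ∀ k ∉ box n, partialDeriv i u k = 0 := fun k hk => by
    funext j
    simp [partialDeriv, hu k hk]
  have h1 := anisoSq_eq_boxSq h 0 0
  simp only [Nat.cast_zero] at h1
  rw [h1]
  congr 1
  refine Finset.sum_congr rfl fun k _ => ?_
  simp only [anisoWeight, pow_zero, one_mul, partialDeriv, norm_mul, Complex.norm_I,
    Complex.norm_intCast, mul_pow, sq_abs, Finset.mul_sum]

end BoxBounds

theorem triAbs_partial_advect_le {v : VField} (hv : IsDivFree v) (w : VField) :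
    triAbs (partialDeriv 1 v) w (partialDeriv 1 w) ≤
      36 * (anisoNorm 0 1 w * anisoNorm 1 1 w * anisoNorm 1 1 v) := by
  refine triAbs_le_of_forall (fun j => ?_) (fun j => ?_)
  · refine (convForm_le_FSN (mixedNormFst_partial_one_le v 0) (mixedNormSnd_partial_zero_le w j)
      (ellTwoNorm_partial_one_le w j)).trans_eq (by ring)
  · refine (convForm_le_SFN (mixedNormSnd_partial_one_vertical_le hv)
      (mixedNormFst_partial_one_le w j) (ellTwoNorm_partial_one_le w j)).trans_eq (by ring)

theorem norm_tri_partial_advect_le {n : ℕ} {u v : VField} (hu : ∀ k ∉ box n, u k = 0)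
    (hv : ∀ k ∉ box n, v k = 0) (hd : IsDivFree v) :
    ‖tri (partialDeriv 1 v) u (partialDeriv 1 u)‖ ≤
      36 * (√(boxSq n (anisoWeight 0 1) u) * √(boxSq n (anisoWeight 1 1) u) *
        √(boxSq n (anisoWeight 1 1) v)) := by
  refine norm_le_of_enorm_le_mul (by positivity) ((enorm_tri_le _ _ _).trans
    (triAbs_partial_advect_le hd u)) ?_
  rw [anisoNorm_eq_boxSq hu, anisoNorm_eq_boxSq hu, anisoNorm_eq_boxSq hv,
    ENNReal.ofReal_mul (by positivity), ENNReal.ofReal_mul (by positivity)]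

/-! ### A priori estimates for the Galerkin approximations, uniform in the truncation -/

theorem energy_gronwall {T e₀ : ℝ} {e d h g P : ℝ → ℝ} (he₀ : 0 ≤ e₀)
    (hP : ∀ t ∈ Set.Icc 0 T, IntervalIntegrable P volume 0 t ∧
      e t = e₀ + 2 * ∫ s in (0 : ℝ)..t, P s)
    (hec : ContinuousOn e (Set.Icc 0 T)) (hd : IntervalIntegrable d volume 0 T)
    (hh : IntervalIntegrable h volume 0 T) (hg : IntervalIntegrable g volume 0 T)
    (he0 : ∀ s, 0 ≤ e s) (hd0 : ∀ s, 0 ≤ d s) (hh0 : ∀ s, 0 ≤ h s) (hg0 : ∀ s, 0 ≤ g s)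
    (hle : ∀ s ∈ Set.Icc 0 T, 2 * P s + d s ≤ h s * e s + g s) {N : ℕ}
    (hN : ∫ s in (0 : ℝ)..T, h s ≤ N / 2) {t : ℝ} (ht : t ∈ Set.Icc 0 T) :
    e t + ∫ s in (0 : ℝ)..t, d s ≤ (e₀ + ∫ s in (0 : ℝ)..T, g s) * 2 ^ N := by
  have hT : 0 ≤ T := ht.1.trans ht.2
  have h0 : (0 : ℝ) ∈ Set.Icc 0 T := Set.left_mem_Icc.mpr hT
  have hhe : IntervalIntegrable (fun s => h s * e s) volume 0 T :=
    hh.mul_continuousOn (by rwa [Set.uIcc_of_le hT])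
  have key : ∀ r ∈ Set.Icc 0 T, e r + ∫ s in (0 : ℝ)..r, d s ≤
      (e₀ + ∫ s in (0 : ℝ)..T, g s) + ∫ s in (0 : ℝ)..r, h s * e s := by
    intro r hr
    have iP := (hP r hr).1
    have idr := intervalIntegrable_of_mem_Icc hd h0 hr
    have ih := intervalIntegrable_of_mem_Icc hhe h0 hr
    have ig := intervalIntegrable_of_mem_Icc hg h0 hr
    have h1 := intervalIntegral.integral_mono_on hr.1 ((iP.const_mul 2).add idr) (ih.add ig)
      fun s hs => hle s ⟨hs.1, hs.2.trans hr.2⟩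
    rw [intervalIntegral.integral_add (iP.const_mul 2) idr, intervalIntegral.integral_add ih ig,
      intervalIntegral.integral_const_mul] at h1
    have h2 : ∫ s in (0 : ℝ)..r, g s ≤ ∫ s in (0 : ℝ)..T, g s :=
      intervalIntegral.integral_mono_interval le_rfl hr.1 hr.2
        (Eventually.of_forall fun s => hg0 s) hg
    rw [(hP r hr).2]
    linarith
  have hK : 0 ≤ e₀ + ∫ s in (0 : ℝ)..T, g s :=
    add_nonneg he₀ (intervalIntegral.integral_nonneg hT fun s _ => hg0 s)
  refine (key t ht).trans (gronwall_halving hK hh hh0 he0 hhe (fun r hr => ?_) N hN t ht)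
  have := intervalIntegral.integral_nonneg (μ := volume) hr.1 fun s (_ : s ∈ Set.Icc 0 r) => hd0 s
  linarith [key r hr]

theorem continuousOn_boxSq {n : ℕ} {T : ℝ} (ω : Freq → ℝ) {U : ℝ → VField}
    (hU : ∀ k j, ContinuousOn (fun t => U t k j) (Set.Icc 0 T)) :
    ContinuousOn (fun t => boxSq n ω (U t)) (Set.Icc 0 T) :=
  continuousOn_finsetSum _ fun k _ => continuousOn_const.mul
    (continuousOn_finsetSum _ fun j _ => (hU k j).norm.pow 2)

/-- The right-hand side `∂₁² u - α B(u, u) - B(u, v) - B(v, u)`. -/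
def driftField (α : ℝ) (u v : VField) : VField :=
  partialDeriv 0 (partialDeriv 0 u) - α • bilinB u u - bilinB u v - bilinB v u

/-- Real divergence-free trigonometric polynomials with frequencies in the box. -/
structure IsBoxField (n : ℕ) (u : VField) : Prop where
  supp : ∀ k ∉ box n, u k = 0
  real : IsRealField u
  divFree : IsDivFree u

theorem IsBoxField.finite {n : ℕ} {u : VField} (h : IsBoxField n u) :
    (Function.support u).Finite := finite_support_of_box h.supp

theorem isBoxField_trunc {u : VField} (n : ℕ) (hr : IsRealField u) (hd : IsDivFree u) :
    IsBoxField n (trunc n u) :=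
  ⟨fun _ hk => trunc_apply_of_notMem hk u, isRealField_trunc hr n, isDivFree_trunc hd n⟩

/-- Solutions of the truncated equation, damped by the factor `θ`. -/
structure IsGalerkinSolution (n : ℕ) (T α : ℝ) (θ : ℝ → ℝ) (V f : ℝ → VField) (x₀ : VField)
    (U : ℝ → VField) : Prop where
  isBox : ∀ t, IsBoxField n (U t)
  cont : ∀ k j, ContinuousOn (fun t => U t k j) (Set.Icc 0 T)
  int : ∀ k ∈ box n, ∀ j,
    IntervalIntegrable (fun s => (θ s • driftField α (U s) (V s) + f s) k j) volume 0 T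
  eq : ∀ k ∈ box n, ∀ j, ∀ t ∈ Set.Icc 0 T, U t k j = x₀ k j +
    ∫ s in (0 : ℝ)..t, (θ s • driftField α (U s) (V s) + f s) k j

theorem boxPairing_driftField {n : ℕ} (m : ℕ) (α : ℝ) {u v : VField} (hu : IsBoxField n u)
    (hv : IsBoxField n v) :
    boxPairing n (anisoWeight 0 m) (driftField α u v) u =
      -(boxSq n (anisoWeight 1 m) u - boxSq n (anisoWeight 0 m) u) -
      α * (tri u u (weighted (anisoWeight 0 m) u)).re -
      (tri u v (weighted (anisoWeight 0 m) u)).re -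
      (tri v u (weighted (anisoWeight 0 m) u)).re := by
  have hω : ∀ k, anisoWeight 0 m (-k) = anisoWeight 0 m k := fun k => by simp [anisoWeight]
  have hw := finite_support_weighted hu.finite (anisoWeight 0 m)
  unfold driftField
  rw [boxPairing_sub, boxPairing_sub, boxPairing_sub, boxPairing_smul, boxPairing_laplace,
    boxSq_horizontal,
    boxPairing_bilinB hω (triAbs_ne_top_of_finite hu.finite hu.finite hw) hu.real hu.divFree
      hu.supp,
    boxPairing_bilinB hω (triAbs_ne_top_of_finite hu.finite hv.finite hw) hu.real hu.divFree
      hu.supp,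
    boxPairing_bilinB hω (triAbs_ne_top_of_finite hv.finite hu.finite hw) hu.real hu.divFree
      hu.supp]

namespace IsGalerkinSolution

variable {n : ℕ} {T α : ℝ} {θ : ℝ → ℝ} {V f : ℝ → VField} {x₀ : VField} {U : ℝ → VField}

theorem energy (h : IsGalerkinSolution n T α θ V f x₀ U) (m : ℕ) {t : ℝ}
    (ht : t ∈ Set.Icc 0 T) :
    IntervalIntegrable (fun s => θ s * boxPairing n (anisoWeight 0 m)
        (driftField α (U s) (V s)) (U s) + boxPairing n (anisoWeight 0 m) (f s) (U s)) volume 0 t ∧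
    boxSq n (anisoWeight 0 m) (U t) = boxSq n (anisoWeight 0 m) x₀ +
      2 * ∫ s in (0 : ℝ)..t, (θ s * boxPairing n (anisoWeight 0 m)
        (driftField α (U s) (V s)) (U s) + boxPairing n (anisoWeight 0 m) (f s) (U s)) := by
  simpa only [boxPairing_add, boxPairing_smul] using
    energy_identity n (anisoWeight 0 m) h.int h.eq ht

/-- The L² bound survives an arbitrary damping factor in [0,1], because the undamped drift
contributes at most a nonnegative multiple of the energy. The constant may depend on n: the lemma
only supplies the a priori bound for solving the truncated system. -/
theorem damped_bound (h : IsGalerkinSolution n T α θ V f x₀ U) (hV : ∀ s, IsBoxField n (V s))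
    (hVc : ∀ k j, ContinuousOn (fun t => V t k j) (Set.Icc 0 T))
    (hθ : ∀ s, θ s ∈ Set.Icc (0 : ℝ) 1) {r : ℝ → ℝ} (hr : ∀ s, 0 ≤ r s)
    (hri : IntervalIntegrable r volume 0 T)
    (hf : ∀ s, boxSq n (anisoWeight 0 0) (f s) ≤ r s ^ 2) {N : ℕ}
    (hN : ∫ s in (0 : ℝ)..T, (1 + 1296 * boxSq n (anisoWeight 1 1) (V s) + r s) ≤ N / 2)
    {t : ℝ} (ht : t ∈ Set.Icc 0 T) :
    boxSq n (anisoWeight 0 0) (U t) ≤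
      (boxSq n (anisoWeight 0 0) x₀ + ∫ s in (0 : ℝ)..T, r s) * 2 ^ N := by
  have hT : 0 ≤ T := ht.1.trans ht.2
  have hpos : ∀ (a b : ℕ) (u : VField), 0 ≤ boxSq n (anisoWeight a b) u := fun a b =>
    boxSq_nonneg fun k => (anisoWeight_pos a b k).le
  have h1 := energy_gronwall (hpos 0 0 x₀) (fun t ht => h.energy 0 ht)
    (continuousOn_boxSq (anisoWeight 0 0) h.cont) (d := fun _ => 0) intervalIntegrable_const
    (h := fun s => 1 + 1296 * boxSq n (anisoWeight 1 1) (V s) + r s)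
    (((continuousOn_const.add (continuousOn_const.mul
      (continuousOn_boxSq (anisoWeight 1 1) hVc))).intervalIntegrable_of_Icc hT).add hri)
    hri (fun s => hpos 0 0 _) (fun s => le_rfl)
    (fun s => by have := hpos 1 1 (V s); have := hr s; positivity) hr ?_ hN ht
  · simpa using h1
  · intro s _
    have hb := h.isBox s
    have h2 := two_mul_boxPairing_le (fun k => (anisoWeight_pos 0 0 k).le) (hr s) (hf s) (u := U s)
    have h3 := norm_tri_middle_le hb.supp (hV s).supp hb.divFree
    have h4 := (Complex.abs_re_le_norm _).trans h3
    rw [boxPairing_driftField 0 α hb (hV s), tri_weight_zero, tri_weight_zero, tri_weight_zero,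
      tri_self hb.divFree, tri_self (hV s).divFree]
    simp only [Complex.zero_re, mul_zero, sub_zero]
    have hx := Real.sq_sqrt (hpos 0 0 (U s))
    have hy := Real.sq_sqrt (hpos 1 0 (U s))
    have hz := Real.sq_sqrt (hpos 1 1 (V s))
    have hm := boxSq_anisoWeight_mono (n := n) zero_le_one le_rfl (a := 0) (b := 0) (a' := 1) (U s)
    have h5 := (abs_le.mp h4).1
    set x := √(boxSq n (anisoWeight 0 0) (U s))
    set y := √(boxSq n (anisoWeight 1 0) (U s))
    set z := √(boxSq n (anisoWeight 1 1) (V s))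
    set q := (tri (U s) (V s) (U s)).re
    set p := boxPairing n (anisoWeight 0 0) (f s) (U s)
    rw [← hx, ← hy] at hm ⊢
    rw [← hx] at h2
    rw [← hz]
    -- From 72xyz ≤ y² + 1296x²z² and x² ≤ y², with 1296 = 36².
    have h6 : 2 * (-(y ^ 2 - x ^ 2) - q) ≤ (1 + 1296 * z ^ 2) * x ^ 2 := by
      nlinarith [sq_nonneg (y - 36 * (x * z))]
    have h7 : 0 ≤ (1 + 1296 * z ^ 2) * x ^ 2 := by positivity
    have h8 : θ s * (2 * (-(y ^ 2 - x ^ 2) - q)) ≤ (1 + 1296 * z ^ 2) * x ^ 2 := by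
      calc θ s * (2 * (-(y ^ 2 - x ^ 2) - q)) ≤ θ s * ((1 + 1296 * z ^ 2) * x ^ 2) :=
            mul_le_mul_of_nonneg_left h6 (hθ s).1
        _ ≤ 1 * ((1 + 1296 * z ^ 2) * x ^ 2) := mul_le_mul_of_nonneg_right (hθ s).2 h7
        _ = _ := one_mul _
    nlinarith

end IsGalerkinSolution

theorem boxSq_anisoWeight_nonneg (n a b : ℕ) (u : VField) : 0 ≤ boxSq n (anisoWeight a b) u :=
  boxSq_nonneg (fun k => (anisoWeight_pos a b k).le) u

theorem boxSq_zero (n : ℕ) (ω : Freq → ℝ) : boxSq n ω 0 = 0 := by simp [boxSq]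

theorem boxPairing_zero_left (n : ℕ) (ω : Freq → ℝ) (u : VField) : boxPairing n ω 0 u = 0 := by
  simp [boxPairing]

theorem tri_zero_left (v w : VField) : tri 0 v w = 0 := by
  simp [tri, triTerm, triComp]

theorem tri_zero_middle (u w : VField) : tri u 0 w = 0 := by
  simp [tri, triTerm, triComp, partialDeriv]

theorem isBoxField_zero (n : ℕ) : IsBoxField n 0 :=
  ⟨fun _ _ => rfl, fun k j => by simp, fun k => by simp⟩

/-- Vertical estimate of the nonlinearity for trigonometric polynomials. -/
theorem two_mul_re_tri_partial_le {n : ℕ} {u : VField} (hu : IsBoxField n u) :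
    -2 * (tri (partialDeriv 1 u) u (partialDeriv 1 u)).re ≤
      (boxSq n (anisoWeight 1 1) u - boxSq n (anisoWeight 0 1) u)
        - (boxSq n (anisoWeight 1 0) u - boxSq n (anisoWeight 0 0) u)
      + 410 * boxSq n (anisoWeight 0 1) u *
        (boxSq n (anisoWeight 1 0) u - boxSq n (anisoWeight 0 0) u)
      + 5 * boxSq n (anisoWeight 0 1) u
      + 5 * (boxSq n (anisoWeight 1 0) u - boxSq n (anisoWeight 0 0) u) := by
  set A := boxSq n (fun k => (k 1 : ℝ) ^ 2) u with hA
  set C := boxSq n (fun k => (k 0 : ℝ) ^ 2) u with hC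
  set B := boxSq n (fun k => (k 0 : ℝ) ^ 2 * (k 1 : ℝ) ^ 2) u with hB
  have hA0 : 0 ≤ A := boxSq_nonneg (fun k => by positivity) u
  have hB0 : 0 ≤ B := boxSq_nonneg (fun k => by positivity) u
  have hC0 : 0 ≤ C := boxSq_nonneg (fun k => by positivity) u
  have hpu : ∀ k ∉ box n, partialDeriv 1 u k = 0 := fun k hk => by
    funext j
    simp [partialDeriv, hu.supp k hk]
  have hB' : boxSq n (fun k => (k 0 : ℝ) ^ 2) (partialDeriv 1 u) = B := by
    refine Finset.sum_congr rfl fun k _ => ?_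
    simp only [partialDeriv, norm_mul, Complex.norm_I, Complex.norm_intCast, mul_pow, sq_abs,
      one_mul, ← Finset.mul_sum]
    ring
  have h := two_mul_norm_tri_partial_le hu.divFree
    (triAbs_ne_top_of_finite (finite_support_partialDeriv hu.finite 1) hu.finite
      (finite_support_partialDeriv hu.finite 1)) hA0 hB0 hC0
    (anisoSq_zero_partialDeriv hu.supp 1)
    ((anisoSq_zero_partialDeriv hpu 0).trans (by rw [hB'])) (anisoSq_zero_partialDeriv hu.supp 0)
  have hre := (abs_le.mp (Complex.abs_re_le_norm
    (tri (partialDeriv 1 u) u (partialDeriv 1 u)))).1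
  have e1 : boxSq n (anisoWeight 1 0) u - boxSq n (anisoWeight 0 0) u = C := by
    rw [← boxSq_horizontal, hC]
    congr 1
    funext k
    simp [anisoWeight]
  have e2 : boxSq n (anisoWeight 1 1) u - boxSq n (anisoWeight 0 1) u = C + B := by
    rw [← boxSq_horizontal, hC, hB, ← boxSq_add_weight]
    congr 1
    funext k
    simp only [anisoWeight]
    ring
  have e3 : A ≤ boxSq n (anisoWeight 0 1) u := by
    have : boxSq n (anisoWeight 0 1) u = boxSq n (anisoWeight 0 0) u + A := by
      rw [hA, ← boxSq_add_weight]
      congr 1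
      funext k
      simp [anisoWeight]
    linarith [boxSq_anisoWeight_nonneg n 0 0 u]
  rw [e1, e2]
  have h3 : A * C ≤ boxSq n (anisoWeight 0 1) u * C := mul_le_mul_of_nonneg_right e3 hC0
  nlinarith

namespace IsGalerkinSolution

variable {n : ℕ} {T : ℝ} {V f : ℝ → VField} {x₀ : VField} {U : ℝ → VField}

section Nonlinear

theorem nonlinear_energy (h : IsGalerkinSolution n T 1 (fun _ => 1) (fun _ => 0) (fun _ => 0) x₀ U)
    (m : ℕ) {t : ℝ} (ht : t ∈ Set.Icc 0 T) :
    IntervalIntegrable (fun s => -(boxSq n (anisoWeight 1 m) (U s) -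
      boxSq n (anisoWeight 0 m) (U s)) -
      (tri (U s) (U s) (weighted (anisoWeight 0 m) (U s))).re) volume 0 t ∧
    boxSq n (anisoWeight 0 m) (U t) = boxSq n (anisoWeight 0 m) x₀ +
      2 * ∫ s in (0 : ℝ)..t, (-(boxSq n (anisoWeight 1 m) (U s) -
      boxSq n (anisoWeight 0 m) (U s)) -
      (tri (U s) (U s) (weighted (anisoWeight 0 m) (U s))).re) := by
  have e : ∀ s, boxPairing n (anisoWeight 0 m) (driftField 1 (U s) 0) (U s) =
      -(boxSq n (anisoWeight 1 m) (U s) - boxSq n (anisoWeight 0 m) (U s)) -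
      (tri (U s) (U s) (weighted (anisoWeight 0 m) (U s))).re := fun s => by
    rw [boxPairing_driftField m 1 (h.isBox s) (isBoxField_zero n), tri_zero_left, tri_zero_middle]
    simp
  simpa only [boxPairing_zero_left, add_zero, one_mul, e] using h.energy m ht

theorem nonlinear_energy_zero
    (h : IsGalerkinSolution n T 1 (fun _ => 1) (fun _ => 0) (fun _ => 0) x₀ U)
    {t : ℝ} (ht : t ∈ Set.Icc 0 T) :
    boxSq n (anisoWeight 0 0) (U t) + ∫ s in (0 : ℝ)..t, 2 * (boxSq n (anisoWeight 1 0) (U s) -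
      boxSq n (anisoWeight 0 0) (U s)) ≤ boxSq n (anisoWeight 0 0) x₀ := by
  have hT : 0 ≤ T := ht.1.trans ht.2
  have hc := fun ω => continuousOn_boxSq (n := n) ω h.cont
  have h1 := energy_gronwall (boxSq_anisoWeight_nonneg n 0 0 x₀)
    (fun t ht => h.nonlinear_energy 0 ht) (hc (anisoWeight 0 0))
    (d := fun s => 2 * (boxSq n (anisoWeight 1 0) (U s) - boxSq n (anisoWeight 0 0) (U s)))
    (h := fun _ => 0) (g := fun _ => 0)
    ((continuousOn_const.mul ((hc _).sub (hc _))).intervalIntegrable_of_Icc hT)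
    intervalIntegrable_const intervalIntegrable_const
    (fun s => boxSq_anisoWeight_nonneg n 0 0 _)
    (fun s => by
      have := boxSq_anisoWeight_mono (n := n) zero_le_one le_rfl (a := 0) (b := 0) (a' := 1) (U s)
      linarith)
    (fun _ => le_rfl) (fun _ => le_rfl) (fun s _ => ?_) (N := 0) (by simp) ht
  · simpa using h1
  · rw [tri_weight_zero, tri_self (h.isBox s).divFree]
    simp only [Complex.zero_re]
    linarith

/-- The Gronwall factor is a multiple of ‖∂₁u‖² plus a constant, and the L² energy law bounds its
integral by the initial data alone. So the estimate is global in time for data of any size. -/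
theorem nonlinear_energy_one
    (h : IsGalerkinSolution n T 1 (fun _ => 1) (fun _ => 0) (fun _ => 0) x₀ U) {E : ℝ}
    (hE : boxSq n (anisoWeight 0 1) x₀ ≤ E) {N : ℕ} (hN : 205 * E + 6 * T ≤ N / 2)
    {t : ℝ} (ht : t ∈ Set.Icc 0 T) :
    boxSq n (anisoWeight 0 1) (U t) + ∫ s in (0 : ℝ)..t, boxSq n (anisoWeight 1 1) (U s) ≤
      3 * E * 2 ^ N := by
  have hT : 0 ≤ T := ht.1.trans ht.2
  have hTm : T ∈ Set.Icc 0 T := Set.right_mem_Icc.mpr hT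
  have hc := fun ω => continuousOn_boxSq (n := n) ω h.cont
  set c : ℝ → ℝ := fun s => boxSq n (anisoWeight 1 0) (U s) - boxSq n (anisoWeight 0 0) (U s)
    with hcdef
  have hci : IntervalIntegrable c volume 0 T :=
    ((hc (anisoWeight 1 0)).sub (hc (anisoWeight 0 0))).intervalIntegrable_of_Icc hT
  have hc0 : ∀ s, 0 ≤ c s := fun s => by
    have := boxSq_anisoWeight_mono (n := n) zero_le_one le_rfl (a := 0) (b := 0) (a' := 1) (U s)
    simp only [hcdef]
    linarith
  have hE0 := (boxSq_anisoWeight_mono (n := n) le_rfl zero_le_one (a := 0) (b := 0) (b' := 1)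
    x₀).trans hE
  have hcI : ∫ s in (0 : ℝ)..T, c s ≤ E / 2 := by
    have h1 := h.nonlinear_energy_zero hTm
    rw [intervalIntegral.integral_const_mul] at h1
    have h2 := boxSq_anisoWeight_nonneg n 0 0 (U T)
    change _ + 2 * ∫ s in (0 : ℝ)..T, c s ≤ _ at h1
    linarith
  have h1 := energy_gronwall (boxSq_anisoWeight_nonneg n 0 1 x₀)
    (fun t ht => h.nonlinear_energy 1 ht) (hc (anisoWeight 0 1))
    (d := fun s => boxSq n (anisoWeight 1 1) (U s))
    -- Of the dissipation, one copy of the H^{1,1} norm is kept on the left and the rest absorbs the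
    -- mixed derivative. Since c integrates to at most E/2, the forcing adds 2E to the initial E,
    -- and h integrates to at most 205E + 6T.
    (h := fun s => 410 * c s + 6) (g := fun s => 4 * c s)
    ((hc _).intervalIntegrable_of_Icc hT)
    ((hci.const_mul 410).add intervalIntegrable_const) (hci.const_mul 4)
    (fun s => boxSq_anisoWeight_nonneg n 0 1 _) (fun s => boxSq_anisoWeight_nonneg n 1 1 _)
    (fun s => by have := hc0 s; positivity) (fun s => by have := hc0 s; positivity)
    (fun s _ => ?_) (N := N) ?_ ht
  · refine h1.trans (mul_le_mul_of_nonneg_right ?_ (by positivity))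
    rw [intervalIntegral.integral_const_mul]
    linarith
  · have hb := h.isBox s
    have h2 := two_mul_re_tri_partial_le hb
    rw [tri_weight_one hb.finite hb.finite hb.finite, tri_self hb.divFree, tri_self hb.divFree]
    simp only [zero_add, add_zero, hcdef]
    nlinarith
  · rw [intervalIntegral.integral_add (hci.const_mul 410) intervalIntegrable_const,
      intervalIntegral.integral_const_mul, intervalIntegral.integral_const]
    simp only [sub_zero, smul_eq_mul]
    linarith

theorem nonlinear_energy_two
    (h : IsGalerkinSolution n T 1 (fun _ => 1) (fun _ => 0) (fun _ => 0) x₀ U) {N : ℕ}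
    (hN : 2 * T + 32400 * ∫ s in (0 : ℝ)..T, boxSq n (anisoWeight 1 1) (U s) ≤ N / 2)
    {t : ℝ} (ht : t ∈ Set.Icc 0 T) :
    boxSq n (anisoWeight 0 2) (U t) ≤ boxSq n (anisoWeight 0 2) x₀ * 2 ^ N := by
  have hT : 0 ≤ T := ht.1.trans ht.2
  have hc := fun ω => continuousOn_boxSq (n := n) ω h.cont
  have hi : IntervalIntegrable (fun s => boxSq n (anisoWeight 1 1) (U s)) volume 0 T :=
    (hc (anisoWeight 1 1)).intervalIntegrable_of_Icc hT
  have h1 := energy_gronwall (boxSq_anisoWeight_nonneg n 0 2 x₀)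
    (fun t ht => h.nonlinear_energy 2 ht) (hc (anisoWeight 0 2))
    (d := fun s => boxSq n (anisoWeight 1 2) (U s))
    (h := fun s => 2 + 32400 * boxSq n (anisoWeight 1 1) (U s)) (g := fun _ => 0)
    ((hc _).intervalIntegrable_of_Icc hT)
    (intervalIntegrable_const.add (hi.const_mul 32400)) intervalIntegrable_const
    (fun s => boxSq_anisoWeight_nonneg n 0 2 _) (fun s => boxSq_anisoWeight_nonneg n 1 2 _)
    (fun s => by have := boxSq_anisoWeight_nonneg n 1 1 (U s); positivity) (fun _ => le_rfl)
    (fun s _ => ?_) (N := N) ?_ ht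
  · have h2 := intervalIntegral.integral_nonneg (μ := volume) ht.1
      fun s (_ : s ∈ Set.Icc 0 t) => boxSq_anisoWeight_nonneg n 1 2 (U s)
    simp only [intervalIntegral.integral_zero, add_zero] at h1
    linarith
  · have hb := h.isBox s
    have h2 := (Complex.abs_re_le_norm _).trans (norm_tri_partial_left_le hb.supp hb.supp hb.divFree)
    have h3 := (Complex.abs_re_le_norm _).trans (norm_tri_second_left_le hb.supp hb.divFree)
    have h4 := (Complex.abs_re_le_norm _).trans (norm_tri_second_middle_le hb.supp hb.divFree)
    have m1 := Real.sqrt_le_sqrt (boxSq_anisoWeight_mono (n := n) le_rfl one_le_two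
      (a := 0) (b := 1) (b' := 2) (U s))
    have m2 := Real.sqrt_le_sqrt (boxSq_anisoWeight_mono (n := n) le_rfl one_le_two
      (a := 1) (b := 1) (b' := 2) (U s))
    rw [tri_weight_two hb.divFree hb.finite]
    have hx := Real.sq_sqrt (boxSq_anisoWeight_nonneg n 0 2 (U s))
    have hy := Real.sq_sqrt (boxSq_anisoWeight_nonneg n 1 2 (U s))
    have hz := Real.sq_sqrt (boxSq_anisoWeight_nonneg n 1 1 (U s))
    have hx0 := Real.sqrt_nonneg (boxSq n (anisoWeight 0 2) (U s))
    have hy0 := Real.sqrt_nonneg (boxSq n (anisoWeight 1 2) (U s))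
    have hz0 := Real.sqrt_nonneg (boxSq n (anisoWeight 1 1) (U s))
    have hw0 := Real.sqrt_nonneg (boxSq n (anisoWeight 0 1) (U s))
    have e2 : ∀ z : ℂ, ((2 : ℂ) * z).re = 2 * z.re := fun z => by simp
    simp only [Complex.add_re, e2]
    rw [← hx, ← hy, ← hz]
    set x := √(boxSq n (anisoWeight 0 2) (U s))
    set y := √(boxSq n (anisoWeight 1 2) (U s))
    set z := √(boxSq n (anisoWeight 1 1) (U s))
    set w := √(boxSq n (anisoWeight 0 1) (U s))
    have h5 : w * z * z ≤ x * y * z :=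
      mul_le_mul_of_nonneg_right (mul_le_mul m1 m2 hz0 hx0) hz0
    have a2 := (abs_le.mp h2).1
    have a3 := (abs_le.mp h3).1
    have a4 := (abs_le.mp h4).1
    -- The three terms have multiplicities 2, 1 and 2, in total 2·36·5 = 360 copies of xyz, and
    -- 360xyz ≤ y² + 180²x²z².
    nlinarith [sq_nonneg (y - 180 * (x * z))]
  · rw [intervalIntegral.integral_add intervalIntegrable_const (hi.const_mul 32400),
      intervalIntegral.integral_const_mul, intervalIntegral.integral_const]
    simp only [sub_zero, smul_eq_mul]
    linarith

end Nonlinear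

/-- In the H^{0,1} estimate of the linear equation both the H^{1,1} and the H^{0,2} norm of the
given field V enter the Gronwall factor; the former is square integrable in time, the latter
bounded. -/
theorem linear_energy (h : IsGalerkinSolution n T 0 (fun _ => 1) V f 0 U)
    (hV : ∀ s, IsBoxField n (V s))
    (hVc : ∀ k j, ContinuousOn (fun t => V t k j) (Set.Icc 0 T))
    {r : ℝ → ℝ} (hr : ∀ s, 0 ≤ r s) (hri : IntervalIntegrable r volume 0 T)
    (hf : ∀ s, boxSq n (anisoWeight 0 1) (f s) ≤ r s ^ 2) {N : ℕ}
    (hN : ∫ s in (0 : ℝ)..T, (2 + 41472 * (boxSq n (anisoWeight 1 1) (V s) +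
      boxSq n (anisoWeight 0 2) (V s)) + r s) ≤ N / 2)
    {t : ℝ} (ht : t ∈ Set.Icc 0 T) :
    boxSq n (anisoWeight 0 1) (U t) + ∫ s in (0 : ℝ)..t, boxSq n (anisoWeight 1 1) (U s) ≤
      (∫ s in (0 : ℝ)..T, r s) * 2 ^ N := by
  have hT : 0 ≤ T := ht.1.trans ht.2
  have hc := fun ω => continuousOn_boxSq (n := n) ω h.cont
  have hVb := fun ω => continuousOn_boxSq (n := n) ω hVc
  have h1 := energy_gronwall (boxSq_anisoWeight_nonneg n 0 1 0)
    (fun t ht => h.energy 1 ht) (hc (anisoWeight 0 1))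
    (d := fun s => boxSq n (anisoWeight 1 1) (U s))
    (h := fun s => 2 + 41472 * (boxSq n (anisoWeight 1 1) (V s) +
      boxSq n (anisoWeight 0 2) (V s)) + r s) (g := r)
    ((hc _).intervalIntegrable_of_Icc hT)
    (((continuousOn_const.add (continuousOn_const.mul
      ((hVb _).add (hVb _)))).intervalIntegrable_of_Icc hT).add hri) hri
    (fun s => boxSq_anisoWeight_nonneg n 0 1 _) (fun s => boxSq_anisoWeight_nonneg n 1 1 _)
    (fun s => by
      have := boxSq_anisoWeight_nonneg n 1 1 (V s)
      have := boxSq_anisoWeight_nonneg n 0 2 (V s)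
      have := hr s
      positivity) hr
    (fun s _ => ?_) hN ht
  · rwa [boxSq_zero, zero_add] at h1
  · have hb := h.isBox s
    have hv := hV s
    have h2 := two_mul_boxPairing_le (fun k => (anisoWeight_pos 0 1 k).le) (hr s) (hf s) (u := U s)
    have h3 := (Complex.abs_re_le_norm _).trans (norm_tri_middle_le hb.supp hv.supp hb.divFree)
    have h4 := (Complex.abs_re_le_norm _).trans
      (norm_tri_partial_left_le hb.supp hv.supp hb.divFree)
    have h5 := (Complex.abs_re_le_norm _).trans (norm_tri_partial_middle_le hb.supp hv.supp)
    have h6 := (Complex.abs_re_le_norm _).trans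
      (norm_tri_partial_advect_le hb.supp hv.supp hv.divFree)
    have m1 := Real.sqrt_le_sqrt (boxSq_anisoWeight_mono (n := n) le_rfl zero_le_one
      (a := 0) (b := 0) (b' := 1) (U s))
    have m2 := Real.sqrt_le_sqrt (boxSq_anisoWeight_mono (n := n) le_rfl zero_le_one
      (a := 1) (b := 0) (b' := 1) (U s))
    rw [one_mul, boxPairing_driftField 1 0 hb hv, tri_weight_one hb.finite hv.finite hb.finite,
      tri_weight_one hv.finite hb.finite hb.finite, tri_self hv.divFree, tri_self hv.divFree]
    have hx := Real.sq_sqrt (boxSq_anisoWeight_nonneg n 0 1 (U s))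
    have hy := Real.sq_sqrt (boxSq_anisoWeight_nonneg n 1 1 (U s))
    have hz := Real.sq_sqrt (boxSq_anisoWeight_nonneg n 1 1 (V s))
    have hw := Real.sq_sqrt (boxSq_anisoWeight_nonneg n 0 2 (V s))
    have hx0 := Real.sqrt_nonneg (boxSq n (anisoWeight 0 1) (U s))
    have hy0 := Real.sqrt_nonneg (boxSq n (anisoWeight 1 0) (U s))
    have hz0 := Real.sqrt_nonneg (boxSq n (anisoWeight 1 1) (V s))
    simp only [Complex.add_re, zero_mul, sub_zero, zero_add, add_zero]
    rw [← hx] at h2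
    rw [← hx, ← hy, ← hz, ← hw]
    set x := √(boxSq n (anisoWeight 0 1) (U s))
    set y := √(boxSq n (anisoWeight 1 1) (U s))
    set z := √(boxSq n (anisoWeight 1 1) (V s))
    set w := √(boxSq n (anisoWeight 0 2) (V s))
    have h7 : √(boxSq n (anisoWeight 0 0) (U s)) * √(boxSq n (anisoWeight 1 0) (U s)) * z ≤
        x * y * z := mul_le_mul_of_nonneg_right (mul_le_mul m1 m2 hy0 hx0) hz0
    have a3 := (abs_le.mp h3).1
    have a4 := (abs_le.mp h4).1
    have a5 := (abs_le.mp h5).1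
    have a6 := (abs_le.mp h6).1
    -- Four trilinear terms survive; each contributes xyz, and the one with ∂₂²V also xyw. Then
    -- (4z+w)² ≤ 32(z²+w²), and 1296·32 = 41472.
    have h8 : 2 * (36 * (x * y * (4 * z + w))) ≤
        y ^ 2 + 1296 * (x ^ 2 * (4 * z + w) ^ 2) := by
      nlinarith [sq_nonneg (y - 36 * (x * (4 * z + w)))]
    have h9 : x ^ 2 * (4 * z + w) ^ 2 ≤ x ^ 2 * (32 * (z ^ 2 + w ^ 2)) := by
      refine mul_le_mul_of_nonneg_left ?_ (sq_nonneg x)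
      nlinarith [sq_nonneg (4 * z - w)]
    nlinarith

end IsGalerkinSolution

/-! ### The finite-dimensional Galerkin space and existence of approximations -/

/-- Extension by zero of a family of coefficients indexed by a box. -/
def extendBox (n : ℕ) : (box n → Fin 2 → ℂ) →ₗ[ℝ] VField where
  toFun x k j := if h : k ∈ box n then x ⟨k, h⟩ j else 0
  map_add' x y := by
    funext k j
    by_cases h : k ∈ box n <;> simp [h]
  map_smul' c x := by
    funext k j
    by_cases h : k ∈ box n <;> simp [h]

theorem extendBox_restrict (n : ℕ) (u : VField) :
    extendBox n (fun k => u k) = trunc n u := by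
  funext k j
  simp [extendBox, trunc]

/-- The space of real divergence-free trigonometric polynomials with frequencies in a box. -/
def galerkinSpace (n : ℕ) : Submodule ℝ (box n → Fin 2 → ℂ) where
  carrier := {x | IsRealField (extendBox n x) ∧ IsDivFree (extendBox n x)}
  add_mem' {x y} hx hy := by
    refine ⟨fun k j => ?_, fun k => ?_⟩
    · simp [map_add, hx.1 k j, hy.1 k j]
    · have h1 := hx.2 k
      have h2 := hy.2 k
      simp only [map_add, Pi.add_apply, Fin.sum_univ_two] at h1 h2 ⊢
      linear_combination h1 + h2
  zero_mem' := by
    refine ⟨fun k j => ?_, fun k => ?_⟩ <;> simp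
  smul_mem' c x hx := by
    refine ⟨fun k j => ?_, fun k => ?_⟩
    · simp [map_smul, hx.1 k j]
    · have h1 := hx.2 k
      simp only [map_smul, Pi.smul_apply, Complex.real_smul, Fin.sum_univ_two] at h1 ⊢
      linear_combination (c : ℂ) * h1

/-- The field with the given coefficients. -/
def toField (n : ℕ) : galerkinSpace n →ₗ[ℝ] VField := extendBox n ∘ₗ (galerkinSpace n).subtype

/-- The truncation of a real divergence-free field. -/
def ofField (n : ℕ) (u : VField) (hr : IsRealField u) (hd : IsDivFree u) : galerkinSpace n :=
  ⟨fun k => u k, by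
    refine ⟨?_, ?_⟩
    · rw [extendBox_restrict]
      exact isRealField_trunc hr n
    · rw [extendBox_restrict]
      exact isDivFree_trunc hd n⟩

theorem toField_ofField (n : ℕ) (u : VField) (hr : IsRealField u) (hd : IsDivFree u) :
    toField n (ofField n u hr hd) = trunc n u := extendBox_restrict n u

theorem isBoxField_toField (n : ℕ) (x : galerkinSpace n) : IsBoxField n (toField n x) :=
  ⟨fun k hk => by funext j; simp [toField, extendBox, hk], x.2.1, x.2.2⟩

theorem norm_le_of_boxSq {n : ℕ} {x : galerkinSpace n} {C : ℝ}
    (h : boxSq n (anisoWeight 0 0) (toField n x) ≤ C) : ‖x‖ ≤ 1 + C := by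
  have hC : 0 ≤ C := (boxSq_anisoWeight_nonneg n 0 0 _).trans h
  change ‖(x : box n → Fin 2 → ℂ)‖ ≤ 1 + C
  rw [pi_norm_le_iff_of_nonneg (by positivity)]
  intro k
  rw [pi_norm_le_iff_of_nonneg (by positivity)]
  intro j
  have h1 : ‖(x : box n → Fin 2 → ℂ) k j‖ ^ 2 ≤ boxSq n (anisoWeight 0 0) (toField n x) := by
    unfold boxSq
    have e : (x : box n → Fin 2 → ℂ) k j = toField n x k j := by simp [toField, extendBox]
    rw [e]
    refine le_trans ?_ (Finset.single_le_sum (f := fun k => anisoWeight 0 0 k *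
      ∑ j, ‖toField n x k j‖ ^ 2) (fun k _ => mul_nonneg (anisoWeight_pos 0 0 k).le
        (Finset.sum_nonneg fun _ _ => by positivity)) k.2)
    simp only [anisoWeight, pow_zero, one_mul]
    exact Finset.single_le_sum (f := fun j => ‖toField n x k j‖ ^ 2)
      (fun _ _ => by positivity) (Finset.mem_univ j)
  nlinarith [norm_nonneg ((x : box n → Fin 2 → ℂ) k j), sq_nonneg (‖(x : box n → Fin 2 → ℂ) k j‖ - 1)]

/-- The coefficient functionals. -/
def coeffCLM (n : ℕ) (k : Freq) (j : Fin 2) : galerkinSpace n →L[ℝ] ℂ :=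
  LinearMap.toContinuousLinearMap
    ((LinearMap.proj (R := ℝ) (φ := fun _ : Fin 2 => ℂ) j ∘ₗ
      LinearMap.proj (R := ℝ) (φ := fun _ : Freq => Fin 2 → ℂ) k) ∘ₗ toField n)

theorem coeffCLM_apply (n : ℕ) (k : Freq) (j : Fin 2) (x : galerkinSpace n) :
    coeffCLM n k j x = toField n x k j := rfl

theorem partialDeriv_add (i : Fin 2) (u v : VField) :
    partialDeriv i (u + v) = partialDeriv i u + partialDeriv i v := by
  funext k j
  simp [partialDeriv, mul_add]

theorem partialDeriv_smul (i : Fin 2) (c : ℝ) (u : VField) :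
    partialDeriv i (c • u) = c • partialDeriv i u := by
  funext k j
  simp only [partialDeriv, Pi.smul_apply, Complex.real_smul]
  ring

/-- The horizontal Laplacian on the Galerkin space. -/
def galerkinLaplace (n : ℕ) : galerkinSpace n →L[ℝ] galerkinSpace n :=
  LinearMap.toContinuousLinearMap
    { toFun := fun x => ofField n (partialDeriv 0 (partialDeriv 0 (toField n x)))
        (isRealField_partialDeriv (isRealField_partialDeriv (isBoxField_toField n x).real 0) 0)
        (isDivFree_partialDeriv (isDivFree_partialDeriv (isBoxField_toField n x).divFree 0) 0)
      map_add' := fun x y => Subtype.ext (funext fun k => by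
        simp only [ofField, map_add, partialDeriv_add, Submodule.coe_add, Pi.add_apply])
      map_smul' := fun c x => Subtype.ext (funext fun k => by
        simp only [ofField, map_smul, partialDeriv_smul, RingHom.id_apply, Submodule.coe_smul,
          Pi.smul_apply]) }

theorem bilinB_add_left {u u' v : VField} (hv : (Function.support v).Finite) :
    bilinB (u + u') v = bilinB u v + bilinB u' v := by
  rw [bilinB, advection_add_left (summable_advection_of_finite hv)
    (summable_advection_of_finite hv), leray_add]
  rfl

theorem bilinB_add_right {u v v' : VField} (hv : (Function.support v).Finite)
    (hv' : (Function.support v').Finite) :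
    bilinB u (v + v') = bilinB u v + bilinB u v' := by
  rw [bilinB, advection_add_right (summable_advection_of_finite hv)
    (summable_advection_of_finite hv'), leray_add]
  rfl

theorem bilinB_smul_left (c : ℝ) (u v : VField) : bilinB (c • u) v = c • bilinB u v := by
  rw [bilinB, advection_smul_left, leray_smul]
  rfl

theorem bilinB_smul_right (c : ℝ) (u v : VField) : bilinB u (c • v) = c • bilinB u v := by
  rw [bilinB, advection_smul_right, leray_smul]
  rfl

/-- The truncated bilinear term on the Galerkin space. -/
def galerkinBilin (n : ℕ) : galerkinSpace n →L[ℝ] galerkinSpace n →L[ℝ] galerkinSpace n :=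
  LinearMap.toContinuousBilinearMap (LinearMap.mk₂ ℝ
    (fun x y => ofField n (bilinB (toField n x) (toField n y))
      (isRealField_bilinB (isBoxField_toField n x).real (isBoxField_toField n y).real)
      (isDivFree_bilinB _ _))
    (fun x x' y => Subtype.ext (funext fun k => by
      simp only [ofField, map_add, bilinB_add_left (isBoxField_toField n y).finite,
        Submodule.coe_add, Pi.add_apply]))
    (fun c x y => Subtype.ext (funext fun k => by
      simp only [ofField, map_smul, bilinB_smul_left, Submodule.coe_smul, Pi.smul_apply]))
    (fun x y y' => Subtype.ext (funext fun k => by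
      simp only [ofField, map_add, bilinB_add_right (isBoxField_toField n y).finite
        (isBoxField_toField n y').finite, Submodule.coe_add, Pi.add_apply]))
    (fun c x y => Subtype.ext (funext fun k => by
      simp only [ofField, map_smul, bilinB_smul_right, Submodule.coe_smul, Pi.smul_apply])))

theorem toField_galerkinLaplace {n : ℕ} (x : galerkinSpace n) {k : Freq} (hk : k ∈ box n)
    (j : Fin 2) : toField n (galerkinLaplace n x) k j =
      partialDeriv 0 (partialDeriv 0 (toField n x)) k j :=
  (congrFun (congrFun (toField_ofField n (partialDeriv 0 (partialDeriv 0 (toField n x)))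
    (isRealField_partialDeriv (isRealField_partialDeriv (isBoxField_toField n x).real 0) 0)
    (isDivFree_partialDeriv (isDivFree_partialDeriv (isBoxField_toField n x).divFree 0) 0)) k)
    j).trans (by rw [trunc_apply_of_mem hk])

theorem toField_galerkinBilin {n : ℕ} (x y : galerkinSpace n) {k : Freq} (hk : k ∈ box n)
    (j : Fin 2) : toField n (galerkinBilin n x y) k j =
      bilinB (toField n x) (toField n y) k j :=
  (congrFun (congrFun (toField_ofField n (bilinB (toField n x) (toField n y))
    (isRealField_bilinB (isBoxField_toField n x).real (isBoxField_toField n y).real)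
    (isDivFree_bilinB _ _)) k) j).trans (by rw [trunc_apply_of_mem hk])

theorem continuousOn_ofField {n : ℕ} {S : Set ℝ} {v : ℝ → VField} (hr : ∀ s, IsRealField (v s))
    (hd : ∀ s, IsDivFree (v s)) (hc : ∀ k j, ContinuousOn (fun s => v s k j) S) :
    ContinuousOn (fun s => ofField n (v s) (hr s) (hd s)) S :=
  (Topology.IsInducing.subtypeVal.continuousOn_iff).mpr
    (continuousOn_pi.mpr fun k => continuousOn_pi.mpr fun j => hc k j)

theorem intervalIntegrable_ofField {n : ℕ} {T : ℝ} {f : ℝ → VField} (hr : ∀ s, IsRealField (f s))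
    (hd : ∀ s, IsDivFree (f s))
    (hf : ∀ k ∈ box n, ∀ j, IntervalIntegrable (fun s => f s k j) volume 0 T) :
    IntervalIntegrable (fun s => ofField n (f s) (hr s) (hd s)) volume 0 T := by
  -- A linear left inverse of the inclusion carries integrability from the ambient coefficient space
  -- to the subspace.
  obtain ⟨P, hP⟩ := (galerkinSpace n).subtype.exists_leftInverse_of_injective
    (galerkinSpace n).ker_subtype
  have h : ∀ s, ofField n (f s) (hr s) (hd s) =
      LinearMap.toContinuousLinearMap P fun k : box n => f s k := fun s =>
    (LinearMap.congr_fun hP (ofField n (f s) (hr s) (hd s))).symm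
  simp_rw [h]
  exact ⟨ContinuousLinearMap.integrable_comp _
      (Integrable.of_eval fun k => Integrable.of_eval fun j => (hf k k.2 j).1),
    ContinuousLinearMap.integrable_comp _
      (Integrable.of_eval fun k => Integrable.of_eval fun j => (hf k k.2 j).2)⟩

/-- One statement serves both equations: α = 1 with v = 0 and f = 0 is the nonlinear one, α = 0 with
v = u⁰ the skeleton equation. -/
theorem exists_isGalerkinSolution (n : ℕ) {T : ℝ} (hT : 0 ≤ T) (α : ℝ) {v f : ℝ → VField}
    {x₀ : VField} (hx₀ : IsRealField x₀) (hx₀' : IsDivFree x₀)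
    (hv : ∀ s, IsRealField (v s)) (hv' : ∀ s, IsDivFree (v s))
    (hvc : ∀ k j, ContinuousOn (fun s => v s k j) (Set.Icc 0 T))
    (hf : ∀ s, IsRealField (f s)) (hf' : ∀ s, IsDivFree (f s))
    (hfi : ∀ k ∈ box n, ∀ j, IntervalIntegrable (fun s => f s k j) volume 0 T)
    {r : ℝ → ℝ} (hr : ∀ s, 0 ≤ r s) (hri : IntervalIntegrable r volume 0 T)
    (hfr : ∀ s, boxSq n (anisoWeight 0 0) (f s) ≤ r s ^ 2) :
    ∃ U, IsGalerkinSolution n T α (fun _ => 1) (fun s => trunc n (v s)) f x₀ U := by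
  set g : ℝ → galerkinSpace n := fun s => ofField n (v s) (hv s) (hv' s) with hg
  have hgc : ContinuousOn g (Set.Icc 0 T) := continuousOn_ofField hv hv' hvc
  set F : ℝ → galerkinSpace n := fun s => ofField n (f s) (hf s) (hf' s) with hF
  have hFi : IntervalIntegrable F volume 0 T := intervalIntegrable_ofField hf hf' hfi
  set M : ℝ → galerkinSpace n →L[ℝ] galerkinSpace n := fun s =>
    galerkinLaplace n - (galerkinBilin n).flip (g s) - galerkinBilin n (g s) with hM
  have hMc : ContinuousOn M (Set.Icc 0 T) :=
    (continuousOn_const.sub ((galerkinBilin n).flip.continuous.comp_continuousOn hgc)).sub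
      ((galerkinBilin n).continuous.comp_continuousOn hgc)
  set Q := (-α) • galerkinBilin n with hQ
  have hgf : ∀ s, toField n (g s) = trunc n (v s) := fun s => toField_ofField n _ _ _
  have hdrift : ∀ (s : ℝ) (x : galerkinSpace n), ∀ k ∈ box n, ∀ j,
      toField n (M s x + Q x x) k j = driftField α (toField n x) (trunc n (v s)) k j := by
    intro s x k hk j
    simp only [hM, hQ, driftField, sub_apply, smul_apply,
      ContinuousLinearMap.flip_apply, map_add, map_sub, map_smul, Pi.add_apply, Pi.sub_apply,
      Pi.smul_apply, Pi.neg_apply, toField_galerkinLaplace x hk, toField_galerkinBilin _ _ hk, hgf, neg_smul]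
    ring
  have hsol : ∀ (θ : ℝ → ℝ) (X : ℝ → galerkinSpace n), ContinuousOn θ (Set.Icc 0 T) →
      ContinuousOn X (Set.Icc 0 T) →
      (∀ t ∈ Set.Icc 0 T, X t = ofField n x₀ hx₀ hx₀' + ∫ s in (0 : ℝ)..t,
          (θ s • (M s (X s) + Q (X s) (X s)) + F s)) →
      IsGalerkinSolution n T α θ (fun s => trunc n (v s)) f x₀ fun t => toField n (X t) := by
    intro θ X hθ hX hXeq
    have hI : IntervalIntegrable (fun s => θ s • (M s (X s) + Q (X s) (X s)) + F s)
        volume 0 T := by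
      refine (ContinuousOn.intervalIntegrable_of_Icc hT ?_).add hFi
      exact hθ.smul ((hMc.clm_apply hX).add
        ((Q.continuous.comp_continuousOn hX).clm_apply hX))
    have hco : ∀ k ∈ box n, ∀ j, ∀ s, coeffCLM n k j (θ s • (M s (X s) + Q (X s) (X s)) + F s) =
        (θ s • driftField α (toField n (X s)) (trunc n (v s)) + f s) k j := by
      intro k hk j s
      rw [coeffCLM_apply, map_add, map_smul, Pi.add_apply, Pi.add_apply, Pi.smul_apply,
        Pi.smul_apply, hdrift s (X s) k hk j, hF, toField_ofField, trunc_apply_of_mem hk]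
      rfl
    refine ⟨fun t => isBoxField_toField n _, fun k j => ?_, fun k hk j => ?_,
      fun k hk j t ht => ?_⟩
    · exact (coeffCLM n k j).continuous.comp_continuousOn hX
    · simp_rw [← hco k hk j]
      exact ⟨(coeffCLM n k j).integrable_comp hI.1, (coeffCLM n k j).integrable_comp hI.2⟩
    · have hIt := intervalIntegrable_of_mem_Icc hI (Set.left_mem_Icc.mpr hT) ht
      rw [← coeffCLM_apply, hXeq t ht, map_add,
        ← ContinuousLinearMap.intervalIntegral_comp_comm _ hIt]
      simp_rw [hco k hk j]
      rw [coeffCLM_apply, toField_ofField, trunc_apply_of_mem hk]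
  obtain ⟨N, hN⟩ := exists_nat_ge (2 * ∫ s in (0 : ℝ)..T,
    (1 + 1296 * boxSq n (anisoWeight 1 1) (trunc n (v s)) + r s))
  obtain ⟨X, hXc, hX⟩ := exists_solution_of_bound hT (ofField n x₀ hx₀ hx₀') M hMc Q F hFi
    (1 + (boxSq n (anisoWeight 0 0) x₀ + ∫ s in (0 : ℝ)..T, r s) * 2 ^ N)
    (fun θ hθ hθc X hXc hX t ht => norm_le_of_boxSq
      ((hsol θ X hθc hXc hX).damped_bound (fun s => isBoxField_trunc n (hv s) (hv' s))
        (fun k j => by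
          by_cases hk : k ∈ box n
          · simpa only [trunc_apply_of_mem hk] using hvc k j
          · simpa only [trunc_apply_of_notMem hk] using continuousOn_const) hθ hr hri hfr
        (N := N) (by linarith) ht))
  exact ⟨_, hsol (fun _ => 1) X continuousOn_const hXc (by simpa only [one_smul] using hX)⟩

/-! ### Coefficients of the bilinear term: bounds and approximation by finite sums -/

/-- The summands of the advection term of a divergence-free field, in divergence form. -/
theorem advection_summand_eq {u : VField} (hu : IsDivFree u) (v : VField) (k l : Freq)
    (j : Fin 2) : ∑ i, u (k - l) i * partialDeriv i v l j =
      ∑ i, Complex.I * (k i : ℂ) * (u (k - l) i * v l j) := by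
  have h := hu (k - l)
  simp only [Fin.sum_univ_two, partialDeriv, Pi.sub_apply, Int.cast_sub] at h ⊢
  linear_combination (-Complex.I * v l j) * h

/-- The largest frequency occurring in the divergence form of the advection term. -/
def advConst (k : Freq) : ℝ≥0∞ := ∑ i, ‖(k i : ℂ)‖ₑ

theorem advConst_ne_top (k : Freq) : advConst k ≠ ∞ :=
  ENNReal.sum_ne_top.mpr fun _ _ => enorm_ne_top

theorem mul_le_inv_mul_sq_add (a b : ℝ≥0∞) (d : ℝ≥0) (hd : d ≠ 0) :
    a * b ≤ (d : ℝ≥0∞)⁻¹ * a ^ 2 + d * b ^ 2 := by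
  have hd' : (d : ℝ≥0∞) ≠ 0 := by exact_mod_cast hd
  rcases le_total a (d * b) with h | h
  · calc a * b ≤ (d * b) * b := by gcongr
      _ = d * b ^ 2 := by ring
      _ ≤ _ := le_add_self
  · have h1 : b ≤ (d : ℝ≥0∞)⁻¹ * a := by
      rw [mul_comm, ← div_eq_mul_inv, ENNReal.le_div_iff_mul_le (Or.inl hd')
        (Or.inl ENNReal.coe_ne_top), mul_comm]
      exact h
    calc a * b ≤ a * ((d : ℝ≥0∞)⁻¹ * a) := by gcongr
      _ = (d : ℝ≥0∞)⁻¹ * a ^ 2 := by ring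
      _ ≤ _ := le_self_add

/-- In divergence form the derivative costs only the fixed output frequency k, so L² bounds suffice.
The parameter d allows an unbalanced Young inequality, which makes the tail of the series small. -/
theorem enorm_advection_summand_le {u : VField} (hu : IsDivFree u) (v : VField) (k l : Freq)
    (j : Fin 2) (d : ℝ≥0) (hd : d ≠ 0) : ‖∑ i, u (k - l) i * partialDeriv i v l j‖ₑ ≤
      advConst k * ((d : ℝ≥0∞)⁻¹ * ampSq u (k - l) + d * ampSq v l) := by
  rw [advection_summand_eq hu, advConst, Finset.sum_mul]
  refine (enorm_sum_fin_two_le _).trans (Finset.sum_le_sum fun i _ => ?_)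
  rw [enorm_mul, enorm_mul, enorm_mul, show ‖Complex.I‖ₑ = 1 by simp [enorm_eq_nnnorm], one_mul]
  gcongr
  refine (mul_le_inv_mul_sq_add _ _ d hd).trans ?_
  gcongr
  · exact enorm_sq_le_ampSq u _ i
  · exact enorm_sq_le_ampSq v _ j

theorem tsum_ampSq_sub (u : VField) (k : Freq) : ∑' l, ampSq u (k - l) = anisoSq 0 0 u := by
  rw [anisoSq_zero_zero]
  exact (Equiv.subLeft k).tsum_eq (ampSq u)

theorem tsum_enorm_advection_summand_le {u : VField} (hu : IsDivFree u) (v : VField) (k : Freq)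
    (j : Fin 2) : ∑' l, ‖∑ i, u (k - l) i * partialDeriv i v l j‖ₑ ≤
      advConst k * (anisoSq 0 0 u + anisoSq 0 0 v) := by
  refine (ENNReal.tsum_le_tsum fun l =>
    enorm_advection_summand_le hu v k l j 1 one_ne_zero).trans ?_
  rw [ENNReal.tsum_mul_left]
  simp only [ENNReal.coe_one, inv_one, one_mul]
  rw [ENNReal.tsum_add, tsum_ampSq_sub, ← anisoSq_zero_zero]

theorem summable_advection {u v : VField} (hd : IsDivFree u) (hu : anisoSq 0 0 u ≠ ∞)
    (hv : anisoSq 0 0 v ≠ ∞) (k : Freq) (j : Fin 2) :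
    Summable fun l => ∑ i, u (k - l) i * partialDeriv i v l j :=
  Summable.of_enorm (ne_top_of_le_ne_top
    (ENNReal.mul_ne_top (advConst_ne_top k) (ENNReal.add_ne_top.mpr ⟨hu, hv⟩))
    (tsum_enorm_advection_summand_le hd v k j))

theorem le_one_add_of_notMem_box {M : ℕ} {l : Freq} (hl : l ∉ box M) :
    ((M : ℝ) + 1) ^ 2 ≤ 1 + ((l 0 : ℝ) ^ 2 + (l 1 : ℝ) ^ 2) := by
  have key : ∀ a : ℤ, (M : ℤ) < |a| → ((M : ℝ) + 1) ^ 2 ≤ (a : ℝ) ^ 2 := fun a ha => by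
    have h1 : ((M : ℝ) + 1) ≤ |(a : ℝ)| := by exact_mod_cast ha
    rw [← sq_abs (a : ℝ)]
    gcongr
  rw [mem_box, not_forall] at hl
  obtain ⟨i, hi⟩ := hl
  have h := key _ (not_le.mp hi)
  fin_cases i <;> simp only [Fin.zero_eta, Fin.mk_one] at h <;>
    nlinarith [sq_nonneg (l 0 : ℝ), sq_nonneg (l 1 : ℝ)]

theorem le_anisoWeight_of_notMem_box {M : ℕ} {l : Freq} (hl : l ∉ box M) :
    ((M : ℝ) + 1) ^ 2 ≤ anisoWeight 1 1 l := by
  refine (le_one_add_of_notMem_box hl).trans ?_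
  simp only [anisoWeight, pow_one]
  nlinarith [mul_nonneg (sq_nonneg (l 0 : ℝ)) (sq_nonneg (l 1 : ℝ))]

/-- The partial sums of the advection term. -/
def advectionSum (M : ℕ) (u v : VField) : VField := fun k j =>
  ∑ l ∈ box M, ∑ i, u (k - l) i * partialDeriv i v l j

theorem enorm_advectionSum_le {u : VField} (hu : IsDivFree u) (v : VField) (k : Freq)
    (j : Fin 2) (M : ℕ) : ‖advectionSum M u v k j‖ₑ ≤
      advConst k * (anisoSq 0 0 u + anisoSq 0 0 v) :=
  (enorm_sum_le _ _).trans ((ENNReal.sum_le_tsum _).trans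
    (tsum_enorm_advection_summand_le hu v k j))

theorem enorm_advection_le {u : VField} (hu : IsDivFree u) (v : VField) (k : Freq)
    (j : Fin 2) : ‖advection u v k j‖ₑ ≤ advConst k * (anisoSq 0 0 u + anisoSq 0 0 v) :=
  (enorm_tsum_le_tsum_enorm).trans (tsum_enorm_advection_summand_le hu v k j)

/-- The rate in M is linear in the squared norms, so it can be integrated in time knowing only u
bounded in L² and v in L²(H^{1,1}). -/
theorem enorm_advection_sub_advectionSum_le {u : VField} (hu : IsDivFree u) (v : VField)
    (k : Freq) (j : Fin 2) (M : ℕ) : ‖advection u v k j - advectionSum M u v k j‖ₑ ≤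
      advConst k * ((M : ℝ≥0∞) + 1)⁻¹ * (anisoSq 0 0 u + anisoSq 1 1 v) := by
  have hw : ∀ l ∉ box M, ((M : ℝ≥0∞) + 1) * ampSq v l ≤
      ((M : ℝ≥0∞) + 1)⁻¹ * (ENNReal.ofReal (anisoWeight 1 1 l) * ampSq v l) := fun l hl => by
    rw [← mul_assoc]
    gcongr
    rw [mul_comm, ← div_eq_mul_inv, ENNReal.le_div_iff_mul_le (by simp) (by simp), ← sq]
    refine le_trans (le_of_eq ?_) (ENNReal.ofReal_le_ofReal (le_anisoWeight_of_notMem_box hl))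
    rw [ENNReal.ofReal_pow (by positivity), ENNReal.ofReal_add (by positivity) zero_le_one]
    simp
  have h01 : anisoSq 0 0 v ≤ anisoSq 1 1 v := by
    simpa using anisoSq_mono (zero_le_one (α := ℕ)) (zero_le_one (α := ℕ)) v
  -- If a norm is infinite the claimed bound may be infinite and there is nothing to show; otherwise
  -- the series converges and can be split.
  have hS : (Summable fun l => ∑ i, u (k - l) i * partialDeriv i v l j) ∨
      advConst k * ((M : ℝ≥0∞) + 1)⁻¹ * (anisoSq 0 0 u + anisoSq 1 1 v) = ∞ := by
    rcases eq_or_ne (advConst k * (anisoSq 0 0 u + anisoSq 1 1 v)) ∞ with h | h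
    · right
      rw [mul_right_comm, h, ENNReal.top_mul]
      simp
    · left
      refine Summable.of_enorm (ne_top_of_le_ne_top h
        ((tsum_enorm_advection_summand_le hu v k j).trans ?_))
      gcongr
  rcases hS with hS | hS
  swap
  · exact hS ▸ le_top
  have hsplit : advection u v k j - advectionSum M u v k j =
      ∑' l : {l // l ∉ box M}, ∑ i, u (k - l) i * partialDeriv i v l j := by
    rw [sub_eq_iff_eq_add', advection, advectionSum, hS.sum_add_tsum_subtype_compl]
  rw [hsplit]
  calc _ ≤ ∑' l : {l // l ∉ box M}, ‖∑ i, u (k - l) i * partialDeriv i v l j‖ₑ :=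
        enorm_tsum_le_tsum_enorm
    _ ≤ ∑' l : {l // l ∉ box M}, advConst k * ((M : ℝ≥0∞) + 1)⁻¹ * (ampSq u (k - l) +
          ENNReal.ofReal (anisoWeight 1 1 l) * ampSq v l) := by
        refine ENNReal.tsum_le_tsum fun l =>
          -- With d = M+1 the u-part gains 1/(M+1), and outside the box the weight is at least
          -- (M+1)², which turns the loss in the v-part into the same gain.
          (enorm_advection_summand_le hu v k l j (M + 1) (by positivity)).trans ?_
        rw [mul_assoc (advConst k), mul_add (((M : ℝ≥0∞) + 1)⁻¹)]
        push_cast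
        gcongr advConst k * (_ + ?_)
        exact hw l l.2
    _ ≤ ∑' l : Freq, advConst k * ((M : ℝ≥0∞) + 1)⁻¹ * (ampSq u (k - l) +
          ENNReal.ofReal (anisoWeight 1 1 l) * ampSq v l) :=
        ENNReal.tsum_comp_le_tsum_of_injective Subtype.val_injective _
    _ = _ := by
        rw [ENNReal.tsum_mul_left, ENNReal.tsum_add, tsum_ampSq_sub]
        have := anisoSq_natCast 1 1 v
        simp only [Nat.cast_one] at this
        rw [this]

/-- A bound for the norm of the Leray projection at a single frequency. -/
def lerayConst (k : Freq) (j : Fin 2) : ℝ≥0∞ :=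
  1 + ∑ i, ‖(k j : ℂ) * (k i : ℂ) / ∑ i, (k i : ℂ) ^ 2‖ₑ

theorem lerayConst_ne_top (k : Freq) (j : Fin 2) : lerayConst k j ≠ ∞ :=
  ENNReal.add_ne_top.mpr ⟨ENNReal.one_ne_top, ENNReal.sum_ne_top.mpr fun _ _ => enorm_ne_top⟩

theorem enorm_leray_le (F : VField) (k : Freq) (j : Fin 2) :
    ‖leray F k j‖ₑ ≤ lerayConst k j * ∑ i, ‖F k i‖ₑ := by
  have h : leray F k j =
      F k j - ∑ i, (k j : ℂ) * (k i : ℂ) / (∑ i, (k i : ℂ) ^ 2) * F k i := by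
    simp only [leray, Finset.mul_sum, Finset.sum_div]
    congr 1
    exact Finset.sum_congr rfl fun i _ => by ring
  rw [h, lerayConst, add_mul, one_mul]
  refine enorm_sub_le.trans (add_le_add ?_ ?_)
  · exact Finset.single_le_sum (f := fun i => ‖F k i‖ₑ) (fun _ _ => zero_le)
      (Finset.mem_univ j)
  · rw [Finset.sum_mul]
    refine (enorm_sum_le _ _).trans (Finset.sum_le_sum fun i _ => ?_)
    rw [enorm_mul]
    gcongr
    exact Finset.single_le_sum (f := fun i => ‖F k i‖ₑ) (fun _ _ => zero_le)
      (Finset.mem_univ i)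

theorem leray_sub (u v : VField) : leray (u - v) = leray u - leray v := by
  funext k j
  simp only [leray, Pi.sub_apply, Fin.sum_univ_two]
  ring

/-- The constant in the estimates of the coefficients of the bilinear term. -/
def bilinConst (k : Freq) (j : Fin 2) : ℝ≥0∞ := lerayConst k j * (2 * advConst k)

theorem bilinConst_ne_top (k : Freq) (j : Fin 2) : bilinConst k j ≠ ∞ :=
  ENNReal.mul_ne_top (lerayConst_ne_top k j)
    (ENNReal.mul_ne_top ENNReal.ofNat_ne_top (advConst_ne_top k))

theorem enorm_leray_le_of_forall {F : VField} {k : Freq} {A : ℝ≥0∞}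
    (h : ∀ i, ‖F k i‖ₑ ≤ advConst k * A) (j : Fin 2) :
    ‖leray F k j‖ₑ ≤ bilinConst k j * A := by
  refine (enorm_leray_le F k j).trans ?_
  rw [bilinConst, mul_assoc]
  gcongr
  rw [Fin.sum_univ_two, mul_assoc, two_mul]
  exact add_le_add (h 0) (h 1)

theorem enorm_bilinB_le {u : VField} (hu : IsDivFree u) (v : VField) (k : Freq) (j : Fin 2) :
    ‖bilinB u v k j‖ₑ ≤ bilinConst k j * (anisoSq 0 0 u + anisoSq 0 0 v) :=
  enorm_leray_le_of_forall (fun i => enorm_advection_le hu v k i) j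

theorem enorm_leray_advectionSum_le {u : VField} (hu : IsDivFree u) (v : VField) (k : Freq)
    (j : Fin 2) (M : ℕ) : ‖leray (advectionSum M u v) k j‖ₑ ≤
      bilinConst k j * (anisoSq 0 0 u + anisoSq 0 0 v) :=
  enorm_leray_le_of_forall (fun i => enorm_advectionSum_le hu v k i M) j

theorem enorm_bilinB_sub_le {u : VField} (hu : IsDivFree u) (v : VField) (k : Freq) (j : Fin 2)
    (M : ℕ) : ‖bilinB u v k j - leray (advectionSum M u v) k j‖ₑ ≤
      bilinConst k j * (((M : ℝ≥0∞) + 1)⁻¹ * (anisoSq 0 0 u + anisoSq 1 1 v)) := by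
  have h : bilinB u v k j - leray (advectionSum M u v) k j =
      leray (advection u v - advectionSum M u v) k j := by
    rw [leray_sub]
    rfl
  rw [h]
  refine enorm_leray_le_of_forall (fun i => ?_) j
  rw [← mul_assoc]
  exact enorm_advection_sub_advectionSum_le hu v k i M

theorem tendsto_leray {ι : Type*} {l : Filter ι} {F : ι → VField} {G : VField}
    (h : ∀ k j, Tendsto (fun n => F n k j) l (𝓝 (G k j))) (k : Freq) (j : Fin 2) :
    Tendsto (fun n => leray (F n) k j) l (𝓝 (leray G k j)) :=
  (h k j).sub (((tendsto_finsetSum _ fun i _ => (h k i).const_mul _).const_mul _).div_const _)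

theorem tendsto_advectionSum {ι : Type*} {l : Filter ι} {x y : ι → VField} {u v : VField}
    (hx : ∀ k j, Tendsto (fun n => x n k j) l (𝓝 (u k j)))
    (hy : ∀ k j, Tendsto (fun n => y n k j) l (𝓝 (v k j))) (M : ℕ) (k : Freq) (j : Fin 2) :
    Tendsto (fun n => advectionSum M (x n) (y n) k j) l (𝓝 (advectionSum M u v k j)) :=
  tendsto_finsetSum _ fun p _ => tendsto_finsetSum _ fun i _ =>
    (hx (k - p) i).mul ((hy p j).const_mul _)

theorem tendsto_advectionSum_advection {u v : VField} (hd : IsDivFree u)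
    (hu : anisoSq 0 0 u ≠ ∞) (hv : anisoSq 0 0 v ≠ ∞) (k : Freq) (j : Fin 2) :
    Tendsto (fun M => advectionSum M u v k j) atTop (𝓝 (advection u v k j)) :=
  (summable_advection hd hu hv k j).hasSum.comp tendsto_box

/-! ### Measurability, lower semicontinuity, and limits of the integrated drift -/

section Measurability

variable {Ω : Type*} [MeasurableSpace Ω] {μ : Measure Ω} {x y : Ω → VField}

theorem aemeasurable_leray {F : Ω → VField}
    (h : ∀ k j, AEMeasurable (fun s => F s k j) μ) (k : Freq) (j : Fin 2) :
    AEMeasurable (fun s => leray (F s) k j) μ := by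
  simp only [leray, Fin.sum_univ_two]
  exact (h k j).sub ((((h k 0).const_mul _).add ((h k 1).const_mul _)).const_mul _ |>.div_const _)

theorem aemeasurable_advectionSum (hx : ∀ k j, AEMeasurable (fun s => x s k j) μ)
    (hy : ∀ k j, AEMeasurable (fun s => y s k j) μ) (M : ℕ) (k : Freq) (j : Fin 2) :
    AEMeasurable (fun s => advectionSum M (x s) (y s) k j) μ := by
  unfold advectionSum
  exact Finset.aemeasurable_fun_sum _ fun p _ => Finset.aemeasurable_fun_sum _ fun i _ =>
    (hx (k - p) i).mul ((hy p j).const_mul _)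

theorem aemeasurable_bilinB (hx : ∀ k j, AEMeasurable (fun s => x s k j) μ)
    (hy : ∀ k j, AEMeasurable (fun s => y s k j) μ)
    (hd : ∀ᵐ s ∂μ, IsDivFree (x s) ∧ anisoSq 0 0 (x s) ≠ ∞ ∧ anisoSq 0 0 (y s) ≠ ∞)
    (k : Freq) (j : Fin 2) : AEMeasurable (fun s => bilinB (x s) (y s) k j) μ := by
  refine aemeasurable_leray (fun k j => ?_) k j
  refine aemeasurable_of_tendsto_metrizable_ae atTop
    (fun M => aemeasurable_advectionSum hx hy M k j) ?_
  filter_upwards [hd] with s hs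
  exact tendsto_advectionSum_advection hs.1 hs.2.1 hs.2.2 k j

theorem aemeasurable_anisoSq (hx : ∀ k j, AEMeasurable (fun s => x s k j) μ) (a b : ℝ) :
    AEMeasurable (fun s => anisoSq a b (x s)) μ := by
  unfold anisoSq
  exact AEMeasurable.tsum fun k => (Finset.aemeasurable_fun_sum _ fun j _ =>
    (hx k j).enorm.pow_const 2).const_mul _

end Measurability

/-- Lower semicontinuity of the anisotropic norms under convergence of all coefficients. -/
theorem anisoSq_le_liminf {ι : Type*} {l : Filter ι} [l.NeBot] {x : ι → VField} {u : VField}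
    (hx : ∀ k j, Tendsto (fun n => x n k j) l (𝓝 (u k j))) (a b : ℝ) :
    anisoSq a b u ≤ liminf (fun n => anisoSq a b (x n)) l := by
  rw [anisoSq, ENNReal.tsum_eq_iSup_sum]
  refine iSup_le fun S => ?_
  have h : Tendsto (fun n => ∑ k ∈ S, ENNReal.ofReal ((1 + (k 0 : ℝ) ^ 2) ^ a *
      (1 + (k 1 : ℝ) ^ 2) ^ b) * ∑ j, ‖x n k j‖ₑ ^ 2) l
      (𝓝 (∑ k ∈ S, ENNReal.ofReal ((1 + (k 0 : ℝ) ^ 2) ^ a *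
      (1 + (k 1 : ℝ) ^ 2) ^ b) * ∑ j, ‖u k j‖ₑ ^ 2)) :=
    tendsto_finsetSum _ fun k _ => ENNReal.Tendsto.const_mul (tendsto_finsetSum _ fun j _ =>
      ENNReal.Tendsto.pow (hx k j).enorm) (Or.inr ENNReal.ofReal_ne_top)
  rw [← h.liminf_eq]
  exact liminf_le_liminf (Eventually.of_forall fun n => ENNReal.sum_le_tsum S)

theorem anisoSq_le_of_tendsto {ι : Type*} {l : Filter ι} [l.NeBot] {x : ι → VField} {u : VField}
    (hx : ∀ k j, Tendsto (fun n => x n k j) l (𝓝 (u k j))) {a b : ℝ} {A : ℝ≥0∞}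
    (hA : ∀ n, anisoSq a b (x n) ≤ A) : anisoSq a b u ≤ A :=
  (anisoSq_le_liminf hx a b).trans
    ((liminf_le_liminf (Eventually.of_forall hA)).trans_eq (liminf_const A))

theorem lintegral_anisoSq_le_of_tendsto {Ω : Type*} [MeasurableSpace Ω] {μ : Measure Ω}
    {x : ℕ → Ω → VField} {u : Ω → VField} (hxm : ∀ n k j, AEMeasurable (fun s => x n s k j) μ)
    (hx : ∀ᵐ s ∂μ, ∀ k j, Tendsto (fun n => x n s k j) atTop (𝓝 (u s k j))) {a b : ℝ}
    {A : ℝ≥0∞} (hA : ∀ n, ∫⁻ s, anisoSq a b (x n s) ∂μ ≤ A) :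
    ∫⁻ s, anisoSq a b (u s) ∂μ ≤ A :=
  (lintegral_mono_ae (hx.mono fun _ hs => anisoSq_le_liminf hs a b)).trans
    ((lintegral_liminf_le' fun n => aemeasurable_anisoSq (hxm n) a b).trans
      ((liminf_le_liminf (Eventually.of_forall hA)).trans_eq (liminf_const A)))

theorem tendsto_of_forall_approx {J : ℕ → ℂ} {z : ℂ} {I : ℕ → ℕ → ℂ} {w : ℕ → ℂ} {D : ℝ≥0∞}
    (hD : D ≠ ∞) (h1 : ∀ M n, ‖J n - I M n‖ₑ ≤ D * ((M : ℝ≥0∞) + 1)⁻¹)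
    (h2 : ∀ M, ‖z - w M‖ₑ ≤ D * ((M : ℝ≥0∞) + 1)⁻¹)
    (h3 : ∀ M, Tendsto (I M) atTop (𝓝 (w M))) : Tendsto J atTop (𝓝 z) := by
  have hlim : Tendsto (fun M : ℕ => D * ((M : ℝ≥0∞) + 1)⁻¹) atTop (𝓝 0) := by
    have h := ENNReal.Tendsto.const_mul (a := D) ((tendsto_add_atTop_iff_nat 1).mpr
      ENNReal.tendsto_inv_nat_nhds_zero) (Or.inr hD)
    simpa only [Nat.cast_add, Nat.cast_one, mul_zero] using h
  rw [EMetric.tendsto_atTop]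
  intro ε hε
  obtain ⟨M, hM⟩ := ((tendsto_order.mp hlim).2 (ε / 3)
    (ENNReal.div_pos hε.ne' ENNReal.ofNat_ne_top)).exists
  obtain ⟨N, hN⟩ := EMetric.tendsto_atTop.mp (h3 M) (ε / 3)
    (ENNReal.div_pos hε.ne' ENNReal.ofNat_ne_top)
  refine ⟨N, fun n hn => ?_⟩
  have e1 : edist (J n) (I M n) < ε / 3 := by
    rw [edist_eq_enorm_sub]
    exact (h1 M n).trans_lt hM
  have e2 : edist (w M) z < ε / 3 := by
    rw [edist_comm, edist_eq_enorm_sub]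
    exact (h2 M).trans_lt hM
  calc edist (J n) z ≤ edist (J n) (I M n) + edist (I M n) (w M) + edist (w M) z :=
        edist_triangle4 _ _ _ _
    _ < ε / 3 + ε / 3 + ε / 3 := ENNReal.add_lt_add (ENNReal.add_lt_add e1 (hN n hn)) e2
    _ = ε := ENNReal.add_thirds ε

theorem integrable_bilinB {Ω : Type*} [MeasurableSpace Ω] {μ : Measure Ω}
    [IsFiniteMeasure μ] {a b : Ω → VField} {C : ℝ≥0}
    (ham : ∀ k j, AEMeasurable (fun s => a s k j) μ)
    (hbm : ∀ k j, AEMeasurable (fun s => b s k j) μ) (had : ∀ᵐ s ∂μ, IsDivFree (a s))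
    (ha : ∀ᵐ s ∂μ, anisoSq 0 0 (a s) ≤ C) (hb : ∀ᵐ s ∂μ, anisoSq 0 0 (b s) ≤ C)
    (k : Freq) (j : Fin 2) : Integrable (fun s => bilinB (a s) (b s) k j) μ := by
  refine ⟨(aemeasurable_bilinB ham hbm ?_ k j).aestronglyMeasurable, ?_⟩
  · filter_upwards [had, ha, hb] with s h1 h2 h3
    exact ⟨h1, ne_top_of_le_ne_top ENNReal.coe_ne_top h2,
      ne_top_of_le_ne_top ENNReal.coe_ne_top h3⟩
  · refine (lintegral_mono_ae (g := fun _ => bilinConst k j * (C + C)) ?_).trans_lt ?_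
    · filter_upwards [had, ha, hb] with s h1 h2 h3
      refine (enorm_bilinB_le h1 _ k j).trans ?_
      gcongr
    · rw [lintegral_const]
      exact ENNReal.mul_lt_top (ENNReal.mul_lt_top (bilinConst_ne_top k j).lt_top
        (by simp)) (measure_lt_top μ _)

/-- Coefficientwise convergence passes through each partial sum of B, a polynomial in finitely many
coefficients, by dominated convergence. The remainder is of order 1/(M+1) uniformly in n, so the two
limits can be interchanged. Only the advected field needs the H^{1,1} bound. -/
theorem tendsto_integral_bilinB {Ω : Type*} [MeasurableSpace Ω] {μ : Measure Ω}
    [IsFiniteMeasure μ] {x y : ℕ → Ω → VField} {u v : Ω → VField} {C : ℝ≥0}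
    (hxm : ∀ n k j, AEMeasurable (fun s => x n s k j) μ)
    (hym : ∀ n k j, AEMeasurable (fun s => y n s k j) μ)
    (hd : ∀ n, ∀ᵐ s ∂μ, IsDivFree (x n s)) (hdu : ∀ᵐ s ∂μ, IsDivFree (u s))
    (hx : ∀ n, ∀ᵐ s ∂μ, anisoSq 0 0 (x n s) ≤ C) (hu : ∀ᵐ s ∂μ, anisoSq 0 0 (u s) ≤ C)
    (hy : ∀ n, ∀ᵐ s ∂μ, anisoSq 0 0 (y n s) ≤ C) (hv : ∀ᵐ s ∂μ, anisoSq 0 0 (v s) ≤ C)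
    (hy1 : ∀ n, ∫⁻ s, anisoSq 1 1 (y n s) ∂μ ≤ C) (hv1 : ∫⁻ s, anisoSq 1 1 (v s) ∂μ ≤ C)
    (hxu : ∀ᵐ s ∂μ, ∀ k j, Tendsto (fun n => x n s k j) atTop (𝓝 (u s k j)))
    (hyv : ∀ᵐ s ∂μ, ∀ k j, Tendsto (fun n => y n s k j) atTop (𝓝 (v s k j)))
    (k : Freq) (j : Fin 2) :
    Tendsto (fun n => ∫ s, bilinB (x n s) (y n s) k j ∂μ) atTop
      (𝓝 (∫ s, bilinB (u s) (v s) k j ∂μ)) := by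
  have hum : ∀ k j, AEMeasurable (fun s => u s k j) μ := fun k j =>
    aemeasurable_of_tendsto_metrizable_ae atTop (fun n => hxm n k j)
      (hxu.mono fun s hs => hs k j)
  have hvm : ∀ k j, AEMeasurable (fun s => v s k j) μ := fun k j =>
    aemeasurable_of_tendsto_metrizable_ae atTop (fun n => hym n k j)
      (hyv.mono fun s hs => hs k j)
  have hbound : ∀ {a b : Ω → VField}, (∀ k j, AEMeasurable (fun s => a s k j) μ) →
      (∀ k j, AEMeasurable (fun s => b s k j) μ) → (∀ᵐ s ∂μ, IsDivFree (a s)) →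
      (∀ᵐ s ∂μ, anisoSq 0 0 (a s) ≤ C) → (∀ᵐ s ∂μ, anisoSq 0 0 (b s) ≤ C) →
      ∫⁻ s, anisoSq 1 1 (b s) ∂μ ≤ C → ∀ M : ℕ,
      ‖∫ s, bilinB (a s) (b s) k j ∂μ - ∫ s, leray (advectionSum M (a s) (b s)) k j ∂μ‖ₑ ≤
        bilinConst k j * (C * μ Set.univ + C) * ((M : ℝ≥0∞) + 1)⁻¹ := by
    intro a b ham hbm had ha hb hb1 M
    have hI1 := integrable_bilinB ham hbm had ha hb k j
    have hI2 : Integrable (fun s => leray (advectionSum M (a s) (b s)) k j) μ := by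
      refine ⟨(aemeasurable_leray (fun k j => aemeasurable_advectionSum ham hbm M k j)
        k j).aestronglyMeasurable, ?_⟩
      refine (lintegral_mono_ae (g := fun _ => bilinConst k j * (C + C)) ?_).trans_lt ?_
      · filter_upwards [had, ha, hb] with s h1 h2 h3
        refine (enorm_leray_advectionSum_le h1 _ k j M).trans ?_
        gcongr
      · rw [lintegral_const]
        exact ENNReal.mul_lt_top (ENNReal.mul_lt_top (bilinConst_ne_top k j).lt_top
          (by simp)) (measure_lt_top μ _)
    rw [← integral_sub hI1 hI2]
    calc _ ≤ ∫⁻ s, ‖bilinB (a s) (b s) k j - leray (advectionSum M (a s) (b s)) k j‖ₑ ∂μ :=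
          enorm_integral_le_lintegral_enorm _
      _ ≤ ∫⁻ s, bilinConst k j * (((M : ℝ≥0∞) + 1)⁻¹ * (C + anisoSq 1 1 (b s))) ∂μ := by
          refine lintegral_mono_ae ?_
          filter_upwards [had, ha] with s h1 h2
          refine (enorm_bilinB_sub_le h1 _ k j M).trans ?_
          gcongr
      _ = bilinConst k j * (((M : ℝ≥0∞) + 1)⁻¹ * (C * μ Set.univ +
            ∫⁻ s, anisoSq 1 1 (b s) ∂μ)) := by
          rw [lintegral_const_mul' _ _ (bilinConst_ne_top k j), lintegral_const_mul' _ _ (by simp),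
            lintegral_add_left measurable_const, lintegral_const]
      _ ≤ bilinConst k j * (((M : ℝ≥0∞) + 1)⁻¹ * (C * μ Set.univ + C)) := by gcongr
      _ = _ := by ring
  refine tendsto_of_forall_approx (D := bilinConst k j * (C * μ Set.univ + C))
    (ENNReal.mul_ne_top (bilinConst_ne_top k j) (by finiteness))
    (fun M n => hbound (hxm n) (hym n) (hd n) (hx n) (hy n) (hy1 n) M)
    (fun M => hbound hum hvm hdu hu hv hv1 M) fun M => ?_
  refine tendsto_integral_of_dominated_convergence
    (fun _ => (bilinConst k j * (C + C)).toReal) (fun n => (aemeasurable_leray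
      (fun k j => aemeasurable_advectionSum (hxm n) (hym n) M k j) k j).aestronglyMeasurable)
    (integrable_const _) (fun n => ?_) ?_
  · filter_upwards [hd n, hx n, hy n] with s h1 h2 h3
    rw [← toReal_enorm]
    refine ENNReal.toReal_mono (ENNReal.mul_ne_top (bilinConst_ne_top k j) (by finiteness)) ?_
    refine (enorm_leray_advectionSum_le h1 _ k j M).trans ?_
    gcongr
  · filter_upwards [hxu, hyv] with s h1 h2
    exact tendsto_leray (fun k j => tendsto_advectionSum h1 h2 M k j) k j

/-! ### Compactness and passage to the limit in the Galerkin scheme -/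

open BoundedContinuousFunction in
/-- A diagonal Arzelà-Ascoli theorem for countably many sequences of functions on `[0,T]`. -/
theorem exists_subseq_tendsto {ι : Type*} [Countable ι] {T : ℝ} (hT : 0 ≤ T)
    {z : ℕ → ℝ → ι → ℂ} (R : ι → ℝ) (hR : ∀ n i, ∀ t ∈ Set.Icc 0 T, ‖z n t i‖ ≤ R i)
    (G : ι → ℝ → ℝ) (hG : ∀ i, ContinuousOn (G i) (Set.Icc 0 T))
    (hz : ∀ n i, ∀ s ∈ Set.Icc 0 T, ∀ t ∈ Set.Icc 0 T, ‖z n t i - z n s i‖ ≤ |G i t - G i s|) :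
    ∃ (φ : ℕ → ℕ) (X : ℝ → ι → ℂ), StrictMono φ ∧ (∀ i, Continuous fun t => X t i) ∧
      ∀ i (t : ℝ), Tendsto (fun n => z (φ n) (Set.projIcc 0 T hT t) i) atTop (𝓝 (X t i)) := by
  have hGc : ∀ i, Continuous fun t : Set.Icc (0 : ℝ) T => G i t := fun i =>
    continuousOn_iff_continuous_domRestrict.mp (hG i)
  have hmod : ∀ i (t : Set.Icc (0 : ℝ) T),
      Tendsto (fun s : Set.Icc (0 : ℝ) T => |G i t - G i s|) (𝓝 t) (𝓝 0) := fun i t => by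
    have h : Continuous fun s : Set.Icc (0 : ℝ) T => |G i t - G i s| :=
      (continuous_const.sub (hGc i)).abs
    simpa using h.tendsto t
  have hle : ∀ n i (s t : Set.Icc (0 : ℝ) T), dist (z n t i) (z n s i) ≤ |G i t - G i s| :=
    fun n i s t => by
      rw [dist_eq_norm]
      exact hz n i s s.2 t t.2
  have hc : ∀ n i, Continuous fun t : Set.Icc (0 : ℝ) T => z n t i := fun n i =>
    continuous_iff_continuousAt.mpr fun t => tendsto_iff_dist_tendsto_zero.mpr
      (squeeze_zero (fun _ => dist_nonneg)
        (fun s => (dist_comm _ _).trans_le (hle n i s t)) (hmod i t))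
  set w : ℕ → ι → (Set.Icc (0 : ℝ) T →ᵇ ℂ) := fun n i => mkOfCompact ⟨_, hc n i⟩ with hw
  have hcomp : ∀ i, IsCompact (closure (Set.range fun n => w n i)) := fun i => by
    refine arzela_ascoli (Metric.closedBall 0 (R i)) (isCompact_closedBall _ _) _ ?_ ?_
    · rintro _ t ⟨n, rfl⟩
      simpa [hw] using hR n i t t.2
    · intro t
      refine Metric.equicontinuousAt_of_continuity_modulus _ (hmod i t) _
        (Eventually.of_forall fun s => ?_)
      rintro ⟨_, n, rfl⟩
      exact hle n i s t
  -- Tychonoff replaces the diagonal extraction; countability of the index set makes the compact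
  -- product sequentially compact.
  obtain ⟨g, -, φ, hφ, hg⟩ := (isCompact_univ_pi hcomp).tendsto_subseq (x := w)
    fun n i _ => subset_closure ⟨n, rfl⟩
  refine ⟨φ, fun t i => g i (Set.projIcc 0 T hT t), hφ,
    fun i => (g i).continuous.comp continuous_projIcc, fun i t => ?_⟩
  exact ((continuous_eval_const (Set.projIcc 0 T hT t)).tendsto (g i)).comp
    ((tendsto_pi_nhds.mp hg) i)

theorem norm_coeff_le {u : VField} {C : ℝ≥0} (hu : anisoSq 0 0 u ≤ C) (k : Freq) (j : Fin 2) :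
    ‖u k j‖ ≤ 1 + C := by
  have h : ‖u k j‖ₑ ^ 2 ≤ C := (enorm_sq_le_ampSq u k j).trans
    ((ENNReal.le_tsum k).trans ((anisoSq_zero_zero u).symm.trans_le hu))
  have h' : ‖u k j‖ ^ 2 ≤ C := by
    rw [enorm_eq_nnnorm] at h
    exact_mod_cast h
  nlinarith [sq_nonneg (‖u k j‖ - 1), norm_nonneg (u k j)]

theorem norm_bilinB_le {u v : VField} {C : ℝ≥0} (hd : IsDivFree u) (hu : anisoSq 0 0 u ≤ C)
    (hv : anisoSq 0 0 v ≤ C) (k : Freq) (j : Fin 2) :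
    ‖bilinB u v k j‖ ≤ (bilinConst k j).toReal * (2 * C) := by
  have h := (enorm_bilinB_le hd v k j).trans
    (mul_le_mul_right (add_le_add hu hv) (bilinConst k j))
  have h' := ENNReal.toReal_mono (ENNReal.mul_ne_top (bilinConst_ne_top k j) (by finiteness)) h
  rw [toReal_enorm, ENNReal.toReal_mul, ← two_mul] at h'
  simpa using h'

theorem norm_laplace_le {u : VField} {C : ℝ≥0} (hu : anisoSq 0 0 u ≤ C) (k : Freq) (j : Fin 2) :
    ‖partialDeriv 0 (partialDeriv 0 u) k j‖ ≤ (k 0 : ℝ) ^ 2 * (1 + C) := by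
  have h : ‖partialDeriv 0 (partialDeriv 0 u) k j‖ = (k 0 : ℝ) ^ 2 * ‖u k j‖ := by
    simp only [partialDeriv, norm_mul, Complex.norm_I, Complex.norm_intCast, one_mul]
    rw [← mul_assoc, ← sq, sq_abs]
  rw [h]
  gcongr
  exact norm_coeff_le hu k j

/-- A bound for the coefficients of the drift. -/
def driftConst (α : ℝ) (C : ℝ≥0) (k : Freq) (j : Fin 2) : ℝ :=
  (k 0 : ℝ) ^ 2 * (1 + C) + (|α| + 2) * ((bilinConst k j).toReal * (2 * C))

theorem norm_driftField_le (α : ℝ) {u v : VField} {C : ℝ≥0} (hdu : IsDivFree u)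
    (hdv : IsDivFree v) (hu : anisoSq 0 0 u ≤ C) (hv : anisoSq 0 0 v ≤ C) (k : Freq)
    (j : Fin 2) : ‖driftField α u v k j‖ ≤ driftConst α C k j := by
  have h1 := norm_laplace_le hu k j
  have h2 := norm_bilinB_le hdu hu hu k j
  have h3 := norm_bilinB_le hdu hu hv k j
  have h4 := norm_bilinB_le hdv hv hu k j
  have h5 : ‖α • bilinB u u k j‖ ≤ |α| * ((bilinConst k j).toReal * (2 * C)) := by
    rw [norm_smul, Real.norm_eq_abs]
    gcongr
  simp only [driftField, Pi.sub_apply, Pi.smul_apply]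
  refine (norm_sub_le _ _).trans ?_
  have h6 := norm_sub_le (partialDeriv 0 (partialDeriv 0 u) k j) (α • bilinB u u k j)
  have h7 := norm_sub_le (partialDeriv 0 (partialDeriv 0 u) k j - α • bilinB u u k j)
    (bilinB u v k j)
  unfold driftConst
  linarith

section Drift

variable {Ω : Type*} [MeasurableSpace Ω] {μ : Measure Ω} [IsFiniteMeasure μ] {C : ℝ≥0}

theorem integrable_laplace {a : Ω → VField} (ham : ∀ k j, AEMeasurable (fun s => a s k j) μ)
    (ha : ∀ᵐ s ∂μ, anisoSq 0 0 (a s) ≤ C) (k : Freq) (j : Fin 2) :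
    Integrable (fun s => partialDeriv 0 (partialDeriv 0 (a s)) k j) μ :=
  Integrable.of_bound (((ham k j).const_mul _).const_mul _).aestronglyMeasurable _
    (ha.mono fun _ hs => norm_laplace_le hs k j)

theorem integrable_driftField (α : ℝ) {a b : Ω → VField}
    (ham : ∀ k j, AEMeasurable (fun s => a s k j) μ)
    (hbm : ∀ k j, AEMeasurable (fun s => b s k j) μ) (had : ∀ᵐ s ∂μ, IsDivFree (a s))
    (hbd : ∀ᵐ s ∂μ, IsDivFree (b s))
    (ha : ∀ᵐ s ∂μ, anisoSq 0 0 (a s) ≤ C) (hb : ∀ᵐ s ∂μ, anisoSq 0 0 (b s) ≤ C)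
    (k : Freq) (j : Fin 2) : Integrable (fun s => driftField α (a s) (b s) k j) μ :=
  (((integrable_laplace ham ha k j).sub
    ((integrable_bilinB ham ham had ha ha k j).smul α)).sub
    (integrable_bilinB ham hbm had ha hb k j)).sub (integrable_bilinB hbm ham hbd hb ha k j)

theorem integral_driftField (α : ℝ) {a b : Ω → VField}
    (ham : ∀ k j, AEMeasurable (fun s => a s k j) μ)
    (hbm : ∀ k j, AEMeasurable (fun s => b s k j) μ) (had : ∀ᵐ s ∂μ, IsDivFree (a s))
    (hbd : ∀ᵐ s ∂μ, IsDivFree (b s))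
    (ha : ∀ᵐ s ∂μ, anisoSq 0 0 (a s) ≤ C) (hb : ∀ᵐ s ∂μ, anisoSq 0 0 (b s) ≤ C)
    (k : Freq) (j : Fin 2) : ∫ s, driftField α (a s) (b s) k j ∂μ =
      ∫ s, partialDeriv 0 (partialDeriv 0 (a s)) k j ∂μ - α • ∫ s, bilinB (a s) (a s) k j ∂μ -
        ∫ s, bilinB (a s) (b s) k j ∂μ - ∫ s, bilinB (b s) (a s) k j ∂μ := by
  have h0 := integrable_laplace ham ha k j
  have h1 := (integrable_bilinB ham ham had ha ha k j).smul α
  have h2 := integrable_bilinB ham hbm had ha hb k j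
  have h3 := integrable_bilinB hbm ham hbd hb ha k j
  rw [← integral_smul]
  exact (integral_sub ((h0.sub h1).sub h2) h3).trans (congrArg (· - _)
    ((integral_sub (h0.sub h1) h2).trans (congrArg (· - _) (integral_sub h0 h1))))

theorem tendsto_integral_driftField (α : ℝ) {x y : ℕ → Ω → VField} {u v : Ω → VField}
    (hxm : ∀ n k j, AEMeasurable (fun s => x n s k j) μ)
    (hym : ∀ n k j, AEMeasurable (fun s => y n s k j) μ)
    (hdx : ∀ n, ∀ᵐ s ∂μ, IsDivFree (x n s)) (hdu : ∀ᵐ s ∂μ, IsDivFree (u s))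
    (hdy : ∀ n, ∀ᵐ s ∂μ, IsDivFree (y n s)) (hdv : ∀ᵐ s ∂μ, IsDivFree (v s))
    (hx : ∀ n, ∀ᵐ s ∂μ, anisoSq 0 0 (x n s) ≤ C) (hu : ∀ᵐ s ∂μ, anisoSq 0 0 (u s) ≤ C)
    (hy : ∀ n, ∀ᵐ s ∂μ, anisoSq 0 0 (y n s) ≤ C) (hv : ∀ᵐ s ∂μ, anisoSq 0 0 (v s) ≤ C)
    (hx1 : ∀ n, ∫⁻ s, anisoSq 1 1 (x n s) ∂μ ≤ C) (hu1 : ∫⁻ s, anisoSq 1 1 (u s) ∂μ ≤ C)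
    (hy1 : ∀ n, ∫⁻ s, anisoSq 1 1 (y n s) ∂μ ≤ C) (hv1 : ∫⁻ s, anisoSq 1 1 (v s) ∂μ ≤ C)
    (hxu : ∀ᵐ s ∂μ, ∀ k j, Tendsto (fun n => x n s k j) atTop (𝓝 (u s k j)))
    (hyv : ∀ᵐ s ∂μ, ∀ k j, Tendsto (fun n => y n s k j) atTop (𝓝 (v s k j)))
    (k : Freq) (j : Fin 2) :
    Tendsto (fun n => ∫ s, driftField α (x n s) (y n s) k j ∂μ) atTop
      (𝓝 (∫ s, driftField α (u s) (v s) k j ∂μ)) := by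
  have hum : ∀ k j, AEMeasurable (fun s => u s k j) μ := fun k j =>
    aemeasurable_of_tendsto_metrizable_ae atTop (fun n => hxm n k j)
      (hxu.mono fun s hs => hs k j)
  have hvm : ∀ k j, AEMeasurable (fun s => v s k j) μ := fun k j =>
    aemeasurable_of_tendsto_metrizable_ae atTop (fun n => hym n k j)
      (hyv.mono fun s hs => hs k j)
  rw [integral_driftField α hum hvm hdu hdv hu hv k j]
  simp_rw [fun n => integral_driftField α (hxm n) (hym n) (hdx n) (hdy n) (hx n) (hy n) k j]
  refine ((Tendsto.sub ?_ (Tendsto.const_smul ?_ α)).sub ?_).sub ?_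
  · refine tendsto_integral_of_dominated_convergence (fun _ => (k 0 : ℝ) ^ 2 * (1 + C))
      (fun n => (((hxm n k j).const_mul _).const_mul _).aestronglyMeasurable)
      (integrable_const _) (fun n => (hx n).mono fun _ hs => norm_laplace_le hs k j) ?_
    exact hxu.mono fun s hs => ((hs k j).const_mul _).const_mul _
  · exact tendsto_integral_bilinB hxm hxm hdx hdu hx hu hx hu hx1 hu1 hxu hxu k j
  · exact tendsto_integral_bilinB hxm hym hdx hdu hx hu hy hv hy1 hv1 hxu hyv k j
  · exact tendsto_integral_bilinB hym hxm hdy hdv hy hv hx hu hx1 hu1 hyv hxu k j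

end Drift

theorem tendsto_trunc {φ : ℕ → ℕ} (hφ : StrictMono φ) (u : VField) (k : Freq) (j : Fin 2) :
    Tendsto (fun n => trunc (φ n) u k j) atTop (𝓝 (u k j)) := by
  refine tendsto_const_nhds.congr' ?_
  filter_upwards [(tendsto_box.comp hφ.tendsto_atTop).eventually_ge_atTop {k}] with n hn
  rw [trunc_apply_of_mem (hn (Finset.mem_singleton_self k))]

theorem continuousOn_trunc {S : Set ℝ} {v : ℝ → VField}
    (hvc : ∀ k j, ContinuousOn (fun s => v s k j) S) (n : ℕ) (k : Freq) (j : Fin 2) :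
    ContinuousOn (fun s => trunc n (v s) k j) S := by
  by_cases hk : k ∈ box n
  · simpa only [trunc_apply_of_mem hk] using hvc k j
  · simpa only [trunc_apply_of_notMem hk] using continuousOn_const

/-- The modulus of continuity on the right does not depend on n: the drift coefficient is bounded by
L² norms alone, and the forcing is common to all truncations. This gives the equicontinuity for
Arzelà–Ascoli. -/
theorem IsGalerkinSolution.norm_coeff_sub_le {n : ℕ} {T α : ℝ} {v f : ℝ → VField} {x₀ : VField}
    {U : ℝ → VField} {C : ℝ≥0}
    (h : IsGalerkinSolution n T α (fun _ => 1) (fun s => trunc n (v s)) f x₀ U)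
    (hv : ∀ s, IsDivFree (v s)) (hvC : ∀ s ∈ Set.Icc 0 T, anisoSq 0 0 (v s) ≤ C)
    (hC : ∀ t ∈ Set.Icc 0 T, anisoSq 0 0 (U t) ≤ C) {k : Freq} {j : Fin 2}
    (hf : IntervalIntegrable (fun s => f s k j) volume 0 T) {s t : ℝ} (hs : s ∈ Set.Icc 0 T)
    (ht : t ∈ Set.Icc 0 T) : ‖U t k j - U s k j‖ ≤
      |(driftConst α C k j * t + ∫ r in (0 : ℝ)..t, ‖f r k j‖) -
        (driftConst α C k j * s + ∫ r in (0 : ℝ)..s, ‖f r k j‖)| := by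
  wlog hst : s ≤ t generalizing s t
  · rw [norm_sub_rev, abs_sub_comm]
    exact this ht hs (le_of_not_ge hst)
  by_cases hk : k ∈ box n
  swap
  · rw [(h.isBox t).supp k hk, (h.isBox s).supp k hk]
    simp
  have hT : (0 : ℝ) ∈ Set.Icc 0 T := ⟨le_rfl, hs.1.trans hs.2⟩
  have hI := h.int k hk j
  rw [h.eq k hk j t ht, h.eq k hk j s hs, add_sub_add_left_eq_sub,
    intervalIntegral.integral_interval_sub_left (intervalIntegrable_of_mem_Icc hI hT ht)
      (intervalIntegrable_of_mem_Icc hI hT hs)]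
  have hfn : IntervalIntegrable (fun r => ‖f r k j‖) volume 0 T := hf.norm
  refine le_trans ?_ (le_abs_self _)
  have e : (driftConst α C k j * t + ∫ r in (0 : ℝ)..t, ‖f r k j‖) -
      (driftConst α C k j * s + ∫ r in (0 : ℝ)..s, ‖f r k j‖) =
      ∫ r in s..t, (driftConst α C k j + ‖f r k j‖) := by
    rw [intervalIntegral.integral_add intervalIntegrable_const
      (intervalIntegrable_of_mem_Icc hfn hs ht), intervalIntegral.integral_const,
      ← intervalIntegral.integral_interval_sub_left (intervalIntegrable_of_mem_Icc hfn hT ht)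
      (intervalIntegrable_of_mem_Icc hfn hT hs), smul_eq_mul]
    ring
  rw [e]
  refine (intervalIntegral.norm_integral_le_integral_norm hst).trans
    (intervalIntegral.integral_mono_on hst (intervalIntegrable_of_mem_Icc hI hs ht).norm
      (intervalIntegrable_const.add (intervalIntegrable_of_mem_Icc hfn hs ht)) fun r hr => ?_)
  have hr' : r ∈ Set.Icc 0 T := ⟨hs.1.trans hr.1, hr.2.trans ht.2⟩
  rw [one_smul, Pi.add_apply, Pi.add_apply]
  refine (norm_add_le _ _).trans (add_le_add ?_ le_rfl)
  exact norm_driftField_le α (h.isBox r).divFree (isDivFree_trunc (hv r) n) (hC r hr')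
    ((anisoSq_trunc_le n (v r) 0 0).trans (hvC r hr')) k j

/-- Each frequency belongs to all sufficiently large boxes, so its truncated equation eventually
holds and converges term by term. Outside [0,T] the limit is frozen at the endpoint values, which
makes its coefficients continuous on the whole line. -/
theorem exists_galerkin_limit {T α : ℝ} (hT : 0 ≤ T) {v f : ℝ → VField} {x₀ : VField}
    {U : ℕ → ℝ → VField} {C : ℝ≥0}
    (hU : ∀ n, IsGalerkinSolution n T α (fun _ => 1) (fun s => trunc n (v s)) f x₀ (U n))
    (hv : ∀ s, IsDivFree (v s)) (hvc : ∀ k j, ContinuousOn (fun s => v s k j) (Set.Icc 0 T))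
    (hvC : ∀ s ∈ Set.Icc 0 T, anisoSq 0 0 (v s) ≤ C)
    (hv1 : ∫⁻ s in Set.Icc 0 T, anisoSq 1 1 (v s) ≤ C)
    (hf : ∀ k j, IntervalIntegrable (fun s => f s k j) volume 0 T)
    (hC : ∀ n, ∀ t ∈ Set.Icc 0 T, anisoSq 0 0 (U n t) ≤ C)
    (hC1 : ∀ n, ∫⁻ s in Set.Icc 0 T, anisoSq 1 1 (U n s) ≤ C) :
    ∃ (φ : ℕ → ℕ) (X : ℝ → VField), StrictMono φ ∧ (∀ k j, Continuous fun t => X t k j) ∧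
      (∀ t, IsRealField (X t)) ∧ (∀ t, IsDivFree (X t)) ∧
      (∀ (t : ℝ) k j, Tendsto (fun n => U (φ n) (Set.projIcc 0 T hT t) k j) atTop
        (𝓝 (X t k j))) ∧
      SolvesOn T x₀ (fun s => driftField α (X s) (v s) + f s) X := by
  have hT0 : (0 : ℝ) ∈ Set.Icc 0 T := ⟨le_rfl, hT⟩
  obtain ⟨φ, Y, hφ, hYc, hY⟩ := exists_subseq_tendsto (ι := Freq × Fin 2) hT
    (z := fun n t p => U n t p.1 p.2) (fun _ => 1 + C)
    (fun n p t ht => norm_coeff_le (hC n t ht) _ _)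
    (fun p t => driftConst α C p.1 p.2 * t + ∫ r in (0 : ℝ)..t, ‖f r p.1 p.2‖)
    (fun p => (continuous_const.mul continuous_id).continuousOn.add
      (continuousOn_primitive_Icc hT (hf p.1 p.2).norm))
    (fun n p s hs t ht => (hU n).norm_coeff_sub_le hv hvC (hC n) (hf _ _) hs ht)
  set X : ℝ → VField := fun t k j => Y t (k, j) with hX
  have hXt : ∀ (t : ℝ) k j, Tendsto (fun n => U (φ n) (Set.projIcc 0 T hT t) k j) atTop
      (𝓝 (X t k j)) := fun t k j => hY (k, j) t
  have hXt' : ∀ t ∈ Set.Icc 0 T, ∀ k j, Tendsto (fun n => U (φ n) t k j) atTop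
      (𝓝 (X t k j)) := fun t ht k j => by
    have := hXt t k j
    rwa [Set.projIcc_of_mem hT ht] at this
  have hXd : ∀ t, IsDivFree (X t) := fun t k => by
    have h := tendsto_finsetSum Finset.univ fun j (_ : j ∈ Finset.univ) =>
      (hXt t k j).const_mul (k j : ℂ)
    refine tendsto_nhds_unique h ?_
    simp_rw [fun n => ((hU (φ n)).isBox (Set.projIcc 0 T hT t)).divFree k]
    exact tendsto_const_nhds
  refine ⟨φ, X, hφ, fun k j => hYc (k, j), fun t k j => ?_, hXd, hXt, fun k j => ?_⟩
  · refine tendsto_nhds_unique (hXt t (-k) j) ?_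
    simp_rw [fun n => ((hU (φ n)).isBox (Set.projIcc 0 T hT t)).real k j]
    exact (Complex.continuous_conj.tendsto _).comp (hXt t k j)
  have hmem : ∀ᵐ s ∂volume.restrict (Set.Icc 0 T), s ∈ Set.Icc 0 T :=
    ae_restrict_mem measurableSet_Icc
  have hxm : ∀ n k j, AEMeasurable (fun s => U (φ n) s k j) (volume.restrict (Set.Icc 0 T)) :=
    fun n k j => ((hU (φ n)).cont k j).aemeasurable measurableSet_Icc
  have hym : ∀ n k j, AEMeasurable (fun s => trunc (φ n) (v s) k j)
      (volume.restrict (Set.Icc 0 T)) :=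
    fun n k j => (continuousOn_trunc hvc (φ n) k j).aemeasurable measurableSet_Icc
  have hxu : ∀ᵐ s ∂volume.restrict (Set.Icc 0 T), ∀ k j,
      Tendsto (fun n => U (φ n) s k j) atTop (𝓝 (X s k j)) :=
    hmem.mono fun s hs => hXt' s hs
  have hXC : ∀ t ∈ Set.Icc 0 T, anisoSq 0 0 (X t) ≤ C := fun t ht =>
    anisoSq_le_of_tendsto (hXt' t ht) fun n => hC (φ n) t ht
  have hX1 : ∫⁻ s in Set.Icc 0 T, anisoSq 1 1 (X s) ≤ C :=
    lintegral_anisoSq_le_of_tendsto hxm hxu fun n => hC1 (φ n)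
  have hXm : ∀ k j, AEMeasurable (fun s => X s k j) (volume.restrict (Set.Icc 0 T)) :=
    fun k j => (hYc (k, j)).aemeasurable
  have hvm : ∀ k j, AEMeasurable (fun s => v s k j) (volume.restrict (Set.Icc 0 T)) :=
    fun k j => (hvc k j).aemeasurable measurableSet_Icc
  have hdI : ∀ k j, IntervalIntegrable (fun s => driftField α (X s) (v s) k j) volume 0 T :=
    fun k j => by
      rw [intervalIntegrable_iff_integrableOn_Icc_of_le hT]
      exact integrable_driftField α hXm hvm (Eventually.of_forall hXd) (Eventually.of_forall hv)
        (hmem.mono hXC) (hmem.mono hvC) k j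
  refine ⟨(hdI k j).add (hf k j), fun t ht => ?_⟩
  have hsub : Set.Icc 0 t ⊆ Set.Icc 0 T := Set.Icc_subset_Icc_right ht.2
  have hle : volume.restrict (Set.Icc 0 t) ≤ volume.restrict (Set.Icc 0 T) :=
    Measure.restrict_mono hsub le_rfl
  have hac := hle.absolutelyContinuous
  have hlim := tendsto_integral_driftField (μ := volume.restrict (Set.Icc 0 t)) α
    (fun n k j => (hxm n k j).mono_measure hle) (fun n k j => (hym n k j).mono_measure hle)
    (fun n => Eventually.of_forall fun s => ((hU (φ n)).isBox s).divFree)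
    (Eventually.of_forall hXd)
    (fun n => Eventually.of_forall fun s => isDivFree_trunc (hv s) (φ n))
    (Eventually.of_forall hv) (fun n => hac (hmem.mono (hC (φ n)))) (hac (hmem.mono hXC))
    (fun n => hac (hmem.mono fun s hs => (anisoSq_trunc_le _ _ _ _).trans (hvC s hs)))
    (hac (hmem.mono hvC)) (fun n => (lintegral_mono' hle le_rfl).trans (hC1 (φ n)))
    ((lintegral_mono' hle le_rfl).trans hX1)
    (fun n => (lintegral_mono' hle fun s => anisoSq_trunc_le _ _ _ _).trans hv1)
    ((lintegral_mono' hle le_rfl).trans hv1) (hac hxu)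
    (Eventually.of_forall fun s k j => tendsto_trunc hφ (v s) k j) k j
  have hdIt := intervalIntegrable_of_mem_Icc (hdI k j) hT0 ht
  have hfIt := intervalIntegrable_of_mem_Icc (hf k j) hT0 ht
  have hlim' : Tendsto (fun n => U (φ n) t k j) atTop
      (𝓝 (x₀ k j + ((∫ s in Set.Icc 0 t, driftField α (X s) (v s) k j) +
        ∫ s in (0 : ℝ)..t, f s k j))) := by
    refine Tendsto.congr' ?_ (tendsto_const_nhds.add (hlim.add_const _))
    filter_upwards [(tendsto_box.comp hφ.tendsto_atTop).eventually_ge_atTop {k}] with n hn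
    have hk : k ∈ box (φ n) := hn (Finset.mem_singleton_self k)
    rw [(hU (φ n)).eq k hk j t ht, integral_Icc_eq_integral_Ioc,
      ← intervalIntegral.integral_of_le ht.1, ← intervalIntegral.integral_add _ hfIt]
    · simp only [one_smul, Pi.add_apply]
    · have h := (intervalIntegrable_of_mem_Icc ((hU (φ n)).int k hk j) hT0 ht).sub hfIt
      simpa only [one_smul, Pi.add_apply, Pi.sub_apply, add_sub_cancel_right] using h
  have := tendsto_nhds_unique (hXt' t ht k j) hlim'
  rw [this, integral_Icc_eq_integral_Ioc, ← intervalIntegral.integral_of_le ht.1,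
    ← intervalIntegral.integral_add hdIt hfIt]
  rfl

/-! ### Membership in the solution class -/

theorem sobolevSq_neg_one_le (u : VField) : sobolevSq (-1) u ≤ anisoSq 0 0 u := by
  rw [anisoSq_zero_zero]
  refine ENNReal.tsum_le_tsum fun k => ?_
  refine mul_le_of_le_one_left' (ENNReal.ofReal_le_one.mpr ?_)
  exact Real.rpow_le_one_of_one_le_of_nonpos (by nlinarith [sq_nonneg (k 0 : ℝ), sq_nonneg (k 1 : ℝ)])
    (by norm_num)

/-- Continuity in H⁻¹ follows from this splitting: finitely many low frequencies are continuous in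
time, and the high ones are uniformly small by the L² bound. -/
theorem sobolevSq_neg_one_le_add (M : ℕ) (u : VField) : sobolevSq (-1) u ≤
    ∑ k ∈ box M, ampSq u k + ((M : ℝ≥0∞) + 1)⁻¹ * anisoSq 0 0 u := by
  rw [sobolevSq, anisoSq_zero_zero, ← ENNReal.sum_add_tsum_compl (box M)]
  refine add_le_add (Finset.sum_le_sum fun k _ => ?_) ?_
  · refine mul_le_of_le_one_left' (ENNReal.ofReal_le_one.mpr ?_)
    exact Real.rpow_le_one_of_one_le_of_nonpos
      (by nlinarith [sq_nonneg (k 0 : ℝ), sq_nonneg (k 1 : ℝ)]) (by norm_num)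
  · refine (ENNReal.tsum_le_tsum (g := fun k : {k // k ∉ box M} =>
      ((M : ℝ≥0∞) + 1)⁻¹ * ampSq u k) fun k => ?_).trans ?_
    · refine mul_le_mul_left ?_ _
      have h := le_one_add_of_notMem_box k.2
      have hM : (0 : ℝ) ≤ M := Nat.cast_nonneg M
      rw [Real.rpow_neg_one, ENNReal.ofReal_inv_of_pos (by positivity)]
      refine ENNReal.inv_le_inv.mpr (le_trans (le_of_eq ?_)
        (ENNReal.ofReal_le_ofReal (p := (M : ℝ) + 1) (by nlinarith)))
      rw [ENNReal.ofReal_add hM zero_le_one]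
      simp
    · rw [ENNReal.tsum_mul_left]
      gcongr
      exact ENNReal.tsum_comp_le_tsum_of_injective Subtype.val_injective _

theorem ampSq_sub_le (u v : VField) (k : Freq) :
    ampSq (u - v) k ≤ 2 * ampSq u k + 2 * ampSq v k := by
  simp only [ampSq, Finset.mul_sum, ← Finset.sum_add_distrib, Pi.sub_apply]
  refine Finset.sum_le_sum fun j _ => ?_
  rw [enorm_eq_nnnorm, enorm_eq_nnnorm, enorm_eq_nnnorm]
  norm_cast
  have h := nnnorm_sub_le (u k j) (v k j)
  have h' : (‖u k j - v k j‖₊ : ℝ) ≤ ‖u k j‖₊ + ‖v k j‖₊ := by exact_mod_cast h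
  rw [← NNReal.coe_le_coe]
  push_cast at h' ⊢
  nlinarith [norm_nonneg (u k j - v k j), sq_nonneg (‖u k j‖ - ‖v k j‖)]

theorem anisoSq_sub_le (a b : ℝ) (u v : VField) :
    anisoSq a b (u - v) ≤ 2 * anisoSq a b u + 2 * anisoSq a b v := by
  simp only [anisoSq]
  rw [← ENNReal.tsum_mul_left, ← ENNReal.tsum_mul_left, ← ENNReal.tsum_add]
  refine ENNReal.tsum_le_tsum fun k => ?_
  refine (mul_le_mul_right (ampSq_sub_le u v k) _).trans_eq ?_
  simp only [ampSq]
  ring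

theorem inSolutionClass_of_continuous {T : ℝ} {X : ℝ → VField} {C : ℝ≥0}
    (hc : ∀ k j, Continuous fun t => X t k j) (hr : ∀ t, IsRealField (X t))
    (hd : ∀ t, IsDivFree (X t)) (hC : ∀ t ∈ Set.Icc 0 T, anisoSq 0 1 (X t) ≤ C)
    (hC1 : ∫⁻ s in Set.Icc 0 T, anisoSq 1 1 (X s) ≤ C) : InSolutionClass T X := by
  have hm : ∀ k j, AEMeasurable (fun s => X s k j) (volume.restrict (Set.Icc 0 T)) :=
    fun k j => (hc k j).aemeasurable
  have hC0 : ∀ t ∈ Set.Icc 0 T, anisoSq 0 0 (X t) ≤ C := fun t ht => by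
    have h := anisoSq_mono (le_refl 0) (zero_le_one (α := ℕ)) (X t)
    simp only [Nat.cast_zero, Nat.cast_one] at h
    exact h.trans (hC t ht)
  have hmem : ∀ᵐ s ∂volume.restrict (Set.Icc 0 T), s ∈ Set.Icc 0 T :=
    ae_restrict_mem measurableSet_Icc
  refine ⟨aemeasurable_pi_iff.mpr fun k => aemeasurable_pi_iff.mpr fun j => hm k j,
    ⟨C, hmem.mono fun t ht => ⟨⟨hr t, hd t, (hC t ht).trans_lt ENNReal.coe_lt_top⟩, hC t ht⟩⟩,
    (ae_lt_top' (aemeasurable_anisoSq hm 1 1) (ne_top_of_le_ne_top ENNReal.coe_ne_top hC1)).mono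
      fun t ht => ⟨hr t, hd t, ht⟩, hC1.trans_lt ENNReal.coe_lt_top,
    fun t ht => ⟨hr t, ((sobolevSq_neg_one_le _).trans (hC0 t ht)).trans_lt ENNReal.coe_lt_top⟩,
    fun t ht => ?_⟩
  rw [ENNReal.tendsto_nhds_zero]
  intro ε hε
  have hε2 : 0 < ε / 2 := ENNReal.div_pos hε.ne' ENNReal.ofNat_ne_top
  have hlim : Tendsto (fun M : ℕ => ((M : ℝ≥0∞) + 1)⁻¹ * (2 * C + 2 * C)) atTop (𝓝 0) := by
    have h := ENNReal.Tendsto.mul_const (b := 2 * (C : ℝ≥0∞) + 2 * C)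
      ((tendsto_add_atTop_iff_nat 1).mpr ENNReal.tendsto_inv_nat_nhds_zero)
      (Or.inr (by finiteness))
    simpa only [Nat.cast_add, Nat.cast_one, zero_mul] using h
  obtain ⟨M, hM⟩ := ((tendsto_order.mp hlim).2 (ε / 2) hε2).exists
  have hfin : Tendsto (fun s => ∑ k ∈ box M, ampSq (X s - X t) k) (𝓝 t) (𝓝 0) := by
    have h : Continuous fun s => ∑ k ∈ box M, ampSq (X s - X t) k :=
      continuous_finsetSum _ fun k _ => continuous_finsetSum _ fun j _ =>
        (ENNReal.continuous_pow 2).comp ((hc k j).sub continuous_const).enorm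
    simpa [ampSq] using h.tendsto t
  filter_upwards [nhdsWithin_le_nhds ((tendsto_order.mp hfin).2 (ε / 2) hε2),
    self_mem_nhdsWithin] with s hs hsT
  calc sobolevSq (-1) (X s - X t) ≤ _ := sobolevSq_neg_one_le_add M _
    _ ≤ ε / 2 + ((M : ℝ≥0∞) + 1)⁻¹ * (2 * C + 2 * C) := by
        refine add_le_add hs.le (mul_le_mul_right ?_ _)
        · refine (anisoSq_sub_le 0 0 _ _).trans ?_
          gcongr
          · exact hC0 s hsT
          · exact hC0 t ht
    _ ≤ ε / 2 + ε / 2 := by gcongr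
    _ = ε := ENNReal.add_halves ε

/-! ### Existence for the deterministic equation -/

theorem lintegral_anisoSq_eq_ofReal {n : ℕ} {T : ℝ} (hT : 0 ≤ T) {U : ℝ → VField}
    (hU : ∀ t, ∀ k ∉ box n, U t k = 0)
    (hc : ∀ k j, ContinuousOn (fun t => U t k j) (Set.Icc 0 T)) (a b : ℕ) :
    ∫⁻ s in Set.Icc 0 T, anisoSq a b (U s) =
      ENNReal.ofReal (∫ s in (0 : ℝ)..T, boxSq n (anisoWeight a b) (U s)) := by
  rw [intervalIntegral.integral_of_le hT, ← integral_Icc_eq_integral_Ioc,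
    ofReal_integral_eq_lintegral_ofReal (continuousOn_boxSq _ hc).integrableOn_Icc
      (Eventually.of_forall fun s => boxSq_anisoWeight_nonneg n a b _)]
  exact lintegral_congr fun s => anisoSq_eq_boxSq (hU s) a b

theorem bilinB_zero_left (v : VField) : bilinB 0 v = 0 := by
  simpa using bilinB_smul_left 0 0 v

theorem bilinB_zero_right (u : VField) : bilinB u 0 = 0 := by
  simpa using bilinB_smul_right 0 u 0

theorem isRealField_zero : IsRealField 0 := fun _ _ => by simp

theorem isDivFree_zero : IsDivFree 0 := fun _ => by simp

theorem driftField_one_zero (u : VField) :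
    driftField 1 u 0 = partialDeriv 0 (partialDeriv 0 u) - bilinB u u := by
  simp [driftField, bilinB_zero_left, bilinB_zero_right]

theorem boxSq_le_toReal (n a b : ℕ) {u : VField} (hu : anisoSq a b u ≠ ∞) :
    boxSq n (anisoWeight a b) u ≤ (anisoSq a b u).toReal :=
  (ENNReal.ofReal_le_iff_le_toReal hu).mp (ofReal_boxSq_le n u a b)

/-- Existence of solutions of the deterministic equation, with the additional vertical regularity
of the initial value. -/
theorem exists_deterministicSolution {T : ℝ} (hT : 0 ≤ T) {u₀ : VField}
    (hu₀ : u₀ ∈ AnisoSpace 0 2) :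
    ∃ (u : ℝ → VField) (C : ℝ≥0), IsDeterministicSolution T u₀ u ∧
      (∀ k j, Continuous fun t => u t k j) ∧ (∀ t, IsRealField (u t)) ∧ (∀ t, IsDivFree (u t)) ∧
      (∀ t ∈ Set.Icc 0 T, anisoSq 0 2 (u t) ≤ C) ∧
      ∫⁻ s in Set.Icc 0 T, anisoSq 1 1 (u s) ≤ C := by
  obtain ⟨hr₀, hd₀, hfin⟩ := hu₀
  have hfin' : anisoSq (0 : ℕ) (2 : ℕ) u₀ ≠ ∞ := by simpa using hfin.ne
  set E : ℝ := (anisoSq (0 : ℕ) (2 : ℕ) u₀).toReal with hE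
  have hE0 : 0 ≤ E := ENNReal.toReal_nonneg
  have hE2 : ∀ n, boxSq n (anisoWeight 0 2) u₀ ≤ E := fun n => boxSq_le_toReal n 0 2 hfin'
  have hE1 : ∀ n, boxSq n (anisoWeight 0 1) u₀ ≤ E := fun n =>
    (boxSq_anisoWeight_mono le_rfl one_le_two u₀).trans (hE2 n)
  have hex : ∀ n, ∃ U, IsGalerkinSolution n T 1 (fun _ => 1) (fun _ => 0) (fun _ => 0) u₀ U := by
    intro n
    have h0 : trunc n (0 : VField) = 0 := by funext k j; simp [trunc]
    have h := exists_isGalerkinSolution n hT 1 (v := fun _ => 0) (f := fun _ => 0) hr₀ hd₀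
      (fun _ => isRealField_zero) (fun _ => isDivFree_zero) (fun _ _ => continuousOn_const)
      (fun _ => isRealField_zero) (fun _ => isDivFree_zero)
      (fun _ _ _ => intervalIntegrable_const) (r := fun _ => 0) (fun _ => le_rfl)
      intervalIntegrable_const (fun _ => by simp [boxSq_zero])
    simpa only [h0] using h
  choose U hU using hex
  obtain ⟨N, hN⟩ := exists_nat_ge (2 * (205 * E + 6 * T))
  have h1 : ∀ n, ∀ t ∈ Set.Icc 0 T, boxSq n (anisoWeight 0 1) (U n t) +
      ∫ s in (0 : ℝ)..t, boxSq n (anisoWeight 1 1) (U n s) ≤ 3 * E * 2 ^ N := fun n t ht =>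
    (hU n).nonlinear_energy_one (hE1 n) (by linarith) ht
  have hI0 : ∀ n t, 0 ≤ t → 0 ≤ ∫ s in (0 : ℝ)..t, boxSq n (anisoWeight 1 1) (U n s) :=
    fun n t ht => intervalIntegral.integral_nonneg ht fun s _ => boxSq_anisoWeight_nonneg n 1 1 _
  have h11 : ∀ n, ∫ s in (0 : ℝ)..T, boxSq n (anisoWeight 1 1) (U n s) ≤ 3 * E * 2 ^ N :=
    fun n => by
      have := h1 n T ⟨hT, le_rfl⟩
      have := boxSq_anisoWeight_nonneg n 0 1 (U n T)
      linarith
  -- The H^{0,2} estimate uses the time integral of the H^{1,1} norm just bounded by the H^{0,1}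
  -- estimate, uniformly in n.
  obtain ⟨N', hN'⟩ := exists_nat_ge (2 * (2 * T + 32400 * (3 * E * 2 ^ N)))
  have h2 : ∀ n, ∀ t ∈ Set.Icc 0 T, boxSq n (anisoWeight 0 2) (U n t) ≤ E * 2 ^ N' :=
    fun n t ht => ((hU n).nonlinear_energy_two (N := N')
      (by linarith [h11 n]) ht).trans (by gcongr; exact hE2 n)
  set C : ℝ≥0 := Real.toNNReal (max (3 * E * 2 ^ N) (E * 2 ^ N')) with hCdef
  have hCle : ∀ x : ℝ, x ≤ max (3 * E * 2 ^ N) (E * 2 ^ N') → ENNReal.ofReal x ≤ C := fun x hx =>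
    ENNReal.ofReal_le_ofReal hx
  have hB2 : ∀ n, ∀ t ∈ Set.Icc 0 T, anisoSq 0 2 (U n t) ≤ C := fun n t ht => by
    have e := anisoSq_eq_boxSq ((hU n).isBox t).supp 0 2
    simp only [Nat.cast_zero, Nat.cast_ofNat] at e
    rw [e]
    exact hCle _ ((h2 n t ht).trans (le_max_right _ _))
  have hB11 : ∀ n, ∫⁻ s in Set.Icc 0 T, anisoSq 1 1 (U n s) ≤ C := fun n => by
    have e := lintegral_anisoSq_eq_ofReal hT (fun t => ((hU n).isBox t).supp) (hU n).cont 1 1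
    simp only [Nat.cast_one] at e
    rw [e]
    exact hCle _ ((h11 n).trans (le_max_left _ _))
  have hmono : ∀ (a : ℕ), a ≤ 2 → ∀ w : VField, anisoSq 0 a w ≤ anisoSq 0 2 w := fun a ha w => by
    simpa using anisoSq_mono (le_refl 0) ha w
  obtain ⟨φ, X, hφ, hXc, hXr, hXd, hX, hsol⟩ := exists_galerkin_limit hT (v := fun _ => 0)
    (f := fun _ => 0) (x₀ := u₀) (U := U) (α := 1) (C := C)
    (fun n => by
      have h0 : trunc n (0 : VField) = 0 := by funext k j; simp [trunc]
      simpa only [h0] using hU n)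
    (fun _ => isDivFree_zero) (fun _ _ => continuousOn_const) (fun _ _ => by simp [anisoSq])
    (by simp [anisoSq]) (fun _ _ => intervalIntegrable_const)
    (fun n t ht => by simpa using (hmono 0 (by norm_num) _).trans (hB2 n t ht)) hB11
  have hX' : ∀ t ∈ Set.Icc 0 T, ∀ k j, Tendsto (fun n => U (φ n) t k j) atTop (𝓝 (X t k j)) :=
    fun t ht k j => by
      have := hX t k j
      rwa [Set.projIcc_of_mem hT ht] at this
  have hXB2 : ∀ t ∈ Set.Icc 0 T, anisoSq 0 2 (X t) ≤ C := fun t ht =>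
    anisoSq_le_of_tendsto (hX' t ht) fun n => hB2 (φ n) t ht
  have hXB11 : ∫⁻ s in Set.Icc 0 T, anisoSq 1 1 (X s) ≤ C :=
    lintegral_anisoSq_le_of_tendsto
      (fun n k j => ((hU (φ n)).cont k j).aemeasurable measurableSet_Icc)
      ((ae_restrict_mem measurableSet_Icc).mono hX') fun n => hB11 (φ n)
  refine ⟨X, C, ⟨inSolutionClass_of_continuous hXc hXr hXd (fun t ht => ?_) hXB11, ?_⟩, hXc, hXr,
    hXd, hXB2, hXB11⟩
  · simpa using (hmono 1 (by norm_num) _).trans (hXB2 t ht)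
  · simpa only [driftField_one_zero, add_zero] using hsol

/-! ### Uniqueness -/

theorem tendsto_boxSq (a b : ℕ) {u : VField} (hu : anisoSq a b u ≠ ∞) :
    Tendsto (fun n => boxSq n (anisoWeight a b) u) atTop (𝓝 (anisoSq a b u).toReal) := by
  have h : Tendsto (fun n => ENNReal.ofReal (boxSq n (anisoWeight a b) u)) atTop
      (𝓝 (anisoSq a b u)) := by
    simp_rw [ofReal_boxSq, anisoSq_natCast]
    exact ENNReal.summable.hasSum.comp tendsto_box
  have h' := (ENNReal.tendsto_toReal hu).comp h
  simpa only [Function.comp_def, ENNReal.toReal_ofReal (boxSq_anisoWeight_nonneg _ a b u)] using h'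

theorem boxPairing_eq_re_sum (n : ℕ) (F : VField) {w : VField} (hw : IsRealField w) :
    boxPairing n (anisoWeight 0 0) F w = (∑ k ∈ box n, ∑ j, F k j * w (-k) j).re := by
  simp [boxPairing, anisoWeight, hw _ _, Complex.re_sum]

theorem tendsto_boxPairing_bilinB {u v w : VField} (h : triAbs u v w ≠ ∞) (hr : IsRealField w)
    (hd : IsDivFree w) :
    Tendsto (fun n => boxPairing n (anisoWeight 0 0) (bilinB u v) w) atTop
      (𝓝 (tri u v w).re) := by
  simp_rw [boxPairing_eq_re_sum _ _ hr, bilinB, sum_leray_mul hd]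
  exact (Complex.continuous_re.tendsto _).comp ((hasSum_advection h).comp tendsto_box)

theorem abs_boxPairing_bilinB_le (n : ℕ) {u v w : VField} (h : triAbs u v w ≠ ∞)
    (hr : IsRealField w) (hd : IsDivFree w) :
    |boxPairing n (anisoWeight 0 0) (bilinB u v) w| ≤ (triAbs u v w).toReal := by
  simp_rw [boxPairing_eq_re_sum _ _ hr, bilinB, sum_leray_mul hd]
  refine (Complex.abs_re_le_norm _).trans ?_
  rw [← toReal_enorm]
  refine ENNReal.toReal_mono h ((enorm_sum_le _ _).trans ((ENNReal.sum_le_tsum _).trans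
    (tsum_enorm_advection_le h)))

theorem anisoNorm_mul_le (a b c d : ℕ) (u v : VField) :
    anisoNorm a b u * anisoNorm c d v ≤ anisoSq a b u + anisoSq c d v := by
  rw [← anisoNorm_sq a b, ← anisoNorm_sq c d]
  simpa using mul_le_inv_mul_sq_add (anisoNorm a b u) (anisoNorm c d v) 1 one_ne_zero

theorem anisoNorm_le_of_anisoSq_le {a b : ℕ} {u : VField} {C : ℝ≥0}
    (h : anisoSq a b u ≤ C) : anisoNorm a b u ≤ 1 + C := by
  have h1 := anisoNorm_mul_le a b a b u u
  rcases le_total (anisoNorm a b u) 1 with h2 | h2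
  · exact h2.trans le_self_add
  · calc anisoNorm a b u ≤ anisoNorm a b u * anisoNorm a b u := le_mul_of_one_le_left' h2
      _ = anisoSq a b u := by rw [← sq, anisoNorm_sq]
      _ ≤ 1 + C := h.trans le_add_self

theorem triAbs_middle_le_add {w : VField} (hw : IsDivFree w) (u : VField) {C : ℝ≥0}
    (hC : anisoSq 0 1 w ≤ C) :
    triAbs w u w ≤ 36 * ((1 + C) * (anisoSq 1 1 w + anisoSq 1 1 u)) := by
  refine (triAbs_middle_le hw u).trans ?_
  rw [mul_assoc (anisoNorm 0 0 w)]
  have h0 : anisoNorm 0 0 w ≤ 1 + C := by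
    refine (anisoNorm_mono le_rfl zero_le_one w).trans (anisoNorm_le_of_anisoSq_le ?_)
    simpa using hC
  have h1 := anisoNorm_mul_le 1 1 1 1 w u
  simp only [Nat.cast_one] at h1
  gcongr
  exact (mul_le_mul_left (anisoNorm_mono le_rfl zero_le_one w) _).trans h1

theorem triAbs_advect_le_add (b w : VField) {C : ℝ≥0} (hC : anisoSq 0 1 w ≤ C) :
    triAbs b w w ≤ 36 * ((1 + C) * (anisoSq 1 1 b + anisoSq 1 1 w)) := by
  refine (triAbs_advect_le b w).trans ?_
  rw [mul_comm _ (anisoNorm 0 1 w)]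
  have h0 : anisoNorm 0 1 w ≤ 1 + C := by
    refine anisoNorm_le_of_anisoSq_le ?_
    simpa using hC
  have h1 := anisoNorm_mul_le 1 1 1 1 b w
  simp only [Nat.cast_one] at h1
  gcongr

/-- The energy estimate for the difference of two solutions. -/
theorem energy_difference_le {w a : VField} (hd : IsDivFree w) (hw : anisoSq 1 1 w ≠ ∞)
    (ha : anisoSq 1 1 a ≠ ∞) :
    2 * (-((anisoSq 1 0 w).toReal - (anisoSq 0 0 w).toReal) - (tri w a w).re) ≤
      (2 + 648 * (anisoSq 1 1 a).toReal) * (anisoSq 0 0 w).toReal := by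
  have hw10 : anisoSq 1 0 w ≠ ∞ := by
    have h := anisoSq_mono (le_refl 1) (zero_le_one (α := ℕ)) w
    simp only [Nat.cast_zero, Nat.cast_one] at h
    exact ne_top_of_le_ne_top hw h
  have hw00 : anisoSq 0 0 w ≠ ∞ := by
    have h := anisoSq_mono (zero_le_one (α := ℕ)) (le_refl 0) w
    simp only [Nat.cast_zero, Nat.cast_one] at h
    exact ne_top_of_le_ne_top hw10 h
  have hsq : ∀ (m n : ℕ) (u : VField), (anisoNorm m n u).toReal ^ 2 = (anisoSq m n u).toReal :=
    fun m n u => by rw [← anisoNorm_sq, ENNReal.toReal_pow]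
  have h := ENNReal.toReal_mono (by
    have h0 := anisoNorm_ne_top (m := 0) (n := 0) (by simpa using hw00)
    have h1 := anisoNorm_ne_top (m := 1) (n := 0) (by simpa using hw10)
    have h2 := anisoNorm_ne_top (m := 1) (n := 1) (by simpa using ha)
    finiteness) ((enorm_tri_le w a w).trans (triAbs_middle_le hd a))
  rw [toReal_enorm, ENNReal.toReal_mul, ENNReal.toReal_mul, ENNReal.toReal_mul,
    ENNReal.toReal_ofNat] at h
  have e0 := hsq 0 0 w
  have e1 := hsq 1 0 w
  have e2 := hsq 1 1 a
  simp only [Nat.cast_zero, Nat.cast_one] at e0 e1 e2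
  rw [← e0, ← e1, ← e2]
  have hre := (abs_le.mp (Complex.abs_re_le_norm (tri w a w))).1
  nlinarith [sq_nonneg ((anisoNorm 1 0 w).toReal -
    18 * ((anisoNorm 0 0 w).toReal * (anisoNorm 1 1 a).toReal))]

/-- The full L² energy identity is obtained as the limit of the identities on boxes, which hold at
every t because they use the equations of finitely many coefficients. Therefore the conclusion also
holds at every t, although w has its regularity only almost everywhere. -/
theorem eq_zero_of_solvesOn {T : ℝ} (hT : 0 ≤ T) {w a b : ℝ → VField} {C : ℝ≥0}
    (ham : ∀ k j, AEMeasurable (fun s => a s k j) (volume.restrict (Set.Icc 0 T)))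
    (hbm : ∀ k j, AEMeasurable (fun s => b s k j) (volume.restrict (Set.Icc 0 T)))
    (hwm : ∀ k j, AEMeasurable (fun s => w s k j) (volume.restrict (Set.Icc 0 T)))
    (hw : ∀ᵐ s ∂volume.restrict (Set.Icc 0 T),
      IsRealField (w s) ∧ IsDivFree (w s) ∧ anisoSq 0 1 (w s) ≤ C)
    (hb : ∀ᵐ s ∂volume.restrict (Set.Icc 0 T), IsDivFree (b s))
    (hw1 : ∫⁻ s in Set.Icc 0 T, anisoSq 1 1 (w s) ≠ ∞)
    (ha1 : ∫⁻ s in Set.Icc 0 T, anisoSq 1 1 (a s) ≠ ∞)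
    (hb1 : ∫⁻ s in Set.Icc 0 T, anisoSq 1 1 (b s) ≠ ∞)
    (hsol : SolvesOn T 0 (fun s => partialDeriv 0 (partialDeriv 0 (w s)) -
      bilinB (w s) (a s) - bilinB (b s) (w s)) w) :
    ∀ t ∈ Set.Icc 0 T, w t = 0 := by
  set G : ℝ → VField := fun s => partialDeriv 0 (partialDeriv 0 (w s)) -
    bilinB (w s) (a s) - bilinB (b s) (w s) with hG
  -- A common dominating function for the box pairings: the dissipation and the absolute forms of
  -- the two trilinear terms.
  set D : ℝ → ℝ≥0∞ := fun s => anisoSq 1 1 (w s) +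
    36 * ((1 + C) * (anisoSq 1 1 (w s) + anisoSq 1 1 (a s))) +
    36 * ((1 + C) * (anisoSq 1 1 (b s) + anisoSq 1 1 (w s))) with hD
  have hwm1 := aemeasurable_anisoSq hwm 1 1
  have ham1 := aemeasurable_anisoSq ham 1 1
  have hbm1 := aemeasurable_anisoSq hbm 1 1
  have hDm : AEMeasurable D (volume.restrict (Set.Icc 0 T)) :=
    (hwm1.add (((hwm1.add ham1).const_mul _).const_mul _)).add
      (((hbm1.add hwm1).const_mul _).const_mul _)
  have hadd : ∀ {f g : ℝ → ℝ≥0∞}, AEMeasurable f (volume.restrict (Set.Icc 0 T)) →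
      ∫⁻ s in Set.Icc 0 T, f s ≠ ∞ → ∫⁻ s in Set.Icc 0 T, g s ≠ ∞ →
      ∫⁻ s in Set.Icc 0 T, (f s + g s) ≠ ∞ := fun hf h1 h2 => by
    rw [lintegral_add_left' hf]
    exact ENNReal.add_ne_top.mpr ⟨h1, h2⟩
  have hmul : ∀ {f : ℝ → ℝ≥0∞}, ∫⁻ s in Set.Icc 0 T, f s ≠ ∞ →
      ∫⁻ s in Set.Icc 0 T, 36 * ((1 + C) * f s) ≠ ∞ := fun h => by
    rw [lintegral_const_mul' _ _ (by finiteness), lintegral_const_mul' _ _ (by finiteness)]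
    finiteness
  have hDi : ∫⁻ s in Set.Icc 0 T, D s ≠ ∞ :=
    hadd (hwm1.add (((hwm1.add ham1).const_mul _).const_mul _))
      (hadd hwm1 hw1 (hmul (hadd hwm1 hw1 ha1))) (hmul (hadd hbm1 hb1 hw1))
  have hDr : IntervalIntegrable (fun s => (D s).toReal) volume 0 T := by
    rw [intervalIntegrable_iff_integrableOn_Icc_of_le hT]
    exact integrable_toReal_of_lintegral_ne_top hDm hDi
  set P : ℝ → ℝ := fun s => -((anisoSq 1 0 (w s)).toReal - (anisoSq 0 0 (w s)).toReal) -
    (tri (w s) (a s) (w s)).re with hP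
  set Q : ℕ → ℝ → ℝ := fun n s => boxPairing n (anisoWeight 0 0) (G s) (w s) with hQ
  have hgood : ∀ᵐ s ∂volume.restrict (Set.Icc 0 T), IsRealField (w s) ∧ IsDivFree (w s) ∧
      anisoSq 0 1 (w s) ≤ C ∧ IsDivFree (b s) ∧ anisoSq 1 1 (w s) ≠ ∞ ∧
      anisoSq 1 1 (a s) ≠ ∞ ∧ anisoSq 1 1 (b s) ≠ ∞ := by
    filter_upwards [hw, hb, ae_lt_top' hwm1 hw1, ae_lt_top' ham1 ha1, ae_lt_top' hbm1 hb1]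
      with s h1 h2 h3 h4 h5
    exact ⟨h1.1, h1.2.1, h1.2.2, h2, h3.ne, h4.ne, h5.ne⟩
  have hQe : ∀ n s, Q n s = -(boxSq n (anisoWeight 1 0) (w s) - boxSq n (anisoWeight 0 0) (w s)) -
      boxPairing n (anisoWeight 0 0) (bilinB (w s) (a s)) (w s) -
      boxPairing n (anisoWeight 0 0) (bilinB (b s) (w s)) (w s) := fun n s => by
    simp only [hQ, hG, boxPairing_sub, boxPairing_laplace, boxSq_horizontal]
  have hlow : ∀ s, anisoSq 1 1 (w s) ≠ ∞ → anisoSq (1 : ℕ) (0 : ℕ) (w s) ≠ ∞ ∧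
      anisoSq (0 : ℕ) (0 : ℕ) (w s) ≠ ∞ := fun s hs => by
    have h1 := anisoSq_mono (le_refl 1) (zero_le_one (α := ℕ)) (w s)
    have h2 := anisoSq_mono (zero_le_one (α := ℕ)) (zero_le_one (α := ℕ)) (w s)
    rw [Nat.cast_one] at h1 h2 ⊢
    exact ⟨ne_top_of_le_ne_top hs h1, ne_top_of_le_ne_top hs h2⟩
  have hQlim : ∀ᵐ s ∂volume.restrict (Set.Icc 0 T),
      Tendsto (fun n => Q n s) atTop (𝓝 (P s)) := by
    filter_upwards [hgood] with s ⟨hr, hd, hC, hbd, hws, has, hbs⟩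
    simp_rw [hQe]
    have h1 := tendsto_boxSq 1 0 (hlow s hws).1
    have h2 := tendsto_boxSq 0 0 (hlow s hws).2
    have h3 := tendsto_boxPairing_bilinB (triAbs_ne_top hws has hws) hr hd
    have h4 := tendsto_boxPairing_bilinB (triAbs_ne_top hbs hws hws) hr hd
    rw [tri_self hbd] at h4
    simpa [hP] using (((h1.sub h2).neg).sub h3).sub h4
  have hQb : ∀ n, ∀ᵐ s ∂volume.restrict (Set.Icc 0 T), ‖Q n s‖ ≤ (D s).toReal := fun n => by
    filter_upwards [hgood] with s ⟨hr, hd, hC, hbd, hws, has, hbs⟩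
    have h1 := abs_boxPairing_bilinB_le n (triAbs_ne_top hws has hws) hr hd
    have h2 := abs_boxPairing_bilinB_le n (triAbs_ne_top hbs hws hws) hr hd
    have h3 := ENNReal.toReal_mono (by finiteness) (triAbs_middle_le_add hd (a s) hC)
    have h4 := ENNReal.toReal_mono (by finiteness) (triAbs_advect_le_add (b s) (w s) hC)
    have h5 : boxSq n (anisoWeight 1 0) (w s) ≤ (anisoSq 1 1 (w s)).toReal := by
      have := boxSq_le_toReal n 1 1 (u := w s) (by simpa using hws)
      rw [Nat.cast_one] at this
      exact (boxSq_anisoWeight_mono le_rfl zero_le_one (w s)).trans this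
    have h6 : boxSq n (anisoWeight 0 0) (w s) ≤ boxSq n (anisoWeight 1 0) (w s) :=
      boxSq_anisoWeight_mono zero_le_one le_rfl (w s)
    have h7 := boxSq_anisoWeight_nonneg n 0 0 (w s)
    have hDs : (D s).toReal = (anisoSq 1 1 (w s)).toReal +
        (36 * ((1 + C) * (anisoSq 1 1 (w s) + anisoSq 1 1 (a s)))).toReal +
        (36 * ((1 + C) * (anisoSq 1 1 (b s) + anisoSq 1 1 (w s)))).toReal := by
      rw [hD, ENNReal.toReal_add (by finiteness) (by finiteness),
        ENNReal.toReal_add (by finiteness) (by finiteness)]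
    rw [hQe, hDs, Real.norm_eq_abs, abs_le]
    have h1' := abs_le.mp h1
    have h2' := abs_le.mp h2
    constructor <;> linarith
  have hE : ∀ n, ∀ t ∈ Set.Icc 0 T, IntervalIntegrable (Q n) volume 0 t ∧
      boxSq n (anisoWeight 0 0) (w t) = 2 * ∫ s in (0 : ℝ)..t, Q n s := fun n t ht => by
    have h := energy_identity n (anisoWeight 0 0) (fun k _ j => (hsol k j).1)
      (fun k _ j => (hsol k j).2) ht
    rw [boxSq_zero, zero_add] at h
    exact h
  have hPI : IntervalIntegrable P volume 0 T := by
    have hQm : ∀ n, AEStronglyMeasurable (Q n) (volume.restrict (Set.Icc 0 T)) := fun n => by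
      have h := (hE n T ⟨hT, le_rfl⟩).1
      rw [intervalIntegrable_iff_integrableOn_Icc_of_le hT] at h
      exact h.aestronglyMeasurable
    rw [intervalIntegrable_iff_integrableOn_Icc_of_le hT] at hDr ⊢
    refine Integrable.mono' hDr (aestronglyMeasurable_of_tendsto_ae atTop hQm hQlim) ?_
    filter_upwards [ae_all_iff.mpr hQb, hQlim] with s h1 h2
    exact le_of_tendsto' h2.norm h1
  have hElim : ∀ t ∈ Set.Icc 0 T, Tendsto (fun n => boxSq n (anisoWeight 0 0) (w t)) atTop
      (𝓝 (2 * ∫ s in (0 : ℝ)..t, P s)) := fun t ht => by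
    simp_rw [fun n => (hE n t ht).2]
    have hsub : Set.uIoc 0 t ⊆ Set.Icc 0 T := by
      rw [Set.uIoc_of_le ht.1]
      exact Set.Ioc_subset_Icc_self.trans (Set.Icc_subset_Icc_right ht.2)
    have hres : ∀ {p : ℝ → Prop}, (∀ᵐ s ∂volume.restrict (Set.Icc 0 T), p s) →
        ∀ᵐ s, s ∈ Set.uIoc 0 t → p s := fun {p} h =>
      ((ae_restrict_iff' measurableSet_Icc).mp h).mono fun s hs hst => hs (hsub hst)
    refine (intervalIntegral.tendsto_integral_filter_of_dominated_convergence
      (fun s => (D s).toReal) ?_ (Eventually.of_forall fun n => hres (hQb n))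
      (intervalIntegrable_of_mem_Icc hDr ⟨le_rfl, hT⟩ ht) (hres hQlim)).const_mul 2
    refine Eventually.of_forall fun n => ?_
    have h := (hE n t ht).1.aestronglyMeasurable
    rwa [Set.uIoc_of_le ht.1]
  -- On [0,T] this is the energy itself; the absolute value only makes it nonnegative elsewhere, as
  -- `gronwall_halving` asks.
  set e : ℝ → ℝ := fun t => |2 * ∫ s in (0 : ℝ)..t, P s| with he
  have heq : ∀ t ∈ Set.Icc 0 T, e t = 2 * ∫ s in (0 : ℝ)..t, P s := fun t ht =>
    abs_of_nonneg (ge_of_tendsto' (hElim t ht) fun n => boxSq_anisoWeight_nonneg n 0 0 _)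
  set h : ℝ → ℝ := fun s => 2 + 648 * (anisoSq 1 1 (a s)).toReal with hh
  have hhI : IntervalIntegrable h volume 0 T := by
    refine intervalIntegrable_const.add (IntervalIntegrable.const_mul ?_ _)
    rw [intervalIntegrable_iff_integrableOn_Icc_of_le hT]
    exact integrable_toReal_of_lintegral_ne_top ham1 ha1
  have hec : ContinuousOn e (Set.Icc 0 T) :=
    ((continuousOn_primitive_Icc hT hPI).const_smul (2 : ℝ)).abs
  have hhe : IntervalIntegrable (fun s => h s * e s) volume 0 T :=
    hhI.mul_continuousOn (by rwa [Set.uIcc_of_le hT])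
  have hPle : ∀ᵐ s ∂volume.restrict (Set.Icc 0 T), 2 * P s ≤ h s * e s := by
    filter_upwards [hgood, ae_restrict_mem measurableSet_Icc]
      with s ⟨hr, hd, hC, hbd, hws, has, hbs⟩ hs
    -- At almost every s the limit of the box energies is the L² norm of w(s), so the pointwise
    -- energy estimate becomes an inequality for e.
    have h1 := tendsto_nhds_unique (hElim s hs) (tendsto_boxSq 0 0 (hlow s hws).2)
    have h2 := energy_difference_le hd hws has
    rw [Nat.cast_zero] at h1
    rw [heq s hs, h1]
    exact h2
  have hgr : ∀ t ∈ Set.Icc 0 T, e t ≤ 0 + ∫ s in (0 : ℝ)..t, h s * e s := fun t ht => by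
    have h0 : (0 : ℝ) ∈ Set.Icc 0 T := ⟨le_rfl, hT⟩
    rw [heq t ht, ← intervalIntegral.integral_const_mul, zero_add]
    refine intervalIntegral.integral_mono_ae_restrict ht.1
      ((intervalIntegrable_of_mem_Icc hPI h0 ht).const_mul 2)
      (intervalIntegrable_of_mem_Icc hhe h0 ht)
      (ae_mono (Measure.restrict_mono (Set.Icc_subset_Icc_right ht.2) le_rfl) hPle)
  obtain ⟨N, hN⟩ := exists_nat_ge (2 * ∫ s in (0 : ℝ)..T, h s)
  have hfin := gronwall_halving le_rfl hhI (fun s => by positivity) (fun s => abs_nonneg _) hhe hgr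
    N (by linarith)
  intro t ht
  have hzero : e t = 0 := le_antisymm ((hgr t ht).trans
    (by have h1 := hfin t ht; rwa [zero_mul] at h1)) (abs_nonneg _)
  have hlim0 := hElim t ht
  rw [← heq t ht, hzero] at hlim0
  have hmono : Monotone fun n => boxSq n (anisoWeight 0 0) (w t) := fun m n hmn =>
    Finset.sum_le_sum_of_subset_of_nonneg (box_mono hmn) fun k _ _ =>
      mul_nonneg (anisoWeight_pos 0 0 k).le (Finset.sum_nonneg fun _ _ => by positivity)
  have hS : anisoSq (0 : ℕ) (0 : ℕ) (w t) = 0 := by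
    have h1 : Tendsto (fun n => ENNReal.ofReal (boxSq n (anisoWeight 0 0) (w t))) atTop
        (𝓝 (anisoSq (0 : ℕ) (0 : ℕ) (w t))) := by
      simp_rw [ofReal_boxSq, anisoSq_natCast]
      exact ENNReal.summable.hasSum.comp tendsto_box
    refine tendsto_nhds_unique h1 ?_
    simpa using ENNReal.tendsto_ofReal hlim0
  rw [Nat.cast_zero, anisoSq_zero_zero, ENNReal.tsum_eq_zero] at hS
  funext k j
  have h1 := (enorm_sq_le_ampSq (w t) k j).trans_eq (hS k)
  simpa using h1

theorem partialDeriv_sub (i : Fin 2) (u v : VField) :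
    partialDeriv i (u - v) = partialDeriv i u - partialDeriv i v := by
  funext k j
  simp [partialDeriv, mul_sub]

theorem isRealField_sub {u v : VField} (hu : IsRealField u) (hv : IsRealField v) :
    IsRealField (u - v) := fun k j => by simp [hu k j, hv k j]

theorem isDivFree_sub {u v : VField} (hu : IsDivFree u) (hv : IsDivFree v) :
    IsDivFree (u - v) := fun k => by
  have h1 := hu k
  have h2 := hv k
  simp only [Pi.sub_apply, Fin.sum_univ_two] at h1 h2 ⊢
  linear_combination h1 - h2

theorem bilinB_sub_left {u u' v : VField} (hd : IsDivFree u) (hd' : IsDivFree u')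
    (hu : anisoSq 0 0 u ≠ ∞) (hu' : anisoSq 0 0 u' ≠ ∞) (hv : anisoSq 0 0 v ≠ ∞) :
    bilinB (u - u') v = bilinB u v - bilinB u' v := by
  simp only [bilinB]
  rw [← leray_sub]
  congr 1
  funext k j
  simp only [advection, Pi.sub_apply]
  rw [← (summable_advection hd hu hv k j).tsum_sub (summable_advection hd' hu' hv k j)]
  refine tsum_congr fun l => ?_
  rw [← Finset.sum_sub_distrib]
  exact Finset.sum_congr rfl fun i _ => by ring

theorem bilinB_sub_right {u v v' : VField} (hd : IsDivFree u) (hu : anisoSq 0 0 u ≠ ∞)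
    (hv : anisoSq 0 0 v ≠ ∞) (hv' : anisoSq 0 0 v' ≠ ∞) :
    bilinB u (v - v') = bilinB u v - bilinB u v' := by
  simp only [bilinB]
  rw [← leray_sub]
  congr 1
  funext k j
  simp only [advection, partialDeriv_sub, Pi.sub_apply]
  rw [← (summable_advection hd hu hv k j).tsum_sub (summable_advection hd hu hv' k j)]
  refine tsum_congr fun l => ?_
  rw [← Finset.sum_sub_distrib]
  exact Finset.sum_congr rfl fun i _ => by ring

theorem SolvesOn.sub {T : ℝ} {x₀ y₀ : VField} {F G X Y : ℝ → VField} (hX : SolvesOn T x₀ F X)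
    (hY : SolvesOn T y₀ G Y) : SolvesOn T (x₀ - y₀) (F - G) (X - Y) := fun k j => by
  refine ⟨(hX k j).1.sub (hY k j).1, fun t ht => ?_⟩
  have h0 : (0 : ℝ) ∈ Set.Icc 0 T := ⟨le_rfl, ht.1.trans ht.2⟩
  have h := intervalIntegral.integral_sub (intervalIntegrable_of_mem_Icc (hX k j).1 h0 ht)
    (intervalIntegrable_of_mem_Icc (hY k j).1 h0 ht)
  simp only [Pi.sub_apply, (hX k j).2 t ht, (hY k j).2 t ht, h]
  ring

theorem SolvesOn.congr_ae {T : ℝ} (hT : 0 ≤ T) {x₀ : VField} {F G X : ℝ → VField}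
    (hX : SolvesOn T x₀ F X) (hFG : ∀ᵐ s ∂volume.restrict (Set.Icc 0 T), F s = G s) :
    SolvesOn T x₀ G X := fun k j => by
  have hsub : ∀ t ∈ Set.Icc 0 T, Set.uIoc 0 t ⊆ Set.Icc 0 T := fun t ht => by
    rw [Set.uIoc_of_le ht.1]
    exact Set.Ioc_subset_Icc_self.trans (Set.Icc_subset_Icc_right ht.2)
  refine ⟨(hX k j).1.congr_ae (ae_mono (Measure.restrict_mono (hsub T ⟨hT, le_rfl⟩) le_rfl)
    (hFG.mono fun s hs => congrFun (congrFun hs k) j)), fun t ht => ?_⟩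
  rw [(hX k j).2 t ht]
  congr 1
  refine intervalIntegral.integral_congr_ae ?_
  exact ((ae_restrict_iff' measurableSet_Icc).mp hFG).mono fun s hs hst => by
    rw [hs (hsub t ht hst)]

theorem InSolutionClass.aemeasurable_coeff {T : ℝ} {X : ℝ → VField} (h : InSolutionClass T X)
    (k : Freq) (j : Fin 2) :
    AEMeasurable (fun s => X s k j) (volume.restrict (Set.Icc 0 T)) :=
  aemeasurable_pi_iff.mp (aemeasurable_pi_iff.mp h.aemeasurable k) j

theorem anisoSq_zero_zero_le_one (u : VField) : anisoSq 0 0 u ≤ anisoSq 0 1 u := by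
  simpa using anisoSq_mono (le_refl 0) (zero_le_one (α := ℕ)) u

/-- Uniqueness for the equations of the solution class whose differences solve a linear
advection equation. -/
theorem InSolutionClass.eqOn_of_sub {T : ℝ} (hT : 0 ≤ T) {x₀ : VField} {X Y a b F G : ℝ → VField}
    (hX : InSolutionClass T X) (hY : InSolutionClass T Y) (ha : InSolutionClass T a)
    (hb : InSolutionClass T b) (hXs : SolvesOn T x₀ F X) (hYs : SolvesOn T x₀ G Y)
    (hFG : ∀ᵐ s ∂volume.restrict (Set.Icc 0 T), F s - G s =
      partialDeriv 0 (partialDeriv 0 (X s - Y s)) - bilinB (X s - Y s) (a s) -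
        bilinB (b s) (X s - Y s)) :
    Set.EqOn X Y (Set.Icc 0 T) := by
  obtain ⟨C, hC⟩ := hX.memLinfty
  obtain ⟨C', hC'⟩ := hY.memLinfty
  have hXY := hXs.sub hYs
  rw [sub_self] at hXY
  have h := eq_zero_of_solvesOn (C := 2 * C + 2 * C') hT ha.aemeasurable_coeff
    hb.aemeasurable_coeff
    (w := X - Y) (fun k j => (hX.aemeasurable_coeff k j).sub (hY.aemeasurable_coeff k j)) ?_
    (hb.memL2.mono fun s hs => hs.2.1) ?_ ha.memL2_norm.ne hb.memL2_norm.ne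
    (hXY.congr_ae hT (hFG.mono fun s hs => hs))
  · exact fun t ht => sub_eq_zero.mp (h t ht)
  · filter_upwards [hC, hC'] with s h1 h2
    refine ⟨isRealField_sub h1.1.1 h2.1.1, isDivFree_sub h1.1.2.1 h2.1.2.1,
      (anisoSq_sub_le 0 1 _ _).trans ?_⟩
    push_cast
    gcongr
    · exact h1.2
    · exact h2.2
  · refine ((lintegral_mono fun s => anisoSq_sub_le 1 1 (X s) (Y s)).trans_lt ?_).ne
    rw [lintegral_add_left' ((aemeasurable_anisoSq hX.aemeasurable_coeff 1 1).const_mul _),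
      lintegral_const_mul' _ _ (by finiteness), lintegral_const_mul' _ _ (by finiteness)]
    have h1 := hX.memL2_norm
    have h2 := hY.memL2_norm
    finiteness

theorem InSolutionClass.ae_divFree {T : ℝ} {X : ℝ → VField} (h : InSolutionClass T X) :
    ∀ᵐ s ∂volume.restrict (Set.Icc 0 T), IsDivFree (X s) ∧ anisoSq 0 0 (X s) ≠ ∞ := by
  obtain ⟨C, hC⟩ := h.memLinfty
  exact hC.mono fun s hs =>
    ⟨hs.1.2.1, ((anisoSq_zero_zero_le_one _).trans_lt hs.1.2.2).ne⟩

/-- With w = v - u, the difference B(v,v) - B(u,u) equals B(w,v) + B(u,w). -/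
theorem IsDeterministicSolution.eqOn {T : ℝ} (hT : 0 ≤ T) {u₀ : VField} {u v : ℝ → VField}
    (hv : IsDeterministicSolution T u₀ v) (hu : IsDeterministicSolution T u₀ u) :
    Set.EqOn v u (Set.Icc 0 T) := by
  refine InSolutionClass.eqOn_of_sub hT hv.1 hu.1 hv.1 hu.1 hv.2 hu.2 ?_
  filter_upwards [hv.1.ae_divFree, hu.1.ae_divFree] with s ⟨h1, h2⟩ ⟨h3, h4⟩
  rw [partialDeriv_sub, partialDeriv_sub, bilinB_sub_left h1 h3 h2 h4 h2,
    bilinB_sub_right h3 h4 h2 h4]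
  abel

theorem IsSkeletonSolution.eqOn {T : ℝ} (hT : 0 ≤ T) {σ : ℝ → VField → EllTwo →L[ℝ] VField}
    {u : ℝ → VField} {φ : ℝ → EllTwo} {X Y : ℝ → VField} (hu : InSolutionClass T u)
    (hY : IsSkeletonSolution T σ u φ Y) (hX : IsSkeletonSolution T σ u φ X) :
    Set.EqOn Y X (Set.Icc 0 T) := by
  refine InSolutionClass.eqOn_of_sub hT hY.1 hX.1 hu hu hY.2 hX.2 ?_
  filter_upwards [hY.1.ae_divFree, hX.1.ae_divFree, hu.ae_divFree]
    with s ⟨h1, h2⟩ ⟨h3, h4⟩ ⟨h5, h6⟩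
  rw [partialDeriv_sub, partialDeriv_sub, bilinB_sub_left h1 h3 h2 h4 h6,
    bilinB_sub_right h5 h6 h2 h4]
  abel

/-! ### The Hilbert–Schmidt forcing and existence for the skeleton equation -/

theorem enorm_ellTwo_sq (a : EllTwo) : ‖a‖ₑ ^ 2 = ∑' n, ‖a n‖ₑ ^ 2 := by
  have h := lp.hasSum_norm (p := 2) (by norm_num) a
  simp only [ENNReal.toReal_ofNat, Real.rpow_ofNat] at h
  have h1 := ENNReal.ofReal_tsum_of_nonneg (fun n => by positivity) h.summable
  rw [h.tsum_eq] at h1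
  simpa only [ENNReal.ofReal_pow (norm_nonneg _), ofReal_norm] using h1

theorem hasSum_apply_single (A : EllTwo →L[ℝ] VField) (a : EllTwo) (k : Freq) (j : Fin 2) :
    HasSum (fun n => (a n : ℂ) * A (lp.single 2 n 1) k j) (A a k j) := by
  have h := A.hasSum (lp.hasSum_single (p := 2) ENNReal.ofNat_ne_top a)
  have h' := Pi.hasSum.mp (Pi.hasSum.mp h k) j
  refine h'.congr_fun fun n => ?_
  have e : lp.single 2 n (a n) = a n • (lp.single 2 n (1 : ℝ) : EllTwo) := by
    rw [← lp.single_smul, smul_eq_mul, mul_one]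
  rw [e, map_smul, Pi.smul_apply, Pi.smul_apply, Complex.real_smul]

theorem enorm_apply_sq_le (A : EllTwo →L[ℝ] VField) (a : EllTwo) (k : Freq) (j : Fin 2) :
    ‖A a k j‖ₑ ^ 2 ≤ ‖a‖ₑ ^ 2 * ∑' n, ‖A (lp.single 2 n 1) k j‖ₑ ^ 2 := by
  have h : ‖A a k j‖ₑ ≤ ellTwoNorm (fun n => ‖a n‖ₑ) *
      ellTwoNorm (fun n => ‖A (lp.single 2 n 1) k j‖ₑ) := by
    rw [← (hasSum_apply_single A a k j).tsum_eq]
    refine enorm_tsum_le_tsum_enorm.trans (le_trans (le_of_eq ?_) (tsum_mul_le_ellTwoNorm _ _))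
    refine tsum_congr fun n => ?_
    rw [enorm_mul]
    congr 1
    simp [enorm_eq_nnnorm]
  calc _ ≤ (ellTwoNorm (fun n => ‖a n‖ₑ) *
      ellTwoNorm (fun n => ‖A (lp.single 2 n 1) k j‖ₑ)) ^ 2 := by gcongr
    _ = _ := by rw [mul_pow, ellTwoNorm_sq, ellTwoNorm_sq, ← enorm_ellTwo_sq]

/-- The operator norm is bounded by the Hilbert-Schmidt norm. -/
theorem anisoSq_apply_le (s s' : ℝ) (A : EllTwo →L[ℝ] VField) (a : EllTwo) :
    anisoSq s s' (A a) ≤ ‖a‖ₑ ^ 2 * hilbertSchmidtSq (anisoSq s s') A := by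
  simp only [hilbertSchmidtSq, anisoSq]
  rw [ENNReal.tsum_comm, ← ENNReal.tsum_mul_left]
  refine ENNReal.tsum_le_tsum fun k => ?_
  rw [ENNReal.tsum_mul_left, mul_left_comm]
  gcongr
  rw [Summable.tsum_finsetSum fun _ _ => ENNReal.summable, Finset.mul_sum]
  exact Finset.sum_le_sum fun j _ => enorm_apply_sq_le A a k j

/-- Measurability of σ is given for each fixed argument in l². Since φ(s) varies, it is expanded in
the standard basis, and the coefficient is a limit of finite sums of products of measurable
functions. -/
theorem aemeasurable_apply {T : ℝ} {σ : ℝ → VField → EllTwo →L[ℝ] VField}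
    (hσ : MeasurableCoeff T σ) {u : ℝ → VField} (hu : ∀ k j, Continuous fun t => u t k j)
    (huH : ∀ t ∈ Set.Icc 0 T, u t ∈ SpaceH) {φ : ℝ → EllTwo}
    (hφ : AEStronglyMeasurable φ (volume.restrict (Set.Icc 0 T))) (k : Freq) (j : Fin 2) :
    AEMeasurable (fun s => σ s (u s) (φ s) k j) (volume.restrict (Set.Icc 0 T)) := by
  have huc : Continuous u := continuous_pi fun k => continuous_pi fun j => hu k j
  have hcoef : ∀ a : EllTwo, AEMeasurable (fun s => σ s (u s) a k j)
      (volume.restrict (Set.Icc 0 T)) := fun a => by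
    refine aemeasurable_restrict_of_measurable_subtype measurableSet_Icc ?_
    have hpair : Measurable fun s : Set.Icc (0 : ℝ) T =>
        ((s, ⟨u s, huH s s.2⟩) : Set.Icc (0 : ℝ) T × SpaceH) :=
      measurable_id.prodMk ((huc.measurable.comp measurable_subtype_coe).subtype_mk)
    exact (measurable_pi_apply j).comp ((measurable_pi_apply k).comp ((hσ a).comp hpair))
  have hcoord : ∀ n, AEMeasurable (fun s => φ s n) (volume.restrict (Set.Icc 0 T)) := fun n =>
    ((lp.evalCLM ℝ (fun _ : ℕ => ℝ) 2 n).continuous.comp_aestronglyMeasurable hφ).aemeasurable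
  refine aemeasurable_of_tendsto_metrizable_ae atTop
    (f := fun (N : ℕ) s => ∑ n ∈ Finset.range N, (φ s n : ℂ) * σ s (u s) (lp.single 2 n 1) k j)
    (fun N => Finset.aemeasurable_fun_sum _ fun n _ =>
      (Complex.measurable_ofReal.comp_aemeasurable (hcoord n)).mul (hcoef _)) ?_
  exact Eventually.of_forall fun s => (hasSum_apply_single _ _ k j).tendsto_sum_nat

theorem anisoSq_partialDeriv_zero_le (u : VField) :
    anisoSq 0 0 (partialDeriv 0 u) ≤ anisoSq 1 1 u := by
  have e := anisoSq_natCast 1 1 u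
  rw [Nat.cast_one] at e
  rw [e, anisoSq_zero_zero]
  refine ENNReal.tsum_le_tsum fun k => ?_
  rw [ampSq_partialDeriv]
  gcongr
  simp only [anisoWeight, pow_one]
  nlinarith [sq_nonneg (k 0 : ℝ), sq_nonneg (k 1 : ℝ),
    mul_nonneg (sq_nonneg (k 0 : ℝ)) (sq_nonneg (k 1 : ℝ))]

theorem anisoSq_partialDeriv_zero_one_le (u : VField) :
    anisoSq 0 0 (partialDeriv 0 (partialDeriv 1 u)) ≤ anisoSq 1 1 u := by
  have e := anisoSq_natCast 1 1 u
  rw [Nat.cast_one] at e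
  rw [e, anisoSq_zero_zero]
  refine ENNReal.tsum_le_tsum fun k => ?_
  rw [ampSq_partialDeriv, ampSq_partialDeriv, ← mul_assoc,
    ← ENNReal.ofReal_mul (sq_nonneg _)]
  gcongr
  simp only [anisoWeight, pow_one]
  nlinarith [sq_nonneg (k 0 : ℝ), sq_nonneg (k 1 : ℝ)]

/-- The forcing term of the skeleton equation agrees almost everywhere with a real divergence-free
field with an integrable bound in `H^{0,1}`. -/
theorem exists_forcing {T : ℝ} (hT : 0 ≤ T) {σ : ℝ → VField → EllTwo →L[ℝ] VField}
    (hσ : MeasurableCoeff T σ) (hA2 : GrowthA2 T σ) {u : ℝ → VField}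
    (hc : ∀ k j, Continuous fun t => u t k j) (hu : InSolutionClass T u)
    (huH : ∀ t ∈ Set.Icc 0 T, u t ∈ SpaceH) {φ : ℝ → EllTwo}
    (hφ : MemLp φ 2 (volume.restrict (Set.Icc 0 T))) :
    ∃ (f : ℝ → VField) (r : ℝ → ℝ),
      (∀ᵐ s ∂volume.restrict (Set.Icc 0 T), f s = σ s (u s) (φ s)) ∧
      (∀ s, IsRealField (f s)) ∧ (∀ s, IsDivFree (f s)) ∧ (∀ s, 0 ≤ r s) ∧
      IntervalIntegrable r volume 0 T ∧
      (∀ s, anisoSq 0 1 (f s) ≤ ENNReal.ofReal (r s ^ 2)) ∧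
      ∀ k j, IntervalIntegrable (fun s => f s k j) volume 0 T := by
  classical
  obtain ⟨K₀, K₁, K₂, hK⟩ := hA2
  set κ : ℝ → ℝ≥0∞ := fun s => K₀ + (K₁ + 2 * K₂) * anisoSq 1 1 (u s) with hκ
  have hum := aemeasurable_anisoSq hu.aemeasurable_coeff 1 1
  have hκm : AEMeasurable κ (volume.restrict (Set.Icc 0 T)) :=
    aemeasurable_const.add (hum.const_mul _)
  have hκi : ∫⁻ s in Set.Icc 0 T, κ s ≠ ∞ := by
    rw [hκ, lintegral_add_left measurable_const, lintegral_const_mul' _ _ (by finiteness),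
      lintegral_const]
    have := hu.memL2_norm
    finiteness
  -- Both summands are integrable in time, and ‖φ‖²κ ≤ (κ + ‖φ‖²)², so r bounds the H^{0,1} norm of
  -- the forcing.
  set r : ℝ → ℝ := fun s => (κ s).toReal + ‖φ s‖ ^ 2 with hr
  have hr0 : ∀ s, 0 ≤ r s := fun s => by positivity
  have hri : Integrable r (volume.restrict (Set.Icc 0 T)) :=
    (integrable_toReal_of_lintegral_ne_top hκm hκi).add (hφ.integrable_norm_pow two_ne_zero)
  -- (A2) controls σ(s,u(s)) only when u(s) lies in H̃^{1,1}, that is for almost every s. Setting f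
  -- = 0 on the exceptional set makes the bounds valid everywhere without changing the integrals.
  set f : ℝ → VField := fun s =>
    if s ∈ Set.Icc 0 T ∧ u s ∈ AnisoSpace 1 1 then σ s (u s) (φ s) else 0 with hf
  have hfe : ∀ᵐ s ∂volume.restrict (Set.Icc 0 T), f s = σ s (u s) (φ s) := by
    filter_upwards [hu.memL2, ae_restrict_mem measurableSet_Icc] with s h1 h2
    simp only [hf, if_pos (And.intro h2 h1)]
  have hfH : ∀ s, f s ∈ AnisoSpace 0 1 := fun s => by
    by_cases h : s ∈ Set.Icc 0 T ∧ u s ∈ AnisoSpace 1 1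
    · simp only [hf, if_pos h]
      exact (hK s h.1 (u s) h.2).1 _
    · simp only [hf, if_neg h]
      exact ⟨isRealField_zero, isDivFree_zero, by simp [anisoSq]⟩
  have hfr : ∀ s, anisoSq 0 1 (f s) ≤ ENNReal.ofReal (r s ^ 2) := fun s => by
    by_cases h : s ∈ Set.Icc 0 T ∧ u s ∈ AnisoSpace 1 1
    swap
    · simp only [hf, if_neg h]
      simp [anisoSq]
    simp only [hf, if_pos h]
    have hκs : κ s ≠ ∞ := by
      have := h.2.2.2
      simp only [hκ]
      finiteness
    have h1 : hilbertSchmidtSq (anisoSq 0 1) (σ s (u s)) ≤ κ s := by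
      refine ((hK s h.1 (u s) h.2).2).trans ?_
      have h01 : anisoSq 0 1 (u s) ≤ anisoSq 1 1 (u s) := by
        simpa using anisoSq_mono (zero_le_one (α := ℕ)) (le_refl 1) (u s)
      calc _ ≤ K₀ + K₁ * anisoSq 1 1 (u s) + K₂ * (anisoSq 1 1 (u s) + anisoSq 1 1 (u s)) := by
            gcongr
            · exact anisoSq_partialDeriv_zero_le _
            · exact anisoSq_partialDeriv_zero_one_le _
        _ = κ s := by
            simp only [hκ]
            ring
    refine (anisoSq_apply_le 0 1 _ _).trans ?_
    calc ‖φ s‖ₑ ^ 2 * hilbertSchmidtSq (anisoSq 0 1) (σ s (u s)) ≤ ‖φ s‖ₑ ^ 2 * κ s := by gcongr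
      _ = ENNReal.ofReal (‖φ s‖ ^ 2 * (κ s).toReal) := by
          rw [ENNReal.ofReal_mul (by positivity), ENNReal.ofReal_toReal hκs,
            ENNReal.ofReal_pow (norm_nonneg _), ofReal_norm]
      _ ≤ ENNReal.ofReal (r s ^ 2) := by
          refine ENNReal.ofReal_le_ofReal ?_
          have h2 : 0 ≤ ‖φ s‖ ^ 2 := by positivity
          have h3 : 0 ≤ (κ s).toReal := ENNReal.toReal_nonneg
          simp only [hr]
          nlinarith
  refine ⟨f, r, hfe, fun s => (hfH s).1, fun s => (hfH s).2.1, hr0, ?_, hfr, fun k j => ?_⟩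
  · rw [intervalIntegrable_iff_integrableOn_Icc_of_le hT]
    exact hri
  · rw [intervalIntegrable_iff_integrableOn_Icc_of_le hT]
    refine Integrable.mono' hri ?_ (Eventually.of_forall fun s => ?_)
    · refine ((aemeasurable_apply hσ hc huH hφ.aestronglyMeasurable k j).congr
        (hfe.mono fun s hs => ?_)).aestronglyMeasurable
      simp only [hs]
    · have h1 : ‖f s k j‖ₑ ^ 2 ≤ ENNReal.ofReal (r s ^ 2) :=
        (enorm_sq_le_ampSq _ k j).trans ((ENNReal.le_tsum k).trans
          ((anisoSq_zero_zero _).symm.trans_le ((anisoSq_zero_zero_le_one _).trans (hfr s))))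
      rw [← ofReal_norm, ← ENNReal.ofReal_pow (norm_nonneg _),
        ENNReal.ofReal_le_ofReal_iff (by positivity)] at h1
      exact abs_le_of_sq_le_sq' h1 (hr0 s) |>.2

theorem driftField_zero (u v : VField) :
    driftField 0 u v = partialDeriv 0 (partialDeriv 0 u) - bilinB u v - bilinB v u := by
  simp [driftField]

/-- Existence of solutions of the linearized skeleton equation. -/
theorem exists_skeletonSolution {T : ℝ} (hT : 0 ≤ T) {σ : ℝ → VField → EllTwo →L[ℝ] VField}
    (hσ : MeasurableCoeff T σ) (hA2 : GrowthA2 T σ) {u : ℝ → VField} {C : ℝ≥0}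
    (hc : ∀ k j, Continuous fun t => u t k j) (hu : InSolutionClass T u)
    (hur : ∀ t, IsRealField (u t)) (hud : ∀ t, IsDivFree (u t))
    (huC : ∀ t ∈ Set.Icc 0 T, anisoSq 0 2 (u t) ≤ C)
    (hu1 : ∫⁻ s in Set.Icc 0 T, anisoSq 1 1 (u s) ≤ C) {φ : ℝ → EllTwo}
    (hφ : MemLp φ 2 (volume.restrict (Set.Icc 0 T))) :
    ∃ X, IsSkeletonSolution T σ u φ X := by
  have huC0 : ∀ t ∈ Set.Icc 0 T, anisoSq 0 0 (u t) ≤ C := fun t ht => by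
    have h := anisoSq_mono (le_refl 0) (zero_le_two (α := ℕ)) (u t)
    simp only [Nat.cast_zero, Nat.cast_ofNat] at h
    exact h.trans (huC t ht)
  obtain ⟨f, r, hfe, hfr, hfd, hr0, hri, hfb, hfi⟩ := exists_forcing hT hσ hA2 hc hu
    (fun t ht => ⟨hur t, hud t, (huC0 t ht).trans_lt ENNReal.coe_lt_top⟩) hφ
  have hfb1 : ∀ n s, boxSq n (anisoWeight 0 1) (f s) ≤ r s ^ 2 := fun n s => by
    have h := ofReal_boxSq_le n (f s) 0 1
    rw [Nat.cast_zero, Nat.cast_one] at h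
    exact (ENNReal.ofReal_le_ofReal_iff (by positivity)).mp (h.trans (hfb s))
  have huc : ∀ k j, ContinuousOn (fun s => u s k j) (Set.Icc 0 T) :=
    fun k j => (hc k j).continuousOn
  have hex : ∀ n, ∃ U, IsGalerkinSolution n T 0 (fun _ => 1) (fun s => trunc n (u s)) f 0 U :=
    fun n => exists_isGalerkinSolution n hT 0 isRealField_zero isDivFree_zero hur hud huc hfr hfd
      (fun k _ j => hfi k j) hr0 hri
      fun s => (boxSq_anisoWeight_mono le_rfl zero_le_one (f s)).trans (hfb1 n s)
  choose U hU using hex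
  have hV : ∀ n s, IsBoxField n (trunc n (u s)) := fun n s => isBoxField_trunc n (hur s) (hud s)
  have hVc : ∀ n k j, ContinuousOn (fun s => trunc n (u s) k j) (Set.Icc 0 T) :=
    fun n => continuousOn_trunc huc n
  -- The exponent comes from the full field u: truncation does not increase norms, so one N serves
  -- for all n. The H^{0,2} norm is bounded in time and gives the term with T, while the H^{1,1}
  -- norm is integrated.
  obtain ⟨N, hN⟩ := exists_nat_ge (2 * ((2 + 41472 * C) * T + 41472 * C +
    ∫ s in (0 : ℝ)..T, r s))
  have hNn : ∀ n, ∫ s in (0 : ℝ)..T, (2 + 41472 * (boxSq n (anisoWeight 1 1) (trunc n (u s)) +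
      boxSq n (anisoWeight 0 2) (trunc n (u s))) + r s) ≤ N / 2 := fun n => by
    have h11 : ∫ s in (0 : ℝ)..T, boxSq n (anisoWeight 1 1) (trunc n (u s)) ≤ C := by
      have e := lintegral_anisoSq_eq_ofReal hT (fun t => (hV n t).supp) (hVc n) 1 1
      rw [Nat.cast_one] at e
      have h := e.symm.trans_le ((lintegral_mono fun s => anisoSq_trunc_le n (u s) 1 1).trans hu1)
      rw [← ENNReal.ofReal_coe_nnreal] at h
      exact (ENNReal.ofReal_le_ofReal_iff C.coe_nonneg).mp h
    have h02 : ∀ s ∈ Set.Icc 0 T, boxSq n (anisoWeight 0 2) (trunc n (u s)) ≤ C := fun s hs => by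
      have h := ofReal_boxSq_le n (trunc n (u s)) 0 2
      rw [Nat.cast_zero, Nat.cast_ofNat] at h
      have h' := h.trans ((anisoSq_trunc_le n (u s) 0 2).trans (huC s hs))
      rw [← ENNReal.ofReal_coe_nnreal] at h'
      exact (ENNReal.ofReal_le_ofReal_iff C.coe_nonneg).mp h'
    have hi11 : IntervalIntegrable (fun s => boxSq n (anisoWeight 1 1) (trunc n (u s)))
        volume 0 T := (continuousOn_boxSq _ (hVc n)).intervalIntegrable_of_Icc hT
    have hi02 : IntervalIntegrable (fun s => boxSq n (anisoWeight 0 2) (trunc n (u s)))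
        volume 0 T := (continuousOn_boxSq _ (hVc n)).intervalIntegrable_of_Icc hT
    have hle : ∫ s in (0 : ℝ)..T, (2 + 41472 * (boxSq n (anisoWeight 1 1) (trunc n (u s)) +
        boxSq n (anisoWeight 0 2) (trunc n (u s))) + r s) ≤
        ∫ s in (0 : ℝ)..T, ((2 + 41472 * C) +
          41472 * boxSq n (anisoWeight 1 1) (trunc n (u s)) + r s) := by
      refine intervalIntegral.integral_mono_on hT
        ((intervalIntegrable_const.add ((hi11.add hi02).const_mul _)).add hri)
        ((intervalIntegrable_const.add (hi11.const_mul _)).add hri) fun s hs => ?_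
      have := h02 s hs
      linarith
    rw [intervalIntegral.integral_add (intervalIntegrable_const.add (hi11.const_mul _)) hri,
      intervalIntegral.integral_add intervalIntegrable_const (hi11.const_mul _),
      intervalIntegral.integral_const, intervalIntegral.integral_const_mul, smul_eq_mul,
      sub_zero] at hle
    linarith
  have hen : ∀ n, ∀ t ∈ Set.Icc 0 T, boxSq n (anisoWeight 0 1) (U n t) +
      ∫ s in (0 : ℝ)..t, boxSq n (anisoWeight 1 1) (U n s) ≤
        (∫ s in (0 : ℝ)..T, r s) * 2 ^ N := fun n t ht =>
    (hU n).linear_energy (hV n) (hVc n) hr0 hri (hfb1 n) (hNn n) ht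
  set D : ℝ≥0 := max C (Real.toNNReal ((∫ s in (0 : ℝ)..T, r s) * 2 ^ N)) with hD
  have hCD : (C : ℝ≥0∞) ≤ D := by exact_mod_cast le_max_left _ _
  have hDle : ∀ x : ℝ, x ≤ (∫ s in (0 : ℝ)..T, r s) * 2 ^ N → ENNReal.ofReal x ≤ D :=
    fun x hx => (ENNReal.ofReal_le_ofReal hx).trans (ENNReal.coe_le_coe.mpr (le_max_right _ _))
  have hB1 : ∀ n, ∀ t ∈ Set.Icc 0 T, anisoSq 0 1 (U n t) ≤ D := fun n t ht => by
    have e := anisoSq_eq_boxSq ((hU n).isBox t).supp 0 1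
    rw [Nat.cast_zero, Nat.cast_one] at e
    rw [e]
    refine hDle _ (le_trans ?_ (hen n t ht))
    exact le_add_of_nonneg_right (intervalIntegral.integral_nonneg ht.1
      fun s _ => boxSq_anisoWeight_nonneg n 1 1 _)
  have hB11 : ∀ n, ∫⁻ s in Set.Icc 0 T, anisoSq 1 1 (U n s) ≤ D := fun n => by
    have e := lintegral_anisoSq_eq_ofReal hT (fun t => ((hU n).isBox t).supp) (hU n).cont 1 1
    rw [Nat.cast_one] at e
    rw [e]
    exact hDle _ ((le_add_of_nonneg_left (boxSq_anisoWeight_nonneg n 0 1 _)).trans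
      (hen n T ⟨hT, le_rfl⟩))
  obtain ⟨ψ, X, hψ, hXc, hXr, hXd, hX, hsol⟩ := exists_galerkin_limit hT hU hud huc
    (fun s hs => (huC0 s hs).trans hCD) (hu1.trans hCD) hfi
    (fun n t ht => (anisoSq_zero_zero_le_one _).trans (hB1 n t ht)) hB11
  have hX' : ∀ t ∈ Set.Icc 0 T, ∀ k j, Tendsto (fun n => U (ψ n) t k j) atTop (𝓝 (X t k j)) :=
    fun t ht k j => by
      have := hX t k j
      rwa [Set.projIcc_of_mem hT ht] at this
  refine ⟨X, inSolutionClass_of_continuous hXc hXr hXd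
    (fun t ht => anisoSq_le_of_tendsto (hX' t ht) fun n => hB1 (ψ n) t ht)
    (lintegral_anisoSq_le_of_tendsto
      (fun n k j => ((hU (ψ n)).cont k j).aemeasurable measurableSet_Icc)
      ((ae_restrict_mem measurableSet_Icc).mono hX') fun n => hB11 (ψ n)), ?_⟩
  refine hsol.congr_ae hT ?_
  filter_upwards [hfe] with s hs
  rw [driftField_zero, hs]

end AnisoNS

end

theorem mainTheorem5 (T : ℝ) (hT : 0 < T)
    (σ : ℝ → AnisoNS.VField → AnisoNS.EllTwo →L[ℝ] AnisoNS.VField)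
    (hσ : AnisoNS.MeasurableCoeff T σ)
    (hA0 : AnisoNS.GrowthA0 T σ) (hA1 : AnisoNS.GrowthA1 T σ) (hA2 : AnisoNS.GrowthA2 T σ)
    (u₀ : AnisoNS.VField) (hu₀ : u₀ ∈ AnisoNS.AnisoSpace 0 2)
    (φ : ℝ → AnisoNS.EllTwo) (hφ : MemLp φ 2 (volume.restrict (Set.Icc 0 T))) :
    ∃ u : ℝ → AnisoNS.VField,
      (AnisoNS.IsDeterministicSolution T u₀ u ∧
        ∀ v, AnisoNS.IsDeterministicSolution T u₀ v → Set.EqOn v u (Set.Icc 0 T)) ∧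
      ∃ X : ℝ → AnisoNS.VField,
        AnisoNS.IsSkeletonSolution T σ u φ X ∧
        ∀ Y, AnisoNS.IsSkeletonSolution T σ u φ Y → Set.EqOn Y X (Set.Icc 0 T) := by
  -- The constructed solution carries the extra H^{0,2} bound, which membership in the solution
  -- class alone does not provide and which the skeleton equation needs.
  obtain ⟨u, C, hu, huc, hur, hud, huC, hu1⟩ := AnisoNS.exists_deterministicSolution hT.le hu₀
  obtain ⟨X, hX⟩ := AnisoNS.exists_skeletonSolution hT.le hσ hA2 huc hu.1 hur hud huC hu1 hφ
  exact ⟨u, ⟨hu, fun v hv => hv.eqOn hT.le hu⟩, X, hX, fun Y hY => hY.eqOn hT.le hu.1 hX⟩
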